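/- Let $\mathrm{O}_n$ be the orthogonal group of Euclidean space $\mathbb{R}^n$. An element of $\mathrm{O}_n$ is a *reflection* (*rotation*) if its fixed point subspace has codimension one (two). A *reflection group* is a finite subgroup of $\mathrm{O}_n$ generated by reflections; a *reflection-rotation group* is a finite subgroup of $\mathrm{O}_n$ generated by reflections and rotations. For a finite $G<\mathrm{O}_n$, the orbit space $\mathbb{R}^n/G$ carries the unique PL structure for which the projection $\mathbb{R}^n\to\mathbb{R}^n/G$ is piecewise linear. We say that *the main theorem holds for $G$* if this PL structure exists and the following is true: $\mathbb{R}^n/G$ is a PL $n$-manifold with (possibly empty) boundary if and only if $G$ is a reflection-rotation group, and in this case either $\mathbb{R}^n/G$ is PL homeomorphic to the half space $\mathbb{R}^{n-1}\times\mathbb{R}_{\ge 0}$ and $G$ contains a reflection, or $\mathbb{R}^n/G$ is PL homeomorphic to $\mathbb{R}^n$ and $G$ contains no reflection. We say that *the PL linearization principle can be applied to $H\triangleleft G$* if $H$ is a normal subgroup of $G<\mathrm{O}_n$ and there are a PL homeomorphism $F:\mathbb{R}^n/H\to\mathbb{R}^n$ and a homomorphism $r:G\to\mathrm{O}_n$ with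 kernel $H$ such that $F(g\cdot\bar x)=r(g)F(\bar x)$ for all $g\in G$ and $\bar x\in\mathbb{R}^n/H$. Let $W<\mathrm{O}_n$ be a reflection group and let $W^{+}$ be its subgroup of elements of determinant one. Then the main theorem holds for $W$ and for $W^+$, and the PL linearization principle can be applied to $W^+\triangleleft W$. Let moreover $h\in\mathrm{O}_n\setminus W$ be a rotation that normalizes $W$, put $W^{\times}=\langle W,h\rangle$ and $W^{\oplus}=\langle W^{+},h\rangle$, and assume that $W^\times$ is finite (this is automatic if $W$ fixes no nonzero vector). Then the main theorem holds for $W^{\oplus}$ and for $W^{\times}$, and the PL linearization principle can be applied to $W^{+}\triangleleft W^{\times}$ and to $W^{\oplus}\triangleleft W^{\times}$. In particular, for every $n$ the PL linearization principle can be applied to $W^{+}(\mathrm{D}_n)\triangleleft W(\mathrm{BC}_n)$, where $W(\mathrm{D}_n)$ is generated by the reflections in the hyperplanes orthogonal to the vectors $e_i\pm e_j$, $i\neq j$, and $W(\mathrm{BC}_n)$ is generated by these and the reflections in the coordinate hyperplanes $e_i^{\perp}$. -/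

import Mathlib

noncomputable section

open Set Topology

namespace PLQuot

/-! ### Polyhedra -/

section Polyhedra

variable {E F : Type*} [NormedAddCommGroup E] [NormedSpace ℝ E]
  [NormedAddCommGroup F] [NormedSpace ℝ F]

/-- A subset `P` is a polyhedron if every point of `P` has a neighbourhood in `P` that is a union
of finitely many simplices contained in `P`. -/
def IsPolyhedron (P : Set E) : Prop :=
  ∀ x ∈ P, ∃ T : Finset (Finset E),
    (∀ s ∈ T, AffineIndependent ℝ ((↑) : s → E) ∧ convexHull ℝ (s : Set E) ⊆ P) ∧
    (⋃ s ∈ T, convexHull ℝ (s : Set E)) ∈ 𝓝[P] x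

/-- Finite unions of convex hulls of finite sets; by `isFinUnion_iff` these are precisely the
compact polyhedra. -/
def IsFinUnion (P : Set E) : Prop :=
  ∃ T : Finset (Finset E), P = ⋃ s ∈ T, convexHull ℝ (s : Set E)

theorem isFinUnion_iUnion {ι : Type*} (I : Finset ι) (Q : ι → Set E)
    (h : ∀ i ∈ I, IsFinUnion (Q i)) : IsFinUnion (⋃ i ∈ I, Q i) := by
  classical
  choose! T hT using h
  refine ⟨I.biUnion T, ?_⟩
  ext x
  simp only [mem_iUnion, Finset.mem_biUnion]
  constructor
  · rintro ⟨i, hi, hx⟩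
    rw [hT i hi] at hx
    simp only [mem_iUnion] at hx
    obtain ⟨s, hs, hx⟩ := hx
    exact ⟨s, ⟨i, hi, hs⟩, hx⟩
  · rintro ⟨s, ⟨i, hi, hs⟩, hx⟩
    refine ⟨i, hi, ?_⟩
    rw [hT i hi]
    simp only [mem_iUnion]
    exact ⟨s, hs, hx⟩

theorem isFinUnion_convexHull {S : Set E} (hS : S.Finite) : IsFinUnion (convexHull ℝ S) :=
  ⟨{hS.toFinset}, by simp⟩

theorem IsFinUnion.exists_simplices {P : Set E} (h : IsFinUnion P) :
    ∃ T : Finset (Finset E), (∀ s ∈ T, AffineIndependent ℝ ((↑) : s → E)) ∧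
      P = ⋃ s ∈ T, convexHull ℝ (s : Set E) := by
  classical
  obtain ⟨T, rfl⟩ := h
  refine ⟨T.biUnion fun s => s.powerset.filter fun t => AffineIndependent ℝ ((↑) : t → E),
    ?_, ?_⟩
  · intro s hs
    simp only [Finset.mem_biUnion, Finset.mem_filter] at hs
    obtain ⟨_, _, _, h⟩ := hs
    exact h
  · ext x
    simp only [mem_iUnion, Finset.mem_biUnion, Finset.mem_filter, Finset.mem_powerset]
    constructor
    · rintro ⟨s, hs, hx⟩
      rw [convexHull_eq_union] at hx
      simp only [mem_iUnion] at hx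
      obtain ⟨t, hts, hti, hx⟩ := hx
      exact ⟨t, ⟨s, hs, by exact_mod_cast hts, hti⟩, hx⟩
    · rintro ⟨t, ⟨s, hs, hts, _⟩, hx⟩
      exact ⟨s, hs, convexHull_mono (by exact_mod_cast hts) hx⟩

theorem isPolyhedron_of_local {P : Set E}
    (h : ∀ x ∈ P, ∃ Q, IsFinUnion Q ∧ Q ⊆ P ∧ Q ∈ 𝓝[P] x) : IsPolyhedron P := by
  intro x hx
  obtain ⟨Q, hQ, hQP, hn⟩ := h x hx
  obtain ⟨T, hT, rfl⟩ := hQ.exists_simplices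
  exact ⟨T, fun s hs => ⟨hT s hs, (subset_biUnion_of_mem (u := fun s : Finset E =>
    convexHull ℝ (s : Set E)) hs).trans hQP⟩, hn⟩

theorem IsPolyhedron.local {P : Set E} (h : IsPolyhedron P) :
    ∀ x ∈ P, ∃ Q, IsFinUnion Q ∧ Q ⊆ P ∧ Q ∈ 𝓝[P] x := by
  intro x hx
  obtain ⟨T, hT, hn⟩ := h x hx
  exact ⟨_, ⟨T, rfl⟩, iUnion₂_subset fun s hs => (hT s hs).2, hn⟩

theorem IsFinUnion.isCompact {P : Set E} (h : IsFinUnion P) : IsCompact P := by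
  obtain ⟨T, rfl⟩ := h
  exact T.isCompact_biUnion fun s _ => s.finite_toSet.isCompact_convexHull ℝ

theorem IsFinUnion.isPolyhedron {P : Set E} (h : IsFinUnion P) : IsPolyhedron P :=
  isPolyhedron_of_local fun _ _ => ⟨P, h, Subset.rfl, self_mem_nhdsWithin⟩

/-- A compact subset of a polyhedron lies in a compact polyhedron inside it. -/
theorem IsPolyhedron.exists_finUnion {P K : Set E} (hP : IsPolyhedron P) (hK : IsCompact K)
    (hKP : K ⊆ P) : ∃ Q, IsFinUnion Q ∧ K ⊆ Q ∧ Q ⊆ P := by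
  classical
  have := hP.local
  choose! Q hQ hQP hn using this
  obtain ⟨t, ht, htK⟩ := hK.elim_nhdsWithin_subcover Q
    fun x hx => nhdsWithin_mono x hKP (hn x (hKP hx))
  exact ⟨⋃ x ∈ t, Q x, isFinUnion_iUnion t Q fun x hx => hQ x (hKP (ht x hx)), htK,
    iUnion₂_subset fun x hx => hQP x (hKP (ht x hx))⟩

theorem isFinUnion_iff {P : Set E} : IsFinUnion P ↔ IsCompact P ∧ IsPolyhedron P := by
  refine ⟨fun h => ⟨h.isCompact, h.isPolyhedron⟩, fun ⟨hc, hp⟩ => ?_⟩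
  obtain ⟨Q, hQ, h1, h2⟩ := hp.exists_finUnion hc Subset.rfl
  rwa [h1.antisymm h2]

theorem IsFinUnion.image {P : Set E} (h : IsFinUnion P) (f : E →ₗ[ℝ] F) :
    IsFinUnion (f '' P) := by
  obtain ⟨T, rfl⟩ := h
  rw [image_iUnion₂]
  refine isFinUnion_iUnion T _ fun s _ => ?_
  rw [f.image_convexHull]
  exact isFinUnion_convexHull (s.finite_toSet.image f)

theorem IsFinUnion.prod {P : Set E} {Q : Set F} (hP : IsFinUnion P) (hQ : IsFinUnion Q) :
    IsFinUnion (P ×ˢ Q) := by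
  obtain ⟨T, rfl⟩ := hP
  obtain ⟨U, rfl⟩ := hQ
  have : (⋃ s ∈ T, convexHull ℝ (s : Set E)) ×ˢ (⋃ s ∈ U, convexHull ℝ (s : Set F)) =
      ⋃ i ∈ T ×ˢ U, convexHull ℝ ((i.1 : Set E) ×ˢ (i.2 : Set F)) := by
    ext x
    simp only [mem_prod, mem_iUnion, Finset.mem_product, convexHull_prod, Prod.exists]
    constructor
    · rintro ⟨⟨s, hs, h1⟩, ⟨t, ht, h2⟩⟩
      exact ⟨s, t, ⟨hs, ht⟩, h1, h2⟩
    · rintro ⟨s, t, ⟨hs, ht⟩, h1, h2⟩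
      exact ⟨⟨s, hs, h1⟩, ⟨t, ht, h2⟩⟩
  rw [this]
  exact isFinUnion_iUnion _ _ fun i _ =>
    isFinUnion_convexHull (i.1.finite_toSet.prod i.2.finite_toSet)

theorem finite_extremePoints_stdSimplex_inter {ι : Type*} [Fintype ι]
    (A : (ι → ℝ) →ₗ[ℝ] F) :
    (extremePoints ℝ (stdSimplex ℝ ι ∩ {w | A w = 0})).Finite := by
  classical
  refine Finite.of_finite_image (f := fun w : ι → ℝ => {i | w i ≠ 0})
    (Set.toFinite _) ?_
  intro w hw w' hw' hs
  simp only at hs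
  have hsupp : ∀ i, w i = 0 → w' i = 0 := by
    intro i hi
    by_contra hne
    have : i ∈ {i | w i ≠ 0} := by rw [hs]; exact hne
    exact this hi
  obtain ⟨⟨⟨hw0, hw1⟩, hwA⟩, hext⟩ := mem_extremePoints.1 hw
  obtain ⟨⟨⟨hw0', hw1'⟩, hwA'⟩, -⟩ := mem_extremePoints.1 hw'
  simp only [mem_ofPred_eq] at hwA hwA'
  -- a small step from `w` away from `w'` stays inside
  obtain ⟨ε, hε, hεw⟩ : ∃ ε : ℝ, 0 < ε ∧ ∀ i, ε * w' i ≤ w i := by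
    by_cases hne : Nonempty ι
    · have : ∀ i, ∃ e : ℝ, 0 < e ∧ e * w' i ≤ w i := by
        intro i
        rcases eq_or_lt_of_le (hw0 i) with h | h
        · exact ⟨1, one_pos, by rw [hsupp i h.symm, ← h]; simp⟩
        · refine ⟨w i / (w' i + 1), by have := hw0' i; positivity, ?_⟩
          have h' := hw0' i
          rw [div_mul_eq_mul_div, div_le_iff₀ (by positivity)]
          nlinarith
      choose e he hew using this
      refine ⟨Finset.univ.inf' Finset.univ_nonempty e, by simpa using he, fun i => ?_⟩
      exact (mul_le_mul_of_nonneg_right (Finset.inf'_le e (Finset.mem_univ i)) (hw0' i)).trans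
        (hew i)
    · exact ⟨1, one_pos, fun i => (hne ⟨i⟩).elim⟩
  have hu : w + ε • (w - w') ∈ stdSimplex ℝ ι ∩ {w | A w = 0} := by
    refine ⟨⟨fun i => ?_, ?_⟩, ?_⟩
    · have h1 := hw0 i
      have h2 := hεw i
      simp only [Pi.add_apply, Pi.smul_apply, Pi.sub_apply, smul_eq_mul]
      nlinarith
    · simp [Finset.sum_add_distrib, ← Finset.mul_sum, Finset.sum_sub_distrib, hw1, hw1']
    · simp [hwA, hwA']
  have hw'm : w' ∈ stdSimplex ℝ ι ∩ {w | A w = 0} := ⟨⟨hw0', hw1'⟩, hwA'⟩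
  refine ((hext _ hu _ hw'm ?_).2).symm
  refine ⟨1 / (1 + ε), ε / (1 + ε), by positivity, by positivity, by field_simp, ?_⟩
  ext i
  simp only [Pi.add_apply, Pi.smul_apply, Pi.sub_apply, smul_eq_mul]
  field_simp
  ring

theorem IsFinUnion.inter_ker {P : Set E} (h : IsFinUnion P) (L : E →ₗ[ℝ] F)
    (hL : Continuous L) : IsFinUnion (P ∩ {x | L x = 0}) := by
  obtain ⟨T, rfl⟩ := h
  rw [iUnion₂_inter]
  refine isFinUnion_iUnion T _ fun s _ => ?_
  rw [s.finite_toSet.convexHull_eq_image]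
  let _ := s.finite_toSet.fintype
  set f : (↑(s : Set E) → ℝ) →ₗ[ℝ] E := ∑ x : ↑(s : Set E), (LinearMap.proj (R := ℝ)
    (φ := fun _ : ↑(s : Set E) => ℝ) x).smulRight (x : E) with hf
  have hfc : Continuous f := f.continuous_of_finiteDimensional
  have h1 : f '' stdSimplex ℝ _ ∩ {x | L x = 0} =
      f '' (stdSimplex ℝ _ ∩ {w | (L ∘ₗ f) w = 0}) := by
    ext x
    constructor
    · rintro ⟨⟨w, hw, rfl⟩, hx⟩
      exact ⟨w, ⟨hw, hx⟩, rfl⟩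
    · rintro ⟨w, ⟨hw, hx⟩, rfl⟩
      exact ⟨⟨w, hw, rfl⟩, hx⟩
  change IsFinUnion (f '' stdSimplex ℝ ↑(s : Set E) ∩ {x | L x = 0})
  rw [h1]
  refine IsFinUnion.image ?_ f
  have hcl : IsClosed {w | (L ∘ₗ f) w = 0} :=
    isClosed_eq (hL.comp hfc) continuous_const
  have hcv : Convex ℝ {w | (L ∘ₗ f) w = 0} := (LinearMap.ker (L ∘ₗ f)).convex
  have hfin := finite_extremePoints_stdSimplex_inter (L ∘ₗ f)
  have key := closure_convexHull_extremePoints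
    ((isCompact_stdSimplex ℝ ↑(s : Set E)).inter_right hcl)
    ((convex_stdSimplex ℝ ↑(s : Set E)).inter hcv)
  rw [(hfin.isClosed_convexHull ℝ).closure_eq] at key
  rw [← key]
  exact isFinUnion_convexHull hfin

end Polyhedra

/-! ### PL charts and PL structures -/

/-- `ℝ^n` with its Euclidean structure. -/
abbrev Euc (n : ℕ) : Type := EuclideanSpace ℝ (Fin n)

/-- A PL chart of a topological space `X`: an embedding of a compact polyhedron into `X`. -/
structure PLChart (X : Type*) [TopologicalSpace X] where
  dim : ℕ
  carrier : Set (Euc dim)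
  isCompact : IsCompact carrier
  isPolyhedron : IsPolyhedron carrier
  map : carrier → X
  isEmbedding : IsEmbedding map

section PLStructures

variable {X Y : Type*} [TopologicalSpace X] [TopologicalSpace Y]

/-- The graph of the partially defined map `ψ⁻¹ ∘ f ∘ φ : P ⇀ Q`, for charts `c = (P, φ)` and
`d = (Q, ψ)`. -/
def PLChart.graph (c : PLChart X) (d : PLChart Y) (f : X → Y) : Set (Euc c.dim × Euc d.dim) :=
  {z | ∃ (hp : z.1 ∈ c.carrier) (hq : z.2 ∈ d.carrier),
    f (c.map ⟨z.1, hp⟩) = d.map ⟨z.2, hq⟩}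

/-- The domain `φ⁻¹ (f⁻¹ (ψ (Q))) ⊆ P` of the partially defined map `ψ⁻¹ ∘ f ∘ φ : P ⇀ Q`, for
charts `c = (P, φ)` and `d = (Q, ψ)`. -/
def PLChart.domain (c : PLChart X) (d : PLChart Y) (f : X → Y) : Set (Euc c.dim) :=
  {p | ∃ hp : p ∈ c.carrier, f (c.map ⟨p, hp⟩) ∈ range d.map}

/-- The map `f` is PL in the charts `c = (P, φ)` and `d = (Q, ψ)`: the set `φ⁻¹ (f⁻¹ (ψ (Q)))` is
a compact polyhedron (possibly empty), and `ψ⁻¹ ∘ f ∘ φ` is piecewise linear on it, i.e. its graph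
is a polyhedron. (Its continuity follows from that of `f`.) -/
def PLChart.IsPLBetween (c : PLChart X) (d : PLChart Y) (f : X → Y) : Prop :=
  IsCompact (c.domain d f) ∧ IsPolyhedron (c.domain d f) ∧ IsPolyhedron (c.graph d f)

/-- Compatibility of two charts: the overlap is a compact polyhedron and the change of charts is
piecewise linear. -/
def PLChart.Compatible (c d : PLChart X) : Prop := c.IsPLBetween d id

variable (X) in
/-- A PL structure on `X`: a maximal atlas of pairwise compatible PL charts such that each point
has a neighbourhood that is the image of a chart. -/
structure PLStructure where
  charts : Set (PLChart X)
  compatible : ∀ c ∈ charts, ∀ d ∈ charts, c.Compatible d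
  covers : ∀ x : X, ∃ c ∈ charts, range c.map ∈ 𝓝 x
  maximal : ∀ c : PLChart X,
    (∀ d ∈ charts, c.Compatible d ∧ d.Compatible c) → c ∈ charts

/-- PL maps between spaces with PL structures. -/
def IsPLMap (A : PLStructure X) (B : PLStructure Y) (f : X → Y) : Prop :=
  Continuous f ∧ ∀ c ∈ A.charts, ∀ d ∈ B.charts, c.IsPLBetween d f

/-- PL homeomorphisms. -/
def IsPLHomeomorph (A : PLStructure X) (B : PLStructure Y) (F : X ≃ₜ Y) : Prop :=
  IsPLMap A B F ∧ IsPLMap B A F.symm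

/-- `X` with the PL structure `A` is a PL manifold with (possibly empty) boundary of dimension `n`:
a second-countable Hausdorff space in which every point has a neighbourhood that is the image of a
chart defined on an `n`-simplex. -/
def IsPLManifoldWithBoundary (n : ℕ) (A : PLStructure X) : Prop :=
  T2Space X ∧ SecondCountableTopology X ∧
    ∀ x : X, ∃ c ∈ A.charts,
      (∃ v : Fin (n + 1) → Euc c.dim, AffineIndependent ℝ v ∧
        c.carrier = convexHull ℝ (range v)) ∧
      range c.map ∈ 𝓝 x

/-! ### The natural PL structure on a polyhedron -/

variable {N : ℕ}

/-- The graph of a chart of `X`, seen in `ℝ^N` via `ι : X → ℝ^N`. -/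
def PLChart.graphIn (c : PLChart X) (ι : X → Euc N) : Set (Euc c.dim × Euc N) :=
  {z | ∃ hp : z.1 ∈ c.carrier, z.2 = ι (c.map ⟨z.1, hp⟩)}

theorem PLChart.isCompact_graphIn (c : PLChart X) {ι : X → Euc N} (hι : Continuous ι) :
    IsCompact (c.graphIn ι) := by
  have : CompactSpace c.carrier := isCompact_iff_compactSpace.1 c.isCompact
  have h : c.graphIn ι = range fun p : c.carrier => ((p : Euc c.dim), ι (c.map p)) := by
    ext ⟨a, b⟩
    simp only [PLChart.graphIn, mem_ofPred_eq, mem_range, Prod.mk.injEq, Subtype.exists]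
    constructor
    · rintro ⟨hp, h⟩
      exact ⟨a, hp, rfl, h.symm⟩
    · rintro ⟨a', hp, rfl, rfl⟩
      exact ⟨hp, rfl⟩
  rw [h]
  exact isCompact_range (continuous_subtype_val.prodMk
    (hι.comp c.isEmbedding.continuous))

theorem PLChart.domain_eq_image (c : PLChart X) (d : PLChart Y) (f : X → Y) :
    c.domain d f = Prod.fst '' c.graph d f := by
  ext p
  constructor
  · rintro ⟨hp, ⟨q, hq⟩, h⟩
    exact ⟨(p, q), ⟨hp, hq, h.symm⟩, rfl⟩
  · rintro ⟨⟨p, q⟩, ⟨hp, hq, h⟩, rfl⟩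
    exact ⟨hp, ⟨q, hq⟩, h.symm⟩

theorem PLChart.isPLBetween_of_graph {c : PLChart X} {d : PLChart Y} {f : X → Y}
    (h : IsFinUnion (c.graph d f)) : c.IsPLBetween d f := by
  have h2 : IsFinUnion (c.domain d f) := by
    rw [c.domain_eq_image]
    exact h.image (LinearMap.fst ℝ (Euc c.dim) (Euc d.dim))
  exact ⟨h2.isCompact, h2.isPolyhedron, h.isPolyhedron⟩

theorem PLChart.compatible_of_graphIn {c d : PLChart X} {ι : X → Euc N}
    (hι : IsEmbedding ι) (hc : IsPolyhedron (c.graphIn ι)) (hd : IsPolyhedron (d.graphIn ι)) :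
    c.Compatible d := by
  refine PLChart.isPLBetween_of_graph ?_
  have hc' := isFinUnion_iff.2 ⟨c.isCompact_graphIn hι.continuous, hc⟩
  have hd' := isFinUnion_iff.2 ⟨d.isCompact_graphIn hι.continuous, hd⟩
  let V := (Euc c.dim × Euc N) × (Euc d.dim × Euc N)
  let L : V →L[ℝ] Euc N :=
    (ContinuousLinearMap.snd ℝ _ _).comp (ContinuousLinearMap.fst ℝ _ _) -
    (ContinuousLinearMap.snd ℝ _ _).comp (ContinuousLinearMap.snd ℝ _ _)
  let p : V →ₗ[ℝ] Euc c.dim × Euc d.dim :=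
    LinearMap.prodMap (LinearMap.fst ℝ _ _) (LinearMap.fst ℝ _ _)
  have := ((hc'.prod hd').inter_ker L.toLinearMap L.continuous).image p
  convert this using 1
  ext ⟨a, b⟩
  constructor
  · rintro ⟨ha, hb, h⟩
    refine ⟨((a, ι (c.map ⟨a, ha⟩)), (b, ι (d.map ⟨b, hb⟩))), ⟨⟨⟨ha, rfl⟩, ⟨hb, rfl⟩⟩, ?_⟩, rfl⟩
    simp only [id] at h
    simp [L, h]
  · rintro ⟨⟨⟨a', x⟩, ⟨b', y⟩⟩, ⟨⟨⟨ha, hx⟩, ⟨hb, hy⟩⟩, h⟩, hab⟩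
    obtain ⟨rfl, rfl⟩ : a' = a ∧ b' = b := by simpa [p] using hab
    refine ⟨ha, hb, hι.injective ?_⟩
    simp only [L, mem_ofPred_eq, ContinuousLinearMap.coe_coe, sub_apply,
      ContinuousLinearMap.comp_apply, ContinuousLinearMap.coe_fst', ContinuousLinearMap.coe_snd',
      sub_eq_zero] at h hx hy
    simp only [id]
    rw [← hx, ← hy, h]

/-- A compact polyhedron inside the image of `ι`, as a chart. -/
def inclusionChart (ι : X → Euc N) (hι : IsEmbedding ι) (Q : Set (Euc N)) (hQ : IsFinUnion Q)
    (hQX : Q ⊆ range ι) : PLChart X where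
  dim := N
  carrier := Q
  isCompact := hQ.isCompact
  isPolyhedron := hQ.isPolyhedron
  map := fun p => (hQX p.2).choose
  isEmbedding := by
    refine IsEmbedding.of_comp (g := ι) ?_ hι.continuous ?_
    · refine hι.continuous_iff.2 ?_
      convert continuous_subtype_val (p := fun x => x ∈ Q) using 1
      ext1 p
      exact (hQX p.2).choose_spec
    · convert IsEmbedding.subtypeVal (p := fun x => x ∈ Q) using 1
      ext1 p
      exact (hQX p.2).choose_spec

theorem inclusionChart_spec (ι : X → Euc N) (hι : IsEmbedding ι) (Q : Set (Euc N))
    (hQ : IsFinUnion Q) (hQX : Q ⊆ range ι) (p : Q) :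
    ι ((inclusionChart ι hι Q hQ hQX).map p) = p := (hQX p.2).choose_spec

theorem range_inclusionChart (ι : X → Euc N) (hι : IsEmbedding ι) (Q : Set (Euc N))
    (hQ : IsFinUnion Q) (hQX : Q ⊆ range ι) :
    range (inclusionChart ι hι Q hQ hQX).map = ι ⁻¹' Q := by
  ext x
  constructor
  · rintro ⟨p, rfl⟩
    have h : ι ((inclusionChart ι hι Q hQ hQX).map p) ∈ Q := by
      rw [inclusionChart_spec ι hι Q hQ hQX p]
      exact p.2
    exact h
  · intro hx
    exact ⟨⟨ι x, hx⟩, hι.injective (inclusionChart_spec ι hι Q hQ hQX ⟨ι x, hx⟩)⟩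

theorem inclusionChart_isPolyhedron (ι : X → Euc N) (hι : IsEmbedding ι) (Q : Set (Euc N))
    (hQ : IsFinUnion Q) (hQX : Q ⊆ range ι) :
    IsPolyhedron ((inclusionChart ι hι Q hQ hQX).graphIn ι) := by
  have h := (hQ.image (LinearMap.prod LinearMap.id LinearMap.id :
    Euc N →ₗ[ℝ] Euc N × Euc N)).isPolyhedron
  have h2 : (inclusionChart ι hι Q hQ hQX).graphIn ι =
      (LinearMap.prod LinearMap.id LinearMap.id : Euc N →ₗ[ℝ] Euc N × Euc N) '' Q := by
    ext ⟨a, b⟩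
    constructor
    · rintro ⟨hp, h⟩
      have h' : b = a := h.trans (inclusionChart_spec ι hι Q hQ hQX ⟨a, hp⟩)
      exact ⟨a, hp, Prod.ext rfl h'.symm⟩
    · rintro ⟨x, hx, h⟩
      obtain ⟨rfl, rfl⟩ : x = a ∧ x = b := Prod.mk.inj h
      exact ⟨hx, (inclusionChart_spec ι hι Q hQ hQX ⟨x, hx⟩).symm⟩
  rwa [h2]

/-- The natural PL structure of a polyhedron in `ℝ^N`, transported to `X` along an embedding
`ι : X → ℝ^N` onto it: a chart `(P, φ)` belongs to it if and only if `ι ∘ φ : P → ℝ^N` is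
piecewise linear, i.e. has a polyhedral graph. -/
def PLStructure.ofPolyhedron (ι : X → Euc N) (hι : IsEmbedding ι)
    (hX : IsPolyhedron (range ι)) : PLStructure X where
  charts := {c | IsPolyhedron (c.graphIn ι)}
  compatible := fun _ hc _ hd => PLChart.compatible_of_graphIn hι hc hd
  covers := by
    intro x
    obtain ⟨Q, hQ, hQX, hn⟩ := hX.local (ι x) ⟨x, rfl⟩
    refine ⟨inclusionChart ι hι Q hQ hQX, inclusionChart_isPolyhedron ι hι Q hQ hQX, ?_⟩
    rw [range_inclusionChart, hι.nhds_eq_comap, Filter.mem_comap]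
    obtain ⟨u, hu, huQ⟩ := mem_nhdsWithin_iff_exists_mem_nhds_inter.1 hn
    exact ⟨u, hu, fun y hy => huQ ⟨hy, y, rfl⟩⟩
  maximal := by
    intro c hc
    have : CompactSpace c.carrier := isCompact_iff_compactSpace.1 c.isCompact
    obtain ⟨Q, hQ, hKQ, hQX⟩ := hX.exists_finUnion
      (isCompact_range (hι.continuous.comp c.isEmbedding.continuous))
      (range_comp_subset_range c.map ι)
    have h := (hc _ (inclusionChart_isPolyhedron ι hι Q hQ hQX)).1.2.2
    have h2 : c.graph (inclusionChart ι hι Q hQ hQX) id = c.graphIn ι := by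
      ext ⟨a, b⟩
      constructor
      · rintro ⟨ha, hb, h⟩
        refine ⟨ha, ?_⟩
        exact ((congrArg ι h).trans (inclusionChart_spec ι hι Q hQ hQX ⟨b, hb⟩)).symm
      · rintro ⟨ha, hb⟩
        have hb' : b ∈ Q := by
          rw [show b = _ from hb]
          exact hKQ ⟨_, rfl⟩
        exact ⟨ha, hb', hι.injective
          (Eq.trans hb.symm (inclusionChart_spec ι hι Q hQ hQX ⟨b, hb'⟩).symm)⟩
    have h3 : IsPolyhedron (c.graphIn ι) := h2 ▸ h
    exact h3

end PLStructures

/-! ### Euclidean space and the half space -/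

/-- The closed half space `ℝ^{n-1} × ℝ_{≥ 0}` (the first coordinate is the nonnegative one;
for `n = 0` it is the point `ℝ^0`). -/
def halfSpace (n : ℕ) : Set (Euc n) := {x | ∀ i : Fin n, (i : ℕ) = 0 → 0 ≤ x i}

theorem isFinUnion_box {n : ℕ} (a b : Fin n → ℝ) (hab : a ≤ b) :
    IsFinUnion {x : Euc n | ∀ i, x i ∈ Icc (a i) (b i)} := by
  have h1 : IsFinUnion (univ.pi fun i => Icc (a i) (b i)) := by
    have : (univ.pi fun i => Icc (a i) (b i)) =
        convexHull ℝ (univ.pi fun i => ({a i, b i} : Set ℝ)) := by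
      rw [convexHull_pi]
      simp only [convexHull_pair, segment_eq_Icc (hab _)]
    rw [this]
    exact isFinUnion_convexHull (Set.Finite.pi fun i => Set.toFinite _)
  have h2 := h1.image (WithLp.linearEquiv 2 ℝ (Fin n → ℝ)).symm.toLinearMap
  convert h2 using 1
  ext x
  constructor
  · intro hx
    exact ⟨WithLp.ofLp x, fun i _ => hx i, rfl⟩
  · rintro ⟨y, hy, rfl⟩ i
    exact hy i (mem_univ i)

theorem box_mem_nhds {n : ℕ} (x : Euc n) :
    {y : Euc n | ∀ i, y i ∈ Ioo (x i - 1) (x i + 1)} ∈ 𝓝 x := by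
  have : {y : Euc n | ∀ i, y i ∈ Ioo (x i - 1) (x i + 1)} =
      ⋂ i, {y : Euc n | y i ∈ Ioo (x i - 1) (x i + 1)} := by
    ext y; simp
  rw [this]
  refine Filter.iInter_mem.2 fun i => ?_
  have hc : Continuous fun y : Euc n => y i := by fun_prop
  exact (isOpen_Ioo.preimage hc).mem_nhds (by simp)

theorem isPolyhedron_univ {n : ℕ} : IsPolyhedron (univ : Set (Euc n)) := by
  refine isPolyhedron_of_local fun x _ => ⟨_, isFinUnion_box (fun i => x i - 1)
    (fun i => x i + 1) (fun i => by simp only; linarith), subset_univ _, ?_⟩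
  rw [nhdsWithin_univ]
  exact Filter.mem_of_superset (box_mem_nhds x) fun y hy i => Ioo_subset_Icc_self (hy i)

theorem isPolyhedron_halfSpace {n : ℕ} : IsPolyhedron (halfSpace n) := by
  refine isPolyhedron_of_local fun x hx => ⟨_, isFinUnion_box
    (fun i => if (i : ℕ) = 0 then 0 else x i - 1) (fun i => x i + 1) ?_, ?_, ?_⟩
  · intro i
    simp only
    split_ifs with h
    · linarith [hx i h]
    · linarith
  · intro y hy i hi
    simpa [hi] using (hy i).1
  · refine mem_nhdsWithin_iff_exists_mem_nhds_inter.2 ⟨_, box_mem_nhds x, ?_⟩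
    rintro y ⟨hy, hyH⟩ i
    refine ⟨?_, (hy i).2.le⟩
    split_ifs with h
    · exact hyH i h
    · exact (hy i).1.le

/-- The natural PL structure on `ℝ^n`. -/
def plEuc (n : ℕ) : PLStructure (Euc n) :=
  PLStructure.ofPolyhedron id IsEmbedding.id (by rw [range_id]; exact isPolyhedron_univ)

/-- The natural PL structure on the half space. -/
def plHalfSpace (n : ℕ) : PLStructure (halfSpace n) :=
  PLStructure.ofPolyhedron Subtype.val IsEmbedding.subtypeVal
    (by rw [Subtype.range_coe]; exact isPolyhedron_halfSpace)

/-! ### Orthogonal groups and their orbit spaces -/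

/-- The orthogonal group `O_n`, as the group of linear isometries of `ℝ^n`. -/
abbrev O (n : ℕ) : Type := Euc n ≃ₗᵢ[ℝ] Euc n

variable {n : ℕ}

/-- The codimension of the fixed point subspace of `g`. -/
def fixCodim (g : O n) : ℕ :=
  Module.finrank ℝ (Euc n ⧸ LinearMap.eqLocus (g.toLinearEquiv : Euc n →ₗ[ℝ] Euc n) LinearMap.id)

/-- A reflection: the fixed point subspace has codimension one. -/
def IsReflection (g : O n) : Prop := fixCodim g = 1

/-- A rotation: the fixed point subspace has codimension two. -/
def IsRotation (g : O n) : Prop := fixCodim g = 2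

/-- A (finite real) reflection group: a finite group generated by the reflections it contains. -/
def IsReflectionGroup (W : Subgroup (O n)) : Prop :=
  Finite W ∧ W = Subgroup.closure {g | g ∈ W ∧ IsReflection g}

/-- A reflection-rotation group: a finite group generated by the reflections and rotations it
contains. -/
def IsReflectionRotationGroup (G : Subgroup (O n)) : Prop :=
  Finite G ∧ G = Subgroup.closure {g | g ∈ G ∧ (IsReflection g ∨ IsRotation g)}

/-- The orientation preserving subgroup `G⁺`: the elements of determinant one. -/
def orientationPreserving (G : Subgroup (O n)) : Subgroup (O n) where
  carrier := {g | g ∈ G ∧ LinearMap.det (g.toLinearEquiv : Euc n →ₗ[ℝ] Euc n) = 1}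
  one_mem' := ⟨G.one_mem, LinearMap.det_id⟩
  mul_mem' := by
    rintro a b ⟨ha, ha'⟩ ⟨hb, hb'⟩
    refine ⟨G.mul_mem ha hb, ?_⟩
    change LinearMap.det ((a.toLinearEquiv : Euc n →ₗ[ℝ] Euc n) ∘ₗ
      (b.toLinearEquiv : Euc n →ₗ[ℝ] Euc n)) = 1
    rw [LinearMap.det_comp, ha', hb', one_mul]
  inv_mem' := by
    rintro a ⟨ha, ha'⟩
    refine ⟨G.inv_mem ha, ?_⟩
    have h : LinearMap.det ((a.toLinearEquiv : Euc n →ₗ[ℝ] Euc n) ∘ₗ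
        (a⁻¹.toLinearEquiv : Euc n →ₗ[ℝ] Euc n)) = 1 := by
      have : (a.toLinearEquiv : Euc n →ₗ[ℝ] Euc n) ∘ₗ
        (a⁻¹.toLinearEquiv : Euc n →ₗ[ℝ] Euc n) = LinearMap.id :=
          LinearMap.ext fun x => a.apply_symm_apply x
      rw [this, LinearMap.det_id]
    rwa [LinearMap.det_comp, ha', one_mul] at h

/-- The extension `⟨G, h⟩` of a subgroup `G` by an element `h`. -/
def extendBy (G : Subgroup (O n)) (h : O n) : Subgroup (O n) :=
  Subgroup.closure ((G : Set (O n)) ∪ {h})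

/-- Two points are equivalent if they lie in the same `G`-orbit. -/
def orbitSetoid (G : Subgroup (O n)) : Setoid (Euc n) where
  r x y := ∃ g ∈ G, g x = y
  iseqv :=
    { refl := fun _ => ⟨1, G.one_mem, rfl⟩
      symm := by
        rintro x _ ⟨g, hg, rfl⟩
        exact ⟨g⁻¹, G.inv_mem hg, g.symm_apply_apply x⟩
      trans := by
        rintro x _ _ ⟨g, hg, rfl⟩ ⟨k, hk, rfl⟩
        exact ⟨k * g, G.mul_mem hk hg, rfl⟩ }

/-- The orbit space `ℝ^n/G`, with the quotient topology. -/
abbrev OrbitSpace (G : Subgroup (O n)) : Type := Quotient (orbitSetoid G)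

/-- The projection `ℝ^n → ℝ^n/G`. -/
abbrev orbitMk (G : Subgroup (O n)) (x : Euc n) : OrbitSpace G := Quotient.mk (orbitSetoid G) x

/-- `A` is the quotient PL structure on `ℝ^n/G`: the projection `ℝ^n → ℝ^n/G` is PL. By
`IsOrbitPL.unique` there is at most one such PL structure. -/
def IsOrbitPL (G : Subgroup (O n)) (A : PLStructure (OrbitSpace G)) : Prop :=
  IsPLMap (plEuc n) A (orbitMk G)

theorem isOpenMap_orbitMk (G : Subgroup (O n)) : IsOpenMap (orbitMk G) := by
  intro U hU
  refine isOpen_coinduced.2 ?_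
  have : Quotient.mk (orbitSetoid G) ⁻¹' (orbitMk G '' U) =
      ⋃ g ∈ G, (g : Euc n → Euc n) ⁻¹' U := by
    ext x
    simp only [mem_preimage, mem_image, mem_iUnion, exists_prop]
    constructor
    · rintro ⟨y, hy, h⟩
      obtain ⟨g, hg, h'⟩ := Quotient.exact h.symm
      exact ⟨g, hg, by rwa [h']⟩
    · rintro ⟨g, hg, h⟩
      exact ⟨g x, h, (Quotient.sound ⟨g, hg, rfl⟩ : orbitMk G x = orbitMk G (g x)).symm⟩
  change IsOpen (Quotient.mk (orbitSetoid G) ⁻¹' (orbitMk G '' U))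
  rw [this]
  exact isOpen_biUnion fun g _ => hU.preimage g.continuous

theorem PLChart.IsPLBetween.isFinUnion_graph {X Y : Type*} [TopologicalSpace X]
    [TopologicalSpace Y] {c : PLChart X} {d : PLChart Y} {f : X → Y} (hf : Continuous f)
    (h : c.IsPLBetween d f) : IsFinUnion (c.graph d f) := by
  refine isFinUnion_iff.2 ⟨?_, h.2.2⟩
  have hD : CompactSpace (c.domain d f) := isCompact_iff_compactSpace.1 h.1
  let φ : c.domain d f → c.carrier := fun p => ⟨p.1, p.2.choose⟩
  have hφ : Continuous φ := continuous_subtype_val.subtype_mk _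
  let ψ : c.domain d f → d.carrier := fun p => p.2.choose_spec.choose
  have hψ' : ∀ p, d.map (ψ p) = f (c.map (φ p)) := fun p => p.2.choose_spec.choose_spec
  have hψ : Continuous ψ := by
    refine d.isEmbedding.continuous_iff.2 ?_
    rw [show d.map ∘ ψ = f ∘ c.map ∘ φ from funext hψ']
    exact hf.comp (c.isEmbedding.continuous.comp hφ)
  have : c.graph d f = range fun p : c.domain d f =>
      ((p : Euc c.dim), (ψ p : Euc d.dim)) := by
    ext ⟨a, b⟩
    constructor
    · rintro ⟨ha, hb, h⟩
      refine ⟨⟨a, ha, ⟨b, hb⟩, h.symm⟩, ?_⟩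
      have h1 := hψ' ⟨a, ha, ⟨b, hb⟩, h.symm⟩
      have h2 := d.isEmbedding.injective (h1.trans h)
      simp [h2]
    · rintro ⟨p, hp⟩
      obtain ⟨rfl, rfl⟩ := Prod.mk.inj hp
      exact ⟨(φ p).2, (ψ p).2, (hψ' p).symm⟩
  rw [this]
  exact isCompact_range (continuous_subtype_val.prodMk (continuous_subtype_val.comp hψ))

theorem IsOrbitPL.compatible {G : Subgroup (O n)} {A B : PLStructure (OrbitSpace G)}
    (hA : IsOrbitPL G A) (hB : IsOrbitPL G B) {c d : PLChart (OrbitSpace G)}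
    (hc : c ∈ A.charts) (hd : d ∈ B.charts) : c.Compatible d := by
  have : CompactSpace c.carrier := isCompact_iff_compactSpace.1 c.isCompact
  -- a compact polyhedron in `ℝ^n` whose image contains the image of `c`
  obtain ⟨Q, hQ, hcQ⟩ : ∃ Q : Set (Euc n), IsFinUnion Q ∧ range c.map ⊆ orbitMk G '' Q := by
    obtain ⟨t, ht⟩ := (isCompact_range c.isEmbedding.continuous).elim_finite_subcover
      (fun k : ℕ => orbitMk G '' Metric.ball 0 (k : ℝ))
      (fun k => isOpenMap_orbitMk G _ Metric.isOpen_ball) (by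
        intro y _
        obtain ⟨x, rfl⟩ := Quotient.exists_rep y
        obtain ⟨k, hk⟩ := exists_nat_gt ‖x‖
        exact mem_iUnion.2 ⟨k, x, by simpa using hk, rfl⟩)
    obtain ⟨Q, hQ, hK, -⟩ := isPolyhedron_univ.exists_finUnion
      (t.isCompact_biUnion fun k _ => isCompact_closedBall (0 : Euc n) (k : ℝ)) (subset_univ _)
    refine ⟨Q, hQ, fun y hy => ?_⟩
    obtain ⟨k, hk, x, hx, rfl⟩ := mem_iUnion₂.1 (ht hy)
    exact ⟨x, hK (mem_iUnion₂.2 ⟨k, hk, Metric.ball_subset_closedBall hx⟩), rfl⟩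
  have hQX : Q ⊆ range (id : Euc n → Euc n) := by simp
  let k : PLChart (Euc n) := inclusionChart id IsEmbedding.id Q hQ hQX
  have hk : k ∈ (plEuc n).charts := inclusionChart_isPolyhedron id IsEmbedding.id Q hQ hQX
  have hkm : ∀ p : Q, k.map p = p := inclusionChart_spec id IsEmbedding.id Q hQ hQX
  have h1 := (hA.2 k hk c hc).isFinUnion_graph hA.1
  have h2 := (hB.2 k hk d hd).isFinUnion_graph hB.1
  refine PLChart.isPLBetween_of_graph ?_
  let V := (Euc n × Euc c.dim) × (Euc n × Euc d.dim)
  let L : V →L[ℝ] Euc n :=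
    (ContinuousLinearMap.fst ℝ _ _).comp (ContinuousLinearMap.fst ℝ _ _) -
    (ContinuousLinearMap.fst ℝ _ _).comp (ContinuousLinearMap.snd ℝ _ _)
  let p : V →ₗ[ℝ] Euc c.dim × Euc d.dim :=
    LinearMap.prodMap (LinearMap.snd ℝ _ _) (LinearMap.snd ℝ _ _)
  have := ((h1.prod h2).inter_ker L.toLinearMap L.continuous).image p
  convert this using 1
  ext ⟨a, b⟩
  constructor
  · rintro ⟨ha, hb, h⟩
    obtain ⟨x, hx, hxa⟩ := hcQ ⟨⟨a, ha⟩, rfl⟩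
    have hx' : orbitMk G (k.map ⟨x, hx⟩) = c.map ⟨a, ha⟩ :=
      (congrArg (orbitMk G) (hkm ⟨x, hx⟩)).trans hxa
    refine ⟨((x, a), (x, b)), ⟨⟨⟨hx, ha, hx'⟩, ⟨hx, hb, hx'.trans h⟩⟩, ?_⟩, rfl⟩
    exact sub_self x
  · rintro ⟨⟨⟨x, a'⟩, ⟨y, b'⟩⟩, ⟨⟨⟨hx, ha, h1⟩, ⟨hy, hb, h2⟩⟩, h⟩, hab⟩
    obtain ⟨rfl, rfl⟩ : a' = a ∧ b' = b := Prod.mk.inj hab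
    refine ⟨ha, hb, ?_⟩
    obtain rfl : x = y := sub_eq_zero.1 h
    exact h1.symm.trans h2

theorem IsOrbitPL.unique {G : Subgroup (O n)} {A B : PLStructure (OrbitSpace G)}
    (hA : IsOrbitPL G A) (hB : IsOrbitPL G B) : A = B := by
  have h : A.charts = B.charts := by
    ext c
    exact ⟨fun hc => B.maximal c fun d hd => ⟨hA.compatible hB hc hd, hB.compatible hA hd hc⟩,
      fun hc => A.maximal c fun d hd => ⟨hB.compatible hA hc hd, hA.compatible hB hd hc⟩⟩
  cases A
  cases B
  simp only at h
  subst h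
  rfl

/-! ### The main theorem and the PL linearization principle for given groups -/

/-- The assertion of the main theorem for the finite group `G < O_n`: the PL space `ℝ^n/G` is a PL
manifold with boundary if and only if `G` is a reflection-rotation group, and in this case either
`ℝ^n/G` is PL homeomorphic to the half space and `G` contains a reflection, or `ℝ^n/G` is PL
homeomorphic to `ℝ^n` and `G` contains no reflection. -/
def MainTheoremHoldsFor (G : Subgroup (O n)) : Prop :=
  ∃ A : PLStructure (OrbitSpace G), IsOrbitPL G A ∧
    (IsPLManifoldWithBoundary n A ↔ IsReflectionRotationGroup G) ∧
    (IsPLManifoldWithBoundary n A →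
      ((∃ F : OrbitSpace G ≃ₜ halfSpace n, IsPLHomeomorph A (plHalfSpace n) F) ∧
          ∃ g ∈ G, IsReflection g) ∨
      ((∃ F : OrbitSpace G ≃ₜ Euc n, IsPLHomeomorph A (plEuc n) F) ∧
          ¬ ∃ g ∈ G, IsReflection g))

/-- The PL linearization principle can be applied to `H ◁ G`: `H` is a normal subgroup of `G`, and
there are a PL homeomorphism `F : ℝ^n/H → ℝ^n` and a homomorphism `r : G → O_n` with kernel `H` such
that `F` is equivariant, where `G` acts on `ℝ^n/H` by `g • [x] = [g x]` and on `ℝ^n` through `r`. -/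
def PLLinearizationApplies (H G : Subgroup (O n)) : Prop :=
  H ≤ G ∧ (H.subgroupOf G).Normal ∧
    ∃ A : PLStructure (OrbitSpace H), IsOrbitPL H A ∧
      ∃ (F : OrbitSpace H ≃ₜ Euc n) (r : G →* O n),
        IsPLHomeomorph A (plEuc n) F ∧ r.ker = H.subgroupOf G ∧
        ∀ (g : G) (x : Euc n), F (orbitMk H ((g : O n) x)) = r g (F (orbitMk H x))

/-! ### The reflection groups of type `BC_n` and `D_n` -/

/-- The orthogonal reflection in the hyperplane `v^⊥`. -/
def reflectionAlong (v : Euc n) : O n := Submodule.reflection (ℝ ∙ v)ᗮ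

/-- The standard basis vector `e_i` of `ℝ^n`. -/
abbrev stdVec (i : Fin n) : Euc n := EuclideanSpace.single i 1

/-- The reflection group `W(D_n)`, generated by the reflections in the hyperplanes orthogonal to the
vectors `e_i - e_j` and `e_i + e_j`, `i ≠ j`. -/
def weylD (n : ℕ) : Subgroup (O n) :=
  Subgroup.closure {g | ∃ i j : Fin n, i ≠ j ∧
    (g = reflectionAlong (stdVec i - stdVec j) ∨ g = reflectionAlong (stdVec i + stdVec j))}

/-- The reflection group `W(BC_n)`, generated by `W(D_n)` and the reflections in the coordinate
hyperplanes. -/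
def weylBC (n : ℕ) : Subgroup (O n) :=
  Subgroup.closure ((weylD n : Set (O n)) ∪ {g | ∃ i : Fin n, g = reflectionAlong (stdVec i)})

end PLQuot

end

open PLQuot

/-!
A positive system of roots of `W` determines a chamber `C`, which is a strict fundamental domain,
and the sum of the translates of an interior point under the stabilizer of the positive system is a
direction `e` in the interior of `C` which this stabilizer fixes. A piecewise linear shear along `e`
takes `C` to the half space `{y | 0 ≤ ⟪e, y⟫}` and commutes with the stabilizer. Sending a point of
`w⁻¹ C` to the sheared point `w x`, reflected along `e` if `w` is odd, gives a map `ℝⁿ → ℝⁿ` whose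
fibres are the orbits of `W⁺`. An element of `W` acts on the target through its determinant, as `1`
or as the reflection along `e`, and the stabilizer acts as before. Since every element normalizing
`W` is the product of an element of `W` and one of the stabilizer, the whole action on `ℝⁿ/W⁺` is
linear.

If the chamber is chosen to contain as many fixed points of the rotation `h` as possible, then the
factor of `h` in the stabilizer fixes all fixed points of `h`, so that `h` acts on `ℝⁿ/W⁺` as a
product of two reflections. This product generates the group of rotations of a dihedral group, and
the reflection along `e` normalizes the dihedral group. Applying the construction again, now to the
dihedral group, linearizes the action on `ℝⁿ/W^⊕`. The groups `W` and `W^×` then act through at most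
one reflection, and folding along its hyperplane identifies their orbit spaces with a half space.
-/

noncomputable section

open Set Topology

namespace PLQuot

/-! ### Piecewise linear maps -/

section PLMaps

variable {E F H : Type*} [NormedAddCommGroup E] [NormedSpace ℝ E]
  [NormedAddCommGroup F] [NormedSpace ℝ F] [NormedAddCommGroup H] [NormedSpace ℝ H]

theorem isFinUnion_Icc (a b : ℝ) : IsFinUnion (Icc a b) := by
  rcases le_or_gt a b with hab | hba
  · rw [← segment_eq_Icc hab, ← convexHull_pair]
    exact isFinUnion_convexHull (Set.toFinite _)
  · rw [Icc_eq_empty (not_le.2 hba)]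
    exact ⟨∅, by simp⟩

theorem IsFinUnion.inter_nonneg {P : Set E} (hP : IsFinUnion P) (L : E →L[ℝ] ℝ) :
    IsFinUnion (P ∩ {x | 0 ≤ L x}) := by
  obtain ⟨M, hM⟩ := (hP.isCompact.image L.continuous).bddAbove
  have h := ((hP.prod (isFinUnion_Icc 0 M)).inter_ker
    (L.comp (ContinuousLinearMap.fst ℝ E ℝ) - ContinuousLinearMap.snd ℝ E ℝ).toLinearMap
    (ContinuousLinearMap.continuous _)).image (LinearMap.fst ℝ E ℝ)
  convert h using 1
  ext x
  constructor
  · rintro ⟨hx, hLx⟩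
    exact ⟨(x, L x), ⟨⟨hx, hLx, hM ⟨x, hx, rfl⟩⟩, by simp⟩, rfl⟩
  · rintro ⟨⟨x, t⟩, ⟨⟨hx, ht, -⟩, hxt⟩, rfl⟩
    obtain rfl : L x = t := by simpa [sub_eq_zero] using hxt
    exact ⟨hx, ht⟩

theorem IsFinUnion.inter_forall_nonneg {P : Set E} (hP : IsFinUnion P) {ι : Type*} (s : Finset ι)
    (L : ι → E →L[ℝ] ℝ) : IsFinUnion (P ∩ {x | ∀ i ∈ s, 0 ≤ L i x}) := by
  classical
  induction s using Finset.induction_on with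
  | empty => simpa using hP
  | insert a s _ ih =>
    convert ih.inter_nonneg (L a) using 1
    ext x
    simp only [Finset.forall_mem_insert, mem_inter_iff, mem_ofPred_eq]
    tauto

theorem IsFinUnion.inv {R : SetRel E F} (hR : IsFinUnion R) : IsFinUnion R.inv := by
  have h := hR.image (LinearEquiv.prodComm ℝ E F).toLinearMap
  rwa [show ⇑(LinearEquiv.prodComm ℝ E F).toLinearMap = Prod.swap from rfl,
    image_swap_eq_preimage_swap] at h

theorem IsFinUnion.comp {R : SetRel E F} {S : SetRel F H} (hR : IsFinUnion R)
    (hS : IsFinUnion S) : IsFinUnion (R.comp S) := by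
  let L : (E × F) × (F × H) →L[ℝ] F :=
    (ContinuousLinearMap.snd ℝ _ _).comp (ContinuousLinearMap.fst ℝ _ _) -
    (ContinuousLinearMap.fst ℝ _ _).comp (ContinuousLinearMap.snd ℝ _ _)
  have h := ((hR.prod hS).inter_ker L.toLinearMap L.continuous).image
    (LinearMap.prodMap (LinearMap.fst ℝ E F) (LinearMap.snd ℝ F H))
  convert h using 1
  ext ⟨x, z⟩
  constructor
  · rintro ⟨y, hxy, hyz⟩
    exact ⟨((x, y), (y, z)), ⟨⟨hxy, hyz⟩, sub_self y⟩, rfl⟩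
  · rintro ⟨⟨⟨x, y⟩, ⟨y', z⟩⟩, ⟨⟨hxy, hyz⟩, hyy'⟩, ⟨⟩⟩
    obtain rfl : y = y' := sub_eq_zero.1 hyy'
    exact ⟨y, hxy, hyz⟩

/-- A map is piecewise linear if its graph over each compact polyhedron is a compact polyhedron. -/
def IsPL (f : E → F) : Prop :=
  ∀ Q, IsFinUnion Q → IsFinUnion ((fun x => (x, f x)) '' Q)

theorem IsPL.image {f : E → F} (hf : IsPL f) {Q : Set E} (hQ : IsFinUnion Q) :
    IsFinUnion (f '' Q) := by
  have h := (hf Q hQ).image (LinearMap.snd ℝ E F)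
  rwa [image_image] at h

theorem isPL_linearMap (f : E →ₗ[ℝ] F) : IsPL f := fun _ hQ =>
  hQ.image (LinearMap.prod LinearMap.id f)

theorem IsPL.comp {g : F → H} {f : E → F} (hg : IsPL g) (hf : IsPL f) : IsPL (g ∘ f) := by
  intro Q hQ
  convert (hf Q hQ).comp (hg _ (hf.image hQ)) using 1
  ext ⟨x, z⟩
  constructor
  · rintro ⟨x, hx, ⟨⟩⟩
    exact ⟨f x, ⟨x, hx, rfl⟩, f x, ⟨x, hx, rfl⟩, rfl⟩
  · rintro ⟨_, ⟨x, hx, ⟨⟩⟩, _, -, ⟨⟩⟩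
    exact ⟨x, hx, rfl⟩

theorem IsPL.of_eqOn_cover {f : E → F} {ι : Type*} [Finite ι] {S : ι → Set E} {g : ι → E → F}
    (hcover : ∀ x, ∃ i, x ∈ S i) (hS : ∀ i Q, IsFinUnion Q → IsFinUnion (Q ∩ S i))
    (hg : ∀ i, IsPL (g i)) (hfg : ∀ i, EqOn f (g i) (S i)) : IsPL f := by
  intro Q hQ
  have := Fintype.ofFinite ι
  convert isFinUnion_iUnion (Finset.univ : Finset ι) _ fun i _ => hg i _ (hS i Q hQ) using 1
  ext z
  simp only [Finset.mem_univ, iUnion_true, mem_iUnion, mem_image, mem_inter_iff]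
  constructor
  · rintro ⟨x, hx, rfl⟩
    obtain ⟨i, hi⟩ := hcover x
    exact ⟨i, x, ⟨hx, hi⟩, by rw [hfg i hi]⟩
  · rintro ⟨i, x, ⟨hx, hi⟩, rfl⟩
    exact ⟨x, hx, by rw [hfg i hi]⟩

theorem IsPL.isPolyhedron_graphOn {f : E → F} (hf : IsPL f) {P : Set E} (hP : IsPolyhedron P) :
    IsPolyhedron (P.graphOn f) := by
  refine isPolyhedron_of_local ?_
  rintro _ ⟨x, hx, rfl⟩
  obtain ⟨Q, hQ, hQP, hQx⟩ := hP.local x hx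
  obtain ⟨U, hU, hUQ⟩ := mem_nhdsWithin_iff_exists_mem_nhds_inter.1 hQx
  refine ⟨_, hf Q hQ, image_mono hQP, mem_nhdsWithin_iff_exists_mem_nhds_inter.2
    ⟨Prod.fst ⁻¹' U, continuous_fst.continuousAt.preimage_mem_nhds hU, ?_⟩⟩
  rintro _ ⟨hyU, y, hyP, rfl⟩
  exact ⟨y, hUQ ⟨hyU, hyP⟩, rfl⟩

end PLMaps

/-! ### PL maps between embedded polyhedra -/

section Embedded

variable {X Y : Type*} [TopologicalSpace X] [TopologicalSpace Y] {N M : ℕ}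

theorem PLChart.isFinUnion_graphIn {ι : X → Euc N} (hι : Continuous ι) {c : PLChart X}
    (hc : IsPolyhedron (c.graphIn ι)) : IsFinUnion (c.graphIn ι) :=
  isFinUnion_iff.2 ⟨c.isCompact_graphIn hι, hc⟩

theorem PLChart.graph_eq_comp {ι : X → Euc N} {κ : Y → Euc M} (hι : Function.Injective ι)
    (hκ : Function.Injective κ) {f : X → Y} (c : PLChart X) (d : PLChart Y)
    {Q : SetRel (Euc N) (Euc M)} (hQ : Q ⊆ range fun x => (ι x, κ (f x)))
    (hcQ : range (fun p => (ι (c.map p), κ (f (c.map p)))) ⊆ Q) :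
    c.graph d f = SetRel.comp (SetRel.comp (c.graphIn ι) Q) (SetRel.inv (d.graphIn κ)) := by
  ext ⟨p, q⟩
  constructor
  · rintro ⟨hp, hq, hpq⟩
    exact ⟨κ (f (c.map ⟨p, hp⟩)), ⟨ι (c.map ⟨p, hp⟩), ⟨hp, rfl⟩, hcQ ⟨⟨p, hp⟩, rfl⟩⟩,
      hq, congrArg κ hpq⟩
  · rintro ⟨y, ⟨x, ⟨hp, hpx⟩, hxy⟩, hq, hqy⟩
    obtain ⟨z, hz⟩ := hQ hxy
    obtain ⟨rfl, rfl⟩ := Prod.mk.inj hz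
    exact ⟨hp, hq, hκ ((congrArg (κ ∘ f) (hι hpx)).symm.trans hqy)⟩

theorem PLChart.isPLBetween_of_graphIn {ι : X → Euc N} {κ : Y → Euc M} (hι : IsEmbedding ι)
    (hκ : IsEmbedding κ) {f : X → Y} (hf : Continuous f)
    (hfP : IsPolyhedron (range fun x => (ι x, κ (f x)))) {c : PLChart X} {d : PLChart Y}
    (hc : IsPolyhedron (c.graphIn ι)) (hd : IsPolyhedron (d.graphIn κ)) : c.IsPLBetween d f := by
  have : CompactSpace c.carrier := isCompact_iff_compactSpace.1 c.isCompact
  obtain ⟨Q, hQ, hcQ, hQf⟩ := hfP.exists_finUnion (isCompact_range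
    ((hι.continuous.prodMk (hκ.continuous.comp hf)).comp c.isEmbedding.continuous))
    (range_comp_subset_range c.map _)
  refine PLChart.isPLBetween_of_graph ?_
  rw [PLChart.graph_eq_comp hι.injective hκ.injective c d hQf hcQ]
  exact ((isFinUnion_graphIn hι.continuous hc).comp hQ).comp
    (isFinUnion_graphIn hκ.continuous hd).inv

theorem isPLMap_ofPolyhedron {ι : X → Euc N} {κ : Y → Euc M} (hι : IsEmbedding ι)
    (hX : IsPolyhedron (range ι)) (hκ : IsEmbedding κ) (hY : IsPolyhedron (range κ)) {f : X → Y}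
    (hf : Continuous f) (hfP : IsPolyhedron (range fun x => (ι x, κ (f x)))) :
    IsPLMap (PLStructure.ofPolyhedron ι hι hX) (PLStructure.ofPolyhedron κ hκ hY) f :=
  ⟨hf, fun _ hc _ hd => PLChart.isPLBetween_of_graphIn hι hκ hf hfP hc hd⟩

theorem IsPolyhedron.range_prodMk_self {X : Type*} {ι : X → Euc N}
    (hX : IsPolyhedron (range ι)) : IsPolyhedron (range fun x => (ι x, ι x)) := by
  have h := (isPL_linearMap (LinearMap.id (R := ℝ) (M := Euc N))).isPolyhedron_graphOn hX
  rwa [graphOn, ← range_comp] at h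

theorem isPLHomeomorph_ofPolyhedron {ι : X → Euc N} {κ : Y → Euc N} (hι : IsEmbedding ι)
    (hX : IsPolyhedron (range ι)) (hκ : IsEmbedding κ) (hY : IsPolyhedron (range κ)) {F : X ≃ₜ Y}
    (hF : ∀ x, κ (F x) = ι x) :
    IsPLHomeomorph (PLStructure.ofPolyhedron ι hι hX) (PLStructure.ofPolyhedron κ hκ hY) F := by
  have hF' : ∀ y, ι (F.symm y) = κ y := fun y => by rw [← hF, F.apply_symm_apply]
  exact ⟨isPLMap_ofPolyhedron hι hX hκ hY F.continuous
      (by simpa only [hF] using hX.range_prodMk_self),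
    isPLMap_ofPolyhedron hκ hY hι hX F.symm.continuous
      (by simpa only [hF'] using hY.range_prodMk_self)⟩

theorem isPLManifoldWithBoundary_ofPolyhedron {n : ℕ} {ι : X → Euc N} (hι : IsEmbedding ι)
    (hX : IsPolyhedron (range ι))
    (h : ∀ x ∈ range ι, ∃ v : Fin (n + 1) → Euc N, AffineIndependent ℝ v ∧
      convexHull ℝ (range v) ⊆ range ι ∧ convexHull ℝ (range v) ∈ 𝓝[range ι] x) :
    IsPLManifoldWithBoundary n (PLStructure.ofPolyhedron ι hι hX) := by
  refine ⟨hι.t2Space, hι.secondCountableTopology, fun x => ?_⟩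
  obtain ⟨v, hv, hvX, hvx⟩ := h (ι x) ⟨x, rfl⟩
  have hv_fin : IsFinUnion (convexHull ℝ (range v)) := isFinUnion_convexHull (finite_range v)
  refine ⟨inclusionChart ι hι _ hv_fin hvX, inclusionChart_isPolyhedron ι hι _ hv_fin hvX,
    ⟨v, hv, rfl⟩, ?_⟩
  rw [range_inclusionChart, hι.nhds_eq_comap, Filter.mem_comap]
  obtain ⟨U, hU, hUv⟩ := mem_nhdsWithin_iff_exists_mem_nhds_inter.1 hvx
  exact ⟨U, hU, fun y hy => hUv ⟨hy, y, rfl⟩⟩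

end Embedded

/-! ### Corner simplices -/

section Simplex

variable {n : ℕ}

/-- The vertices `a, a + R e_1, …, a + R e_n` of a simplex. -/
def cornerSimplex (a : Euc n) (R : ℝ) : Fin (n + 1) → Euc n :=
  Fin.cons a fun i => a + R • stdVec i

theorem affineIndependent_cornerSimplex (a : Euc n) {R : ℝ} (hR : R ≠ 0) :
    AffineIndependent ℝ (cornerSimplex a R) := by
  have hli : LinearIndependent ℝ fun i : Fin n => (R • stdVec i : Euc n) := by
    simpa [Pi.smul_def', Units.smul_def] using
      (EuclideanSpace.basisFun (Fin n) ℝ).toBasis.linearIndependent.units_smul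
        fun _ => Units.mk0 R hR
  rw [affineIndependent_iff_linearIndependent_vsub ℝ _ 0,
    ← linearIndependent_equiv (finSuccAboveEquiv 0)]
  have hvsub : (fun i : {i : Fin (n + 1) // i ≠ 0} => cornerSimplex a R i -ᵥ cornerSimplex a R 0) ∘
      finSuccAboveEquiv 0 = fun i => (R • stdVec i : Euc n) := by
    ext1 i
    simp [cornerSimplex, finSuccAboveEquiv_apply]
  rwa [hvsub]

theorem le_of_mem_convexHull_cornerSimplex {a y : Euc n} {R : ℝ} (hR : 0 ≤ R)
    (hy : y ∈ convexHull ℝ (range (cornerSimplex a R))) (i : Fin n) : a i ≤ y i := by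
  have hconv : Convex ℝ {y : Euc n | a i ≤ y i} :=
    convex_halfSpace_ge (EuclideanSpace.proj (𝕜 := ℝ) i).isLinear (a i)
  refine convexHull_min ?_ hconv hy
  rintro _ ⟨j, rfl⟩
  cases j using Fin.cases with
  | zero => simp [cornerSimplex]
  | succ j =>
    simp only [cornerSimplex, Fin.cons_succ, mem_ofPred_eq, PiLp.add_apply, PiLp.smul_apply,
      PiLp.single_apply, smul_eq_mul, mul_ite, mul_one, mul_zero]
    split_ifs <;> linarith

theorem mem_convexHull_cornerSimplex {a y : Euc n} {R : ℝ} (hR : 0 < R) (hy : ∀ i, a i ≤ y i)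
    (hyR : ∑ i, (y i - a i) ≤ R) : y ∈ convexHull ℝ (range (cornerSimplex a R)) := by
  let w : Fin (n + 1) → ℝ := Fin.cons (1 - ∑ i, (y i - a i) / R) fun i => (y i - a i) / R
  have hw_zero : 0 ≤ w 0 := by
    simpa only [w, Fin.cons_zero, ← Finset.sum_div, sub_nonneg, div_le_one hR] using hyR
  have hw_succ (i : Fin n) : 0 ≤ w i.succ := div_nonneg (sub_nonneg.2 (hy i)) hR.le
  have hw_sum : ∑ i, w i = 1 := by simp [w, Fin.sum_univ_succ]
  have hy_eq : ∑ i, w i • cornerSimplex a R i = y := by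
    have hcancel (i : Fin n) :
        ((y i - a i) / R) • (R • stdVec i : Euc n) = (y i - a i) • stdVec i := by
      rw [smul_smul, div_mul_cancel₀ _ hR.ne']
    simp only [Fin.sum_univ_succ, w, Fin.cons_zero, Fin.cons_succ, cornerSimplex, smul_add,
      Finset.sum_add_distrib, ← Finset.sum_smul, hcancel]
    rw [← add_assoc, ← add_smul, sub_add_cancel, one_smul]
    ext j
    simp [Finset.sum_apply, Pi.single_apply]
  rw [← hy_eq]
  exact (convex_convexHull ℝ _).sum_mem (fun i _ => Fin.cases hw_zero hw_succ i) hw_sum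
    fun i _ => subset_convexHull ℝ _ ⟨i, rfl⟩

theorem exists_simplex_mem_nhdsWithin {S : Set (Euc n)} {a x : Euc n} (hx : x ∈ S)
    (haS : ∀ y : Euc n, (∀ i, a i ≤ y i) → y ∈ S) (ha : ∀ᶠ y in 𝓝[S] x, ∀ i, a i ≤ y i) :
    ∃ v : Fin (n + 1) → Euc n, AffineIndependent ℝ v ∧
      convexHull ℝ (range v) ⊆ S ∧ convexHull ℝ (range v) ∈ 𝓝[S] x := by
  have hax : ∀ i, a i ≤ x i := ha.self_of_nhdsWithin hx
  obtain ⟨R, hR⟩ := exists_gt (∑ i, (x i - a i))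
  have hR0 : 0 < R := (Finset.sum_nonneg fun i _ => sub_nonneg.2 (hax i)).trans_lt hR
  refine ⟨cornerSimplex a R, affineIndependent_cornerSimplex a hR0.ne',
    fun y hy => haS y (le_of_mem_convexHull_cornerSimplex hR0.le hy), ?_⟩
  have hcont : Continuous fun y : Euc n => ∑ i, (y i - a i) := by fun_prop
  filter_upwards [ha, nhdsWithin_le_nhds (hcont.continuousAt.eventually_lt continuousAt_const hR)]
    with y hay hyR using mem_convexHull_cornerSimplex hR0 hay hyR.le

theorem exists_simplex_mem_nhds (x : Euc n) :
    ∃ v : Fin (n + 1) → Euc n, AffineIndependent ℝ v ∧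
      convexHull ℝ (range v) ⊆ univ ∧ convexHull ℝ (range v) ∈ 𝓝[univ] x := by
  refine exists_simplex_mem_nhdsWithin (a := WithLp.toLp 2 fun i => x i - 1) (mem_univ x)
    (fun _ _ => mem_univ _) ?_
  filter_upwards [nhdsWithin_le_nhds (box_mem_nhds x)] with y hy i using (hy i).1.le

theorem exists_simplex_mem_nhdsWithin_halfSpace {x : Euc n} (hx : x ∈ halfSpace n) :
    ∃ v : Fin (n + 1) → Euc n, AffineIndependent ℝ v ∧
      convexHull ℝ (range v) ⊆ halfSpace n ∧ convexHull ℝ (range v) ∈ 𝓝[halfSpace n] x := by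
  refine exists_simplex_mem_nhdsWithin
    (a := WithLp.toLp 2 fun i => if (i : ℕ) = 0 then 0 else x i - 1) hx
    (fun y hy i hi => by simpa [hi] using hy i) ?_
  filter_upwards [nhdsWithin_le_nhds (box_mem_nhds x), self_mem_nhdsWithin] with y hy hyH i
  change (if (i : ℕ) = 0 then 0 else x i - 1) ≤ y i
  split_ifs with hi
  exacts [hyH i hi, (hy i).1.le]

end Simplex

/-! ### PL maps realizing orbit spaces -/

section OrbitMaps

variable {n : ℕ}

/-- A continuous closed PL self-map of `ℝ^n` whose fibres are the orbits of `G`, so that it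
identifies `ℝ^n/G` with its image. -/
structure IsOrbitMap (G : Subgroup (O n)) (F : Euc n → Euc n) : Prop where
  isPL : IsPL F
  continuous : Continuous F
  isClosedMap : IsClosedMap F
  eq_iff : ∀ x y, F x = F y ↔ ∃ g ∈ G, g x = y

namespace IsOrbitMap

variable {G : Subgroup (O n)} {F : Euc n → Euc n}

theorem id : IsOrbitMap (⊥ : Subgroup (O n)) id where
  isPL := isPL_linearMap LinearMap.id
  continuous := continuous_id
  isClosedMap := IsClosedMap.id
  eq_iff x y := by simp [Subgroup.mem_bot]

theorem comp {H K : Subgroup (O n)} {Q : Euc n → Euc n} (hQ : IsOrbitMap K Q)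
    (hF : IsOrbitMap H F) (hHG : H ≤ G) (hGK : ∀ g ∈ G, ∃ k ∈ K, ∀ x, F (g x) = k (F x))
    (hKG : ∀ k ∈ K, ∃ g ∈ G, ∀ x, F (g x) = k (F x)) : IsOrbitMap G (Q ∘ F) where
  isPL := hQ.isPL.comp hF.isPL
  continuous := hQ.continuous.comp hF.continuous
  isClosedMap := hQ.isClosedMap.comp hF.isClosedMap
  eq_iff x y := by
    simp only [Function.comp, hQ.eq_iff]
    constructor
    · rintro ⟨k, hk, hkxy⟩
      obtain ⟨g, hg, hgk⟩ := hKG k hk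
      rw [← hgk, hF.eq_iff] at hkxy
      obtain ⟨h, hh, hxy⟩ := hkxy
      exact ⟨h * g, G.mul_mem (hHG hh) hg, hxy⟩
    · rintro ⟨g, hg, rfl⟩
      obtain ⟨k, hk, hgk⟩ := hGK g hg
      exact ⟨k, hk, (hgk x).symm⟩

/-- The map `ℝ^n/G → ℝ^n` induced by an orbit map. -/
def lift (hF : IsOrbitMap G F) : OrbitSpace G → Euc n :=
  Quotient.lift F fun x y hxy => (hF.eq_iff x y).2 hxy

theorem range_lift (hF : IsOrbitMap G F) : range hF.lift = range F :=
  range_quotient_lift (s := orbitSetoid G) _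

theorem isEmbedding_lift (hF : IsOrbitMap G F) : IsEmbedding hF.lift := by
  refine (IsClosedEmbedding.of_continuous_injective_isClosedMap
    (hF.continuous.quotient_lift _) ?_ ?_).isEmbedding
  · rintro ⟨x⟩ ⟨y⟩ hxy
    exact Quotient.sound ((hF.eq_iff x y).1 hxy)
  · have hmk : Continuous (orbitMk G) := continuous_quotient_mk'
    exact IsClosedMap.of_comp_surjective Quotient.exists_rep hmk hF.isClosedMap

/-- The PL structure of `ℝ^n/G` defined by an orbit map onto a polyhedron. -/
def plStructure (hF : IsOrbitMap G F) (hP : IsPolyhedron (range F)) : PLStructure (OrbitSpace G) :=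
  PLStructure.ofPolyhedron hF.lift hF.isEmbedding_lift (by rwa [hF.range_lift])

theorem isOrbitPL (hF : IsOrbitMap G F) (hP : IsPolyhedron (range F)) :
    IsOrbitPL G (hF.plStructure hP) := by
  refine isPLMap_ofPolyhedron IsEmbedding.id _ hF.isEmbedding_lift _ continuous_quotient_mk' ?_
  rw [← image_univ]
  exact hF.isPL.isPolyhedron_graphOn isPolyhedron_univ

theorem exists_isPLHomeomorph (hF : IsOrbitMap G F) (hP : IsPolyhedron (range F)) {Y : Type*}
    [TopologicalSpace Y] {κ : Y → Euc n} (hκ : IsEmbedding κ) (hY : IsPolyhedron (range κ))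
    (hFκ : range F = range κ) : ∃ Φ : OrbitSpace G ≃ₜ Y, (∀ x, κ (Φ (orbitMk G x)) = F x) ∧
      IsPLHomeomorph (hF.plStructure hP) (PLStructure.ofPolyhedron κ hκ hY) Φ := by
  let Φ : OrbitSpace G ≃ₜ Y := hF.isEmbedding_lift.toHomeomorph.trans
    ((Homeomorph.setCongr (hF.range_lift.trans hFκ)).trans hκ.toHomeomorph.symm)
  have hΦ (x : OrbitSpace G) : κ (Φ x) = hF.lift x :=
    congrArg Subtype.val (hκ.toHomeomorph.apply_symm_apply
      (Homeomorph.setCongr (hF.range_lift.trans hFκ) (hF.isEmbedding_lift.toHomeomorph x)))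
  exact ⟨Φ, fun x => hΦ (orbitMk G x), isPLHomeomorph_ofPolyhedron _ _ hκ hY hΦ⟩

theorem exists_isPLHomeomorph_euc (hF : IsOrbitMap G F) (hP : IsPolyhedron (range F))
    (hsurj : Function.Surjective F) : ∃ Φ : OrbitSpace G ≃ₜ Euc n,
      (∀ x, Φ (orbitMk G x) = F x) ∧ IsPLHomeomorph (hF.plStructure hP) (plEuc n) Φ :=
  hF.exists_isPLHomeomorph hP IsEmbedding.id _ (by rw [hsurj.range_eq, range_id])

theorem exists_isPLHomeomorph_halfSpace (hF : IsOrbitMap G F) (hP : IsPolyhedron (range F))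
    (hrange : range F = halfSpace n) : ∃ Φ : OrbitSpace G ≃ₜ halfSpace n,
      (∀ x, (Φ (orbitMk G x) : Euc n) = F x) ∧
        IsPLHomeomorph (hF.plStructure hP) (plHalfSpace n) Φ :=
  hF.exists_isPLHomeomorph hP IsEmbedding.subtypeVal _ (by rw [hrange, Subtype.range_coe])

theorem mainTheoremHoldsFor_of_surjective (hF : IsOrbitMap G F) (hsurj : Function.Surjective F)
    (hG : IsReflectionRotationGroup G) (hG_refl : ¬ ∃ g ∈ G, IsReflection g) :
    MainTheoremHoldsFor G := by
  have hP : IsPolyhedron (range F) := by rw [hsurj.range_eq]; exact isPolyhedron_univ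
  have hmanifold : IsPLManifoldWithBoundary n (hF.plStructure hP) := by
    refine isPLManifoldWithBoundary_ofPolyhedron _ _ fun x _ => ?_
    rw [hF.range_lift, hsurj.range_eq]
    exact exists_simplex_mem_nhds x
  obtain ⟨Φ, -, hΦ⟩ := hF.exists_isPLHomeomorph_euc hP hsurj
  exact ⟨hF.plStructure hP, hF.isOrbitPL hP, ⟨fun _ => hG, fun _ => hmanifold⟩,
    fun _ => Or.inr ⟨⟨Φ, hΦ⟩, hG_refl⟩⟩

theorem mainTheoremHoldsFor_of_range_eq_halfSpace (hF : IsOrbitMap G F)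
    (hrange : range F = halfSpace n) (hG : IsReflectionRotationGroup G)
    (hG_refl : ∃ g ∈ G, IsReflection g) : MainTheoremHoldsFor G := by
  have hP : IsPolyhedron (range F) := by rw [hrange]; exact isPolyhedron_halfSpace
  have hmanifold : IsPLManifoldWithBoundary n (hF.plStructure hP) := by
    refine isPLManifoldWithBoundary_ofPolyhedron _ _ fun x hx => ?_
    rw [hF.range_lift, hrange] at hx ⊢
    exact exists_simplex_mem_nhdsWithin_halfSpace hx
  obtain ⟨Φ, -, hΦ⟩ := hF.exists_isPLHomeomorph_halfSpace hP hrange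
  exact ⟨hF.plStructure hP, hF.isOrbitPL hP, ⟨fun _ => hG, fun _ => hmanifold⟩,
    fun _ => Or.inl ⟨⟨Φ, hΦ⟩, hG_refl⟩⟩

theorem plLinearizationApplies {H : Subgroup (O n)} (hF : IsOrbitMap H F)
    (hsurj : Function.Surjective F) (hHG : H ≤ G) (r : G →* O n)
    (hker : r.ker = H.subgroupOf G) (hequiv : ∀ (g : G) x, F ((g : O n) x) = r g (F x)) :
    PLLinearizationApplies H G := by
  have hP : IsPolyhedron (range F) := by rw [hsurj.range_eq]; exact isPolyhedron_univ
  obtain ⟨Φ, hΦ, hΦPL⟩ := hF.exists_isPLHomeomorph_euc hP hsurj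
  refine ⟨hHG, by rw [← hker]; infer_instance, hF.plStructure hP, hF.isOrbitPL hP, Φ, r, hΦPL,
    hker, fun g x => ?_⟩
  rw [hΦ, hΦ, hequiv]

end IsOrbitMap

end OrbitMaps

open scoped RealInnerProductSpace

/-! ### Reflections -/

section Reflections

variable {n : ℕ}

theorem reflectionAlong_apply {v : Euc n} (hv : ‖v‖ = 1) (x : Euc n) :
    reflectionAlong v x = x - (2 * ⟪v, x⟫) • v := by
  rw [reflectionAlong, Submodule.reflection_orthogonal_apply, Submodule.reflection_singleton_apply,
    hv]
  simp only [one_pow, RCLike.ofReal_real_eq_id, id_eq, div_one]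
  module

theorem reflectionAlong_self (v : Euc n) : reflectionAlong v v = -v :=
  Submodule.reflection_orthogonalComplement_singleton_eq_neg v

theorem reflectionAlong_of_inner_eq_zero {v x : Euc n} (hvx : ⟪v, x⟫ = 0) :
    reflectionAlong v x = x :=
  Submodule.reflection_mem_subspace_eq_self
    (Submodule.mem_orthogonal_singleton_iff_inner_right.2 hvx)

theorem reflectionAlong_reflectionAlong (v x : Euc n) :
    reflectionAlong v (reflectionAlong v x) = x :=
  Submodule.reflection_reflection _ x

theorem reflectionAlong_mul_self (v : Euc n) : reflectionAlong v * reflectionAlong v = 1 :=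
  Submodule.reflection_mul_reflection _

theorem reflectionAlong_inv (v : Euc n) : (reflectionAlong v)⁻¹ = reflectionAlong v :=
  Submodule.reflection_inv

theorem reflectionAlong_smul {a : ℝ} (ha : a ≠ 0) (v : Euc n) :
    reflectionAlong (a • v) = reflectionAlong v := by
  simp only [reflectionAlong, Submodule.span_singleton_smul_eq (IsUnit.mk0 a ha)]

theorem reflectionAlong_neg (v : Euc n) : reflectionAlong (-v) = reflectionAlong v := by
  rw [← reflectionAlong_smul (neg_ne_zero.2 one_ne_zero) v, neg_one_smul]

theorem reflectionAlong_zero : reflectionAlong (0 : Euc n) = 1 :=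
  LinearIsometryEquiv.ext fun _ => reflectionAlong_of_inner_eq_zero (inner_zero_left _)

theorem exists_norm_eq_one_reflectionAlong_eq {v : Euc n} (hv : v ≠ 0) :
    ∃ u, ‖u‖ = 1 ∧ reflectionAlong u = reflectionAlong v :=
  ⟨‖v‖⁻¹ • v, norm_smul_inv_norm hv,
    reflectionAlong_smul (inv_ne_zero (norm_ne_zero_iff.2 hv)) v⟩

theorem mul_reflectionAlong_mul_inv (g : O n) (v : Euc n) :
    g * reflectionAlong v * g⁻¹ = reflectionAlong (g v) := by
  have hmap : (ℝ ∙ g v)ᗮ = (ℝ ∙ v)ᗮ.map (g.toLinearEquiv : Euc n →ₗ[ℝ] Euc n) := by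
    rw [Submodule.map_orthogonal_equiv, Submodule.map_span, image_singleton]
    rfl
  ext1 x
  simp only [reflectionAlong, hmap]
  exact (Submodule.reflection_map_apply g _ x).symm

theorem eq_or_eq_neg_of_reflectionAlong_eq {u v : Euc n} (hu : ‖u‖ = 1) (hv : ‖v‖ = 1)
    (huv : reflectionAlong u = reflectionAlong v) : u = v ∨ u = -v := by
  have hneg : u - (2 * ⟪v, u⟫) • v = -u := by
    rw [← reflectionAlong_apply hv, ← huv, reflectionAlong_self]
  have hu_eq : u = ⟪v, u⟫ • v := by
    linear_combination (norm := module) (1 / 2 : ℝ) • hneg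
  have habs : |⟪v, u⟫| = 1 := by
    rw [← Real.norm_eq_abs, ← mul_one ‖⟪v, u⟫‖, ← hv, ← norm_smul, ← hu_eq, hu, hv]
  rcases (abs_eq one_pos.le).1 habs with h | h <;> rw [h] at hu_eq
  · exact .inl (by rwa [one_smul] at hu_eq)
  · exact .inr (by rwa [neg_one_smul] at hu_eq)

theorem det_reflectionAlong {v : Euc n} (hv : v ≠ 0) :
    LinearMap.det ((reflectionAlong v).toLinearEquiv : Euc n →ₗ[ℝ] Euc n) = -1 := by
  have hdet := Submodule.det_reflection (K := (ℝ ∙ v)ᗮ)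
  rwa [Submodule.orthogonal_orthogonal, finrank_span_singleton hv, pow_one] at hdet

end Reflections

/-! ### Positive systems of finite reflection groups -/

section PositiveSystems

variable {n : ℕ}

/-- The unit normals of the reflection hyperplanes of `W`. -/
def roots (W : Subgroup (O n)) : Set (Euc n) := {v | ‖v‖ = 1 ∧ reflectionAlong v ∈ W}

theorem neg_mem_roots {W : Subgroup (O n)} {v : Euc n} (hv : v ∈ roots W) : -v ∈ roots W :=
  ⟨by rw [norm_neg, hv.1], by rw [reflectionAlong_neg]; exact hv.2⟩

/-- `P` is the set of roots of `W` on the side of `ξ`, a vector outside all reflection hyperplanes,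
and `W` is generated by the reflections along these roots. -/
structure IsPositiveSystem (W : Subgroup (O n)) (P : Finset (Euc n)) (ξ : Euc n) : Prop where
  mem_iff : ∀ v, v ∈ P ↔ v ∈ roots W ∧ 0 < ⟪ξ, v⟫
  regular : ∀ v ∈ roots W, ⟪ξ, v⟫ ≠ 0
  generates : W = Subgroup.closure (reflectionAlong '' (P : Set (Euc n)))

/-- The closed chamber defined by `P`. -/
def chamber (P : Finset (Euc n)) : Set (Euc n) := {x | ∀ v ∈ P, 0 ≤ ⟪v, x⟫}

/-- The positive roots whose reflections permute the other positive roots. They turn out to be the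
simple roots, but this description avoids the choice of a basis. -/
def simpleRoots (P : Finset (Euc n)) : Set (Euc n) :=
  {a | a ∈ P ∧ ∀ b ∈ P, b ≠ a → reflectionAlong a b ∈ P}

open Classical in
/-- The positive roots which `w` does not map to positive roots. -/
def inversions (P : Finset (Euc n)) (w : O n) : Finset (Euc n) := P.filter fun b => w b ∉ P

namespace IsPositiveSystem

variable {W : Subgroup (O n)} {P : Finset (Euc n)} {ξ : Euc n}

theorem mem_roots (hP : IsPositiveSystem W P ξ) {v : Euc n} (hv : v ∈ P) : v ∈ roots W :=
  ((hP.mem_iff v).1 hv).1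

theorem norm_eq_one (hP : IsPositiveSystem W P ξ) {v : Euc n} (hv : v ∈ P) : ‖v‖ = 1 :=
  (hP.mem_roots hv).1

theorem reflectionAlong_mem (hP : IsPositiveSystem W P ξ) {v : Euc n} (hv : v ∈ P) :
    reflectionAlong v ∈ W :=
  (hP.mem_roots hv).2

theorem inner_pos (hP : IsPositiveSystem W P ξ) {v : Euc n} (hv : v ∈ P) : 0 < ⟪ξ, v⟫ :=
  ((hP.mem_iff v).1 hv).2

theorem neg_notMem (hP : IsPositiveSystem W P ξ) {v : Euc n} (hv : v ∈ P) : -v ∉ P := by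
  intro hneg
  have hlt := hP.inner_pos hneg
  rw [inner_neg_right] at hlt
  linarith [hP.inner_pos hv]

theorem mem_or_neg_mem (hP : IsPositiveSystem W P ξ) {v : Euc n} (hv : v ∈ roots W) :
    v ∈ P ∨ -v ∈ P := by
  rcases (hP.regular v hv).lt_or_gt with hlt | hgt
  · refine .inr ((hP.mem_iff _).2 ⟨neg_mem_roots hv, ?_⟩)
    rwa [inner_neg_right, neg_pos]
  · exact .inl ((hP.mem_iff _).2 ⟨hv, hgt⟩)

theorem map_mem_or_neg_map_mem (hP : IsPositiveSystem W P ξ) {g : O n}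
    (hg : g ∈ Subgroup.normalizer (W : Set (O n))) {v : Euc n} (hv : v ∈ P) :
    g v ∈ P ∨ -(g v) ∈ P := by
  refine hP.mem_or_neg_mem ⟨by rw [g.norm_map, hP.norm_eq_one hv], ?_⟩
  rw [← mul_reflectionAlong_mul_inv]
  exact (Subgroup.mem_normalizer_iff.1 hg _).1 (hP.reflectionAlong_mem hv)

theorem neg_map_mem (hP : IsPositiveSystem W P ξ) {w : O n} (hw : w ∈ W) {v : Euc n}
    (hv : v ∈ P) (hwv : w v ∉ P) : -(w v) ∈ P :=
  (hP.map_mem_or_neg_map_mem (Subgroup.le_normalizer hw) hv).resolve_left hwv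

theorem mem_simpleRoots_of_minimal (hP : IsPositiveSystem W P ξ) {f : Euc n →ₗ[ℝ] ℝ} {R : ℝ}
    (hle : ∀ v ∈ P, f v ≤ R * ⟪ξ, v⟫) {a : Euc n} (ha : a ∈ P) (hfa : f a = R * ⟪ξ, a⟫)
    (hmin : ∀ v ∈ P, f v = R * ⟪ξ, v⟫ → ⟪ξ, a⟫ ≤ ⟪ξ, v⟫) : a ∈ simpleRoots P := by
  refine ⟨ha, fun c hc hca => ?_⟩
  by_contra hcontra
  obtain ⟨d, hd_def⟩ : ∃ d, d = -(reflectionAlong a c) := ⟨_, rfl⟩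
  have hd : d ∈ P := hd_def ▸ hP.neg_map_mem (hP.reflectionAlong_mem ha) hc hcontra
  have hd_eq : d = (2 * ⟪a, c⟫) • a - c := by
    rw [hd_def, reflectionAlong_apply (hP.norm_eq_one ha), neg_sub]
  have hξd : ⟪ξ, d⟫ = 2 * ⟪a, c⟫ * ⟪ξ, a⟫ - ⟪ξ, c⟫ := by
    rw [hd_eq, inner_sub_right, inner_smul_right]
  have hsum : f d + f c = R * ⟪ξ, d⟫ + R * ⟪ξ, c⟫ := by
    rw [hξd, hd_eq, map_sub, map_smul, smul_eq_mul, hfa]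
    ring
  have hac : ⟪ξ, a⟫ ≤ ⟪ξ, c⟫ := hmin c hc (by linarith [hle c hc, hle d hd])
  have had : ⟪ξ, a⟫ ≤ ⟪ξ, d⟫ := hmin d hd (by linarith [hle c hc, hle d hd])
  have hinner : ⟪a, c⟫ = 1 := by
    refine le_antisymm ?_ ?_
    · simpa only [hP.norm_eq_one ha, hP.norm_eq_one hc, one_mul] using real_inner_le_norm a c
    · by_contra! hlt
      nlinarith [hP.inner_pos ha]
  exact hca ((inner_eq_one_iff_of_norm_eq_one (hP.norm_eq_one ha) (hP.norm_eq_one hc)).1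
    hinner).symm

theorem exists_mem_simpleRoots_pos (hP : IsPositiveSystem W P ξ) (f : Euc n →ₗ[ℝ] ℝ) {b : Euc n}
    (hb : b ∈ P) (hfb : 0 < f b) : ∃ a ∈ simpleRoots P, 0 < f a := by
  obtain ⟨m, hm, hmax⟩ := P.exists_max_image (fun v => f v / ⟪ξ, v⟫) ⟨b, hb⟩
  obtain ⟨R, hR⟩ : ∃ R, R = f m / ⟪ξ, m⟫ := ⟨_, rfl⟩
  rw [← hR] at hmax
  have hR_pos : 0 < R := (div_pos hfb (hP.inner_pos hb)).trans_le (hmax b hb)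
  have hm_eq : f m = R * ⟪ξ, m⟫ := by rw [hR, div_mul_cancel₀ _ (hP.inner_pos hm).ne']
  obtain ⟨a, ha, hmin⟩ := (P.filter fun v => f v = R * ⟪ξ, v⟫).exists_min_image
    (fun v => ⟪ξ, v⟫) ⟨m, Finset.mem_filter.2 ⟨hm, hm_eq⟩⟩
  obtain ⟨haP, hfa⟩ := Finset.mem_filter.1 ha
  refine ⟨a, hP.mem_simpleRoots_of_minimal (fun v hv => ?_) haP hfa fun v hv hfv =>
    hmin v (Finset.mem_filter.2 ⟨hv, hfv⟩), ?_⟩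
  · exact (div_le_iff₀ (hP.inner_pos hv)).1 (hmax v hv)
  · rw [hfa]
    exact mul_pos hR_pos (hP.inner_pos haP)

theorem exists_mem_simpleRoots_inner_pos (hP : IsPositiveSystem W P ξ) {c : Euc n} (hc : c ∈ P) :
    ∃ a ∈ simpleRoots P, 0 < ⟪a, c⟫ := by
  obtain ⟨a, ha, hac⟩ := hP.exists_mem_simpleRoots_pos (innerₛₗ ℝ c) hc (by
    rw [innerₛₗ_apply_apply, real_inner_self_eq_norm_sq, hP.norm_eq_one hc, one_pow]
    exact one_pos)
  exact ⟨a, ha, by rwa [innerₛₗ_apply_apply, real_inner_comm] at hac⟩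

theorem reflectionAlong_mem_closure_simpleRoots (hP : IsPositiveSystem W P ξ) {c : Euc n}
    (hc : c ∈ P) : reflectionAlong c ∈ Subgroup.closure (reflectionAlong '' simpleRoots P) := by
  have : IsStrictOrder (Euc n) fun u v => ⟪ξ, u⟫ < ⟪ξ, v⟫ :=
    { irrefl := fun _ => lt_irrefl _, trans := fun _ _ _ => lt_trans }
  have hwf : (P : Set (Euc n)).WellFoundedOn fun u v => ⟪ξ, u⟫ < ⟪ξ, v⟫ :=
    P.finite_toSet.wellFoundedOn
  refine hwf.induction (P := fun c => reflectionAlong c ∈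
    Subgroup.closure (reflectionAlong '' simpleRoots P)) hc fun c hc ih => ?_
  obtain ⟨a, ha, hac⟩ := hP.exists_mem_simpleRoots_inner_pos hc
  have ha_mem : reflectionAlong a ∈ Subgroup.closure (reflectionAlong '' simpleRoots P) :=
    Subgroup.subset_closure ⟨a, ha, rfl⟩
  rcases eq_or_ne c a with rfl | hca
  · exact ha_mem
  have hlt : ⟪ξ, reflectionAlong a c⟫ < ⟪ξ, c⟫ := by
    rw [reflectionAlong_apply (hP.norm_eq_one ha.1), inner_sub_right, inner_smul_right]
    linarith [mul_pos hac (hP.inner_pos ha.1)]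
  have hconj := ih _ (ha.2 c hc hca) hlt
  rw [← mul_reflectionAlong_mul_inv] at hconj
  rwa [Subgroup.mul_mem_cancel_right _ (inv_mem ha_mem), Subgroup.mul_mem_cancel_left _ ha_mem]
    at hconj

theorem eq_closure_simpleRoots (hP : IsPositiveSystem W P ξ) :
    W = Subgroup.closure (reflectionAlong '' simpleRoots P) := by
  refine le_antisymm (hP.generates.trans_le ?_) ?_ <;> rw [Subgroup.closure_le]
  · rintro _ ⟨c, hc, rfl⟩
    exact hP.reflectionAlong_mem_closure_simpleRoots hc
  · rintro _ ⟨a, ha, rfl⟩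
    exact hP.reflectionAlong_mem ha.1

theorem exists_eq_prod_reflectionAlong (hP : IsPositiveSystem W P ξ) {w : O n} (hw : w ∈ W) :
    ∃ L : List (Euc n), (∀ a ∈ L, a ∈ simpleRoots P) ∧ w = (L.map reflectionAlong).prod := by
  have hcons {a w} (ha : a ∈ simpleRoots P)
      (hw : ∃ L : List (Euc n), (∀ a ∈ L, a ∈ simpleRoots P) ∧ w = (L.map reflectionAlong).prod) :
      ∃ L : List (Euc n), (∀ a ∈ L, a ∈ simpleRoots P) ∧
        reflectionAlong a * w = (L.map reflectionAlong).prod := by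
    obtain ⟨L, hL, rfl⟩ := hw
    exact ⟨a :: L, List.forall_mem_cons.2 ⟨ha, hL⟩, by simp⟩
  rw [hP.eq_closure_simpleRoots] at hw
  induction hw using Subgroup.closure_induction_left with
  | one => exact ⟨[], by simp, by simp⟩
  | mul_left x hx w _ ih =>
    obtain ⟨a, ha, rfl⟩ := hx
    exact hcons ha ih
  | inv_mul_cancel x hx w _ ih =>
    obtain ⟨a, ha, rfl⟩ := hx
    rw [reflectionAlong_inv]
    exact hcons ha ih

theorem exchange_condition {a : Euc n} (ha : a ∈ simpleRoots P) (L : List (Euc n))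
    (hL : ∀ b ∈ L, b ∈ simpleRoots P) (hLa : (L.map reflectionAlong).prod a ∉ P) :
    ∃ M : List (Euc n), (∀ b ∈ M, b ∈ simpleRoots P) ∧ M.length + 1 = L.length ∧
      (L.map reflectionAlong).prod * reflectionAlong a = (M.map reflectionAlong).prod := by
  induction L with
  | nil => exact absurd ha.1 hLa
  | cons b L ih =>
    obtain ⟨hb, hL⟩ := List.forall_mem_cons.1 hL
    rw [List.map_cons, List.prod_cons] at hLa ⊢
    by_cases hLa' : (L.map reflectionAlong).prod a ∈ P
    · have hLab : (L.map reflectionAlong).prod a = b := by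
        by_contra hne
        exact hLa (hb.2 _ hLa' hne)
      refine ⟨L, hL, rfl, ?_⟩
      rw [← hLab, ← mul_reflectionAlong_mul_inv, inv_mul_cancel_right, mul_assoc,
        reflectionAlong_mul_self, mul_one]
    · obtain ⟨M, hM, hlen, hprod⟩ := ih hL hLa'
      exact ⟨b :: M, List.forall_mem_cons.2 ⟨hb, hM⟩, by rw [List.length_cons, hlen,
        List.length_cons], by rw [mul_assoc, hprod, List.map_cons, List.prod_cons]⟩

theorem eq_one_of_forall_map_mem (hP : IsPositiveSystem W P ξ) {w : O n} (hw : w ∈ W)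
    (hwP : ∀ v ∈ P, w v ∈ P) : w = 1 := by
  obtain ⟨L, hL, rfl⟩ := hP.exists_eq_prod_reflectionAlong hw
  clear hw
  induction hlen : L.length using Nat.strong_induction_on generalizing L with
  | _ k ih =>
    rcases L.eq_nil_or_concat with rfl | ⟨L, a, rfl⟩
    · rfl
    simp only [List.concat_eq_append, List.forall_mem_append, List.forall_mem_singleton,
      List.map_append, List.map_singleton, List.prod_append, List.prod_singleton,
      List.length_append, List.length_singleton] at hL hwP hlen ⊢
    obtain ⟨hL, ha⟩ := hL
    have hLa : (L.map reflectionAlong).prod a ∉ P := by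
      intro hLa
      have hmem : (L.map reflectionAlong).prod (reflectionAlong a a) ∈ P := hwP a ha.1
      rw [reflectionAlong_self, map_neg] at hmem
      exact hP.neg_notMem hLa hmem
    obtain ⟨M, hM, hMlen, hprod⟩ := exchange_condition ha L hL hLa
    rw [hprod] at hwP ⊢
    exact ih M.length (by omega) M hM hwP rfl

theorem exists_mem_simpleRoots_map_notMem (hP : IsPositiveSystem W P ξ) {w : O n} (hw : w ∈ W)
    (hwP : ∃ b ∈ P, w b ∉ P) : ∃ a ∈ simpleRoots P, w a ∉ P := by
  obtain ⟨b, hb, hwb⟩ := hwP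
  have hlt : 0 < ⟪ξ, -(w b)⟫ := hP.inner_pos (hP.neg_map_mem hw hb hwb)
  rw [inner_neg_right] at hlt
  obtain ⟨a, ha, hwa⟩ := hP.exists_mem_simpleRoots_pos
    (-(innerₛₗ ℝ ξ ∘ₗ (w.toLinearEquiv : Euc n →ₗ[ℝ] Euc n))) hb hlt
  exact ⟨a, ha, fun hwa' => (neg_pos.1 hwa).not_gt (hP.inner_pos hwa')⟩

theorem card_inversions_mul_reflectionAlong_lt (hP : IsPositiveSystem W P ξ) {w : O n}
    (hw : w ∈ W) {a : Euc n} (ha : a ∈ simpleRoots P) (hwa : w a ∉ P) :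
    (inversions P (w * reflectionAlong a)).card < (inversions P w).card := by
  classical
  rw [← Finset.card_image_of_injective _ (reflectionAlong a).injective]
  refine Finset.card_lt_card ((Finset.ssubset_iff_of_subset ?_).2
    ⟨a, Finset.mem_filter.2 ⟨ha.1, hwa⟩, ?_⟩)
  · intro c hc
    obtain ⟨b, hb, rfl⟩ := Finset.mem_image.1 hc
    obtain ⟨hbP, hwb⟩ := Finset.mem_filter.1 hb
    refine Finset.mem_filter.2 ⟨ha.2 b hbP ?_, hwb⟩
    rintro rfl
    have hneg := hP.neg_map_mem hw ha.1 hwa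
    rw [← map_neg, ← reflectionAlong_self] at hneg
    exact hwb hneg
  · intro hmem
    obtain ⟨b, hb, hba⟩ := Finset.mem_image.1 hmem
    have hb_eq : b = -a := by
      rw [← reflectionAlong_reflectionAlong a b, hba, reflectionAlong_self]
    exact hP.neg_notMem ha.1 (hb_eq ▸ (Finset.mem_filter.1 hb).1)

theorem map_eq_self_of_mem_chamber (hP : IsPositiveSystem W P ξ) {w : O n} (hw : w ∈ W)
    {x : Euc n} (hx : x ∈ chamber P) (hwx : w x ∈ chamber P) : w x = x := by
  induction hcard : (inversions P w).card using Nat.strong_induction_on generalizing w with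
  | _ k ih =>
    by_cases hwP : ∀ b ∈ P, w b ∈ P
    · rw [hP.eq_one_of_forall_map_mem hw hwP]
      rfl
    push Not at hwP
    obtain ⟨a, ha, hwa⟩ := hP.exists_mem_simpleRoots_map_notMem hw hwP
    have hax : ⟪a, x⟫ = 0 := by
      have hle := hwx _ (hP.neg_map_mem hw ha.1 hwa)
      rw [inner_neg_left, w.inner_map_map] at hle
      exact le_antisymm (neg_nonneg.1 hle) (hx a ha.1)
    have hwx_eq : (w * reflectionAlong a) x = w x :=
      congrArg w (reflectionAlong_of_inner_eq_zero hax)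
    rw [← hwx_eq]
    exact ih _ (hcard ▸ hP.card_inversions_mul_reflectionAlong_lt hw ha hwa)
      (W.mul_mem hw (hP.reflectionAlong_mem ha.1)) (by rwa [hwx_eq]) rfl

theorem exists_map_mem_chamber (hP : IsPositiveSystem W P ξ) [Finite W] (x : Euc n) :
    ∃ w ∈ W, w x ∈ chamber P := by
  obtain ⟨w, hmax⟩ := Finite.exists_max fun w : W => ⟪ξ, (w : O n) x⟫
  refine ⟨w, w.2, fun a ha => ?_⟩
  have hle : ⟪ξ, reflectionAlong a ((w : O n) x)⟫ ≤ ⟪ξ, (w : O n) x⟫ :=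
    hmax ⟨reflectionAlong a * w, W.mul_mem (hP.reflectionAlong_mem ha) w.2⟩
  rw [reflectionAlong_apply (hP.norm_eq_one ha), inner_sub_right, inner_smul_right] at hle
  exact nonneg_of_mul_nonneg_left (by linarith) (hP.inner_pos ha)

theorem exists_forall_mul_map_mem (hP : IsPositiveSystem W P ξ) [Finite W] {g : O n}
    (hg : g ∈ Subgroup.normalizer (W : Set (O n))) : ∃ w ∈ W, ∀ v ∈ P, (w * g) v ∈ P := by
  obtain ⟨w, hw, hwgξ⟩ := hP.exists_map_mem_chamber (g ξ)
  have hwg : w * g ∈ Subgroup.normalizer (W : Set (O n)) :=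
    Subgroup.mul_mem _ (Subgroup.le_normalizer hw) hg
  refine ⟨w, hw, fun v hv => (hP.map_mem_or_neg_map_mem hwg hv).resolve_right fun hneg => ?_⟩
  have hle : 0 ≤ ⟪-((w * g) v), (w * g) ξ⟫ := hwgξ _ hneg
  rw [inner_neg_left, (w * g).inner_map_map, real_inner_comm] at hle
  linarith [hP.inner_pos hv]

end IsPositiveSystem

end PositiveSystems

/-! ### Determinants and fixed spaces -/

section DeterminantsAndFixedSpaces

variable {n : ℕ}

/-- The determinant, as a homomorphism on `O_n`. -/
def detHom (n : ℕ) : O n →* ℝ where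
  toFun g := LinearMap.det (g.toLinearEquiv : Euc n →ₗ[ℝ] Euc n)
  map_one' := LinearMap.det_id
  map_mul' a b := LinearMap.det_comp (a.toLinearEquiv : Euc n →ₗ[ℝ] Euc n)
    (b.toLinearEquiv : Euc n →ₗ[ℝ] Euc n)

theorem mem_orientationPreserving {G : Subgroup (O n)} {g : O n} :
    g ∈ orientationPreserving G ↔ g ∈ G ∧ detHom n g = 1 := Iff.rfl

theorem ne_zero_of_norm_eq_one {v : Euc n} (hv : ‖v‖ = 1) : v ≠ 0 :=
  norm_ne_zero_iff.1 (hv.trans_ne one_ne_zero)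

theorem detHom_reflectionAlong {v : Euc n} (hv : ‖v‖ = 1) : detHom n (reflectionAlong v) = -1 :=
  det_reflectionAlong (ne_zero_of_norm_eq_one hv)

theorem detHom_prod_reflectionAlong {l : List (Euc n)} (hl : ∀ v ∈ l, ‖v‖ = 1) :
    detHom n (l.map reflectionAlong).prod = (-1) ^ l.length := by
  have hmap : l.map (detHom n ∘ reflectionAlong) = l.map fun _ => -1 :=
    List.map_congr_left fun v hv => detHom_reflectionAlong (hl v hv)
  rw [map_list_prod, List.map_map, hmap, List.map_const', List.prod_replicate]

theorem fixCodim_eq_finrank {g : O n} {K : Submodule ℝ (Euc n)} (hK : ∀ x, g x = x ↔ x ∈ Kᗮ) :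
    fixCodim g = Module.finrank ℝ K := by
  have hfix : LinearMap.eqLocus (g.toLinearEquiv : Euc n →ₗ[ℝ] Euc n) LinearMap.id = Kᗮ := by
    ext x
    exact hK x
  rw [fixCodim, hfix]
  linarith [Kᗮ.finrank_quotient_add_finrank, K.finrank_add_finrank_orthogonal]

theorem fixCodim_mono {g h : O n} (hgh : ∀ x, h x = x → g x = x) : fixCodim g ≤ fixCodim h := by
  let fix (g : O n) := LinearMap.eqLocus (g.toLinearEquiv : Euc n →ₗ[ℝ] Euc n) LinearMap.id
  have hle : Module.finrank ℝ (fix h) ≤ Module.finrank ℝ (fix g) :=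
    Submodule.finrank_mono fun x hx => hgh x hx
  have hg := (fix g).finrank_quotient_add_finrank
  have hh := (fix h).finrank_quotient_add_finrank
  change Module.finrank ℝ (Euc n ⧸ fix g) ≤ Module.finrank ℝ (Euc n ⧸ fix h)
  omega

theorem fixCodim_one : fixCodim (1 : O n) = 0 := by
  rw [fixCodim_eq_finrank (K := ⊥) (by simp), finrank_bot]

theorem fixCodim_reflectionAlong {v : Euc n} (hv : v ≠ 0) : fixCodim (reflectionAlong v) = 1 := by
  rw [fixCodim_eq_finrank (g := reflectionAlong v) (K := ℝ ∙ v) fun x =>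
    Submodule.reflection_eq_self_iff x, finrank_span_singleton hv]

theorem exists_length_le_prod_reflectionAlong_eq (l : List (Euc n)) :
    ∃ l' : List (Euc n), l'.length ≤ l.length ∧ (∀ v ∈ l', ‖v‖ = 1) ∧
      (l'.map reflectionAlong).prod = (l.map reflectionAlong).prod := by
  induction l with
  | nil => exact ⟨[], le_rfl, by simp, rfl⟩
  | cons v l ih =>
    obtain ⟨l', hlen, hl', hprod⟩ := ih
    rcases eq_or_ne v 0 with rfl | hv
    · exact ⟨l', hlen.trans (Nat.le_succ _), hl', by simp [hprod, reflectionAlong_zero]⟩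
    · obtain ⟨u, hu, huv⟩ := exists_norm_eq_one_reflectionAlong_eq hv
      exact ⟨u :: l', Nat.succ_le_succ hlen, List.forall_mem_cons.2 ⟨hu, hl'⟩, by
        simp only [List.map_cons, List.prod_cons, hprod, huv]⟩

theorem exists_prod_reflectionAlong_eq (g : O n) :
    ∃ l : List (Euc n), l.length ≤ fixCodim g ∧ (∀ v ∈ l, ‖v‖ = 1) ∧
      (l.map reflectionAlong).prod = g := by
  have hcodim : fixCodim g =
      Module.finrank ℝ (ContinuousLinearMap.id ℝ (Euc n) - g.toContinuousLinearEquiv).kerᗮ := by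
    refine fixCodim_eq_finrank fun x => ?_
    rw [Submodule.orthogonal_orthogonal]
    change g x = x ↔ x - g x = 0
    rw [sub_eq_zero, eq_comm]
  obtain ⟨l, hlen, rfl⟩ := g.reflections_generate_dim_aux hcodim.ge
  obtain ⟨l', hlen', hl', hprod⟩ := exists_length_le_prod_reflectionAlong_eq l
  exact ⟨l', hlen'.trans hlen, hl', hprod⟩

theorem detHom_eq_one_or_eq_neg_one (g : O n) : detHom n g = 1 ∨ detHom n g = -1 := by
  obtain ⟨l, -, hl, rfl⟩ := exists_prod_reflectionAlong_eq g
  rw [detHom_prod_reflectionAlong hl]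
  exact neg_one_pow_eq_or ℝ _

theorem eq_of_fixCodim_le_two {g : O n} (hg : fixCodim g ≤ 2) :
    g = 1 ∨ (∃ v, ‖v‖ = 1 ∧ g = reflectionAlong v) ∨
      ∃ u v, ‖u‖ = 1 ∧ ‖v‖ = 1 ∧ g = reflectionAlong u * reflectionAlong v := by
  obtain ⟨l, hlen, hl, hprod⟩ := exists_prod_reflectionAlong_eq g
  match l, hlen.trans hg with
  | [], _ => exact .inl hprod.symm
  | [v], _ => exact .inr (.inl ⟨v, hl v (by simp), by simpa using hprod.symm⟩)
  | [u, v], _ =>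
    exact .inr (.inr ⟨u, v, hl u (by simp), hl v (by simp), by simpa using hprod.symm⟩)

theorem eq_of_fixCodim_le_one {g : O n} (hg : fixCodim g ≤ 1) :
    g = 1 ∨ ∃ v, ‖v‖ = 1 ∧ g = reflectionAlong v := by
  obtain ⟨l, hlen, hl, hprod⟩ := exists_prod_reflectionAlong_eq g
  match l, hlen.trans hg with
  | [], _ => exact .inl hprod.symm
  | [v], _ => exact .inr ⟨v, hl v (by simp), by simpa using hprod.symm⟩

theorem isReflection_reflectionAlong {v : Euc n} (hv : ‖v‖ = 1) :
    IsReflection (reflectionAlong v) :=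
  fixCodim_reflectionAlong (ne_zero_of_norm_eq_one hv)

theorem isReflection_iff_exists_reflectionAlong {g : O n} :
    IsReflection g ↔ ∃ v, ‖v‖ = 1 ∧ g = reflectionAlong v := by
  constructor
  · intro hg
    refine (eq_of_fixCodim_le_one (le_of_eq hg)).resolve_left ?_
    rintro rfl
    exact zero_ne_one (fixCodim_one.symm.trans hg)
  · rintro ⟨v, hv, rfl⟩
    exact isReflection_reflectionAlong hv

theorem IsReflection.detHom_eq_neg_one {g : O n} (hg : IsReflection g) : detHom n g = -1 := by
  obtain ⟨v, hv, rfl⟩ := isReflection_iff_exists_reflectionAlong.1 hg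
  exact detHom_reflectionAlong hv

theorem IsRotation.exists_eq_reflectionAlong_mul {g : O n} (hg : IsRotation g) :
    ∃ u v, ‖u‖ = 1 ∧ ‖v‖ = 1 ∧ g = reflectionAlong u * reflectionAlong v := by
  rcases eq_of_fixCodim_le_two (le_of_eq hg) with rfl | ⟨v, hv, rfl⟩ | huv
  · exact absurd (fixCodim_one.symm.trans hg) (by decide)
  · exact absurd ((isReflection_reflectionAlong hv).symm.trans hg) (by decide)
  · exact huv

theorem IsRotation.detHom_eq_one {g : O n} (hg : IsRotation g) : detHom n g = 1 := by
  obtain ⟨u, v, hu, hv, rfl⟩ := hg.exists_eq_reflectionAlong_mul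
  rw [map_mul, detHom_reflectionAlong hu, detHom_reflectionAlong hv, neg_one_mul, neg_neg]

theorem linearIndependent_of_reflectionAlong_mul_ne_one {u v : Euc n} (hu : ‖u‖ = 1)
    (hv : ‖v‖ = 1) (huv : reflectionAlong u * reflectionAlong v ≠ 1) :
    LinearIndependent ℝ ![u, v] := by
  rw [LinearIndependent.pair_iff' (ne_zero_of_norm_eq_one hu)]
  rintro a rfl
  have ha : a ≠ 0 := by
    rintro rfl
    exact ne_zero_of_norm_eq_one hv (zero_smul ℝ u)
  exact huv (by rw [reflectionAlong_smul ha, reflectionAlong_mul_self])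

theorem inner_eq_zero_of_reflectionAlong_mul_apply_eq {u v : Euc n} (hu : ‖u‖ = 1) (hv : ‖v‖ = 1)
    (huv : reflectionAlong u * reflectionAlong v ≠ 1) {x : Euc n}
    (hx : (reflectionAlong u * reflectionAlong v) x = x) : ⟪u, x⟫ = 0 ∧ ⟪v, x⟫ = 0 := by
  have heq : reflectionAlong u x = reflectionAlong v x := by
    conv_lhs => rw [← hx]
    exact reflectionAlong_reflectionAlong u _
  rw [reflectionAlong_apply hu, reflectionAlong_apply hv, sub_right_inj] at heq
  have hzero := LinearIndependent.pair_iff.1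
    (linearIndependent_of_reflectionAlong_mul_ne_one hu hv huv) (2 * ⟪u, x⟫) (-(2 * ⟪v, x⟫))
    (by rw [heq, neg_smul, add_neg_cancel])
  constructor <;> linarith [hzero.1, hzero.2]

theorem isRotation_reflectionAlong_mul {u v : Euc n} (hu : ‖u‖ = 1) (hv : ‖v‖ = 1)
    (huv : reflectionAlong u * reflectionAlong v ≠ 1) :
    IsRotation (reflectionAlong u * reflectionAlong v) := by
  have hrank := finrank_span_eq_card (linearIndependent_of_reflectionAlong_mul_ne_one hu hv huv)
  rw [Fintype.card_fin] at hrank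
  refine (fixCodim_eq_finrank fun x => ?_).trans hrank
  have hspan : x ∈ (Submodule.span ℝ (range ![u, v]))ᗮ ↔ ⟪u, x⟫ = 0 ∧ ⟪v, x⟫ = 0 := by
    rw [Matrix.range_cons, Matrix.range_cons, Matrix.range_empty, union_empty,
      Submodule.span_union, ← Submodule.inf_orthogonal, Submodule.mem_inf,
      Submodule.mem_orthogonal_singleton_iff_inner_right,
      Submodule.mem_orthogonal_singleton_iff_inner_right]
  rw [hspan]
  refine ⟨inner_eq_zero_of_reflectionAlong_mul_apply_eq hu hv huv, fun ⟨hux, hvx⟩ => ?_⟩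
  rw [LinearIsometryEquiv.coe_mul, Function.comp, reflectionAlong_of_inner_eq_zero hvx,
    reflectionAlong_of_inner_eq_zero hux]

theorem not_exists_isReflection_of_detHom_eq_one {G : Subgroup (O n)}
    (hG : ∀ g ∈ G, detHom n g = 1) : ¬ ∃ g ∈ G, IsReflection g := by
  rintro ⟨g, hg, hg_refl⟩
  have hdet := hG g hg
  rw [hg_refl.detHom_eq_neg_one] at hdet
  norm_num at hdet

end DeterminantsAndFixedSpaces

/-! ### Existence of positive systems -/

section Existence

theorem exists_pos_forall_add_mul_pos {E : Type*} {S : Set E} (hS : S.Finite) (a b : E → ℝ) :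
    ∃ ε : ℝ, 0 < ε ∧ ∀ v ∈ S, 0 < a v → 0 < a v + ε * b v := by
  have hev : ∀ᶠ ε : ℝ in 𝓝[>] 0, ∀ v ∈ S, 0 < a v → 0 < a v + ε * b v := by
    rw [hS.eventually_all]
    intro v _
    by_cases hv : 0 < a v
    · have hcont : Continuous fun ε : ℝ => a v + ε * b v := by fun_prop
      have hpos : ∀ᶠ ε : ℝ in 𝓝 0, 0 < a v + ε * b v :=
        hcont.continuousAt.eventually_const_lt (by simpa using hv)
      exact nhdsWithin_le_nhds (hpos.mono fun ε hε _ => hε)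
    · exact .of_forall fun ε hv' => absurd hv' hv
  obtain ⟨ε, hε, hε_pos⟩ := (hev.and self_mem_nhdsWithin).exists
  exact ⟨ε, hε_pos, hε⟩

variable {n : ℕ}

theorem exists_mem_forall_inner_ne_zero {S : Set (Euc n)} (hS : S.Finite)
    (V : Submodule ℝ (Euc n)) : ∃ x ∈ V, ∀ v ∈ S, v ∉ Vᗮ → ⟪v, x⟫ ≠ 0 := by
  have : Finite {v // v ∈ S ∧ v ∉ Vᗮ} := (hS.subset fun v hv => hv.1).to_subtype
  obtain ⟨x, hx, hne⟩ := Module.Dual.exists_forall_mem_ne_zero_of_forall_exists V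
    (fun v : {v // v ∈ S ∧ v ∉ Vᗮ} => innerₛₗ ℝ (v : Euc n)) fun v => by
      simpa only [Submodule.mem_orthogonal', not_forall, exists_prop,
        innerₛₗ_apply_apply] using v.2.2
  exact ⟨x, hx, fun v hvS hvV => hne ⟨v, hvS, hvV⟩⟩

theorem finite_roots (W : Subgroup (O n)) [Finite W] : (roots W).Finite := by
  have hroots : roots W ⊆ ⋃ g : W, {v : Euc n | ‖v‖ = 1 ∧ reflectionAlong v = g} := fun v hv =>
    mem_iUnion.2 ⟨⟨_, hv.2⟩, hv.1, rfl⟩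
  refine (finite_iUnion fun g => ?_).subset hroots
  rcases {v : Euc n | ‖v‖ = 1 ∧ reflectionAlong v = g}.eq_empty_or_nonempty with
    hempty | ⟨u, hu, hug⟩
  · rw [hempty]
    exact finite_empty
  · refine (toFinite {u, -u}).subset ?_
    rintro v ⟨hv, hvg⟩
    exact eq_or_eq_neg_of_reflectionAlong_eq hv hu (hvg.trans hug.symm)

open Classical in
/-- The roots of `W` on the side of `ξ`. -/
def positiveRoots (W : Subgroup (O n)) [Finite W] (ξ : Euc n) : Finset (Euc n) :=
  (finite_roots W).toFinset.filter fun v => 0 < ⟪ξ, v⟫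

theorem mem_positiveRoots {W : Subgroup (O n)} [Finite W] {ξ v : Euc n} :
    v ∈ positiveRoots W ξ ↔ v ∈ roots W ∧ 0 < ⟪ξ, v⟫ := by
  rw [positiveRoots, Finset.mem_filter, Finite.mem_toFinset]

theorem isPositiveSystem_positiveRoots {W : Subgroup (O n)} [Finite W] {ξ : Euc n}
    (hW : W = Subgroup.closure {g | g ∈ W ∧ IsReflection g}) (hξ : ∀ v ∈ roots W, ⟪ξ, v⟫ ≠ 0) :
    IsPositiveSystem W (positiveRoots W ξ) ξ where
  mem_iff _ := mem_positiveRoots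
  regular := hξ
  generates := by
    refine le_antisymm (hW.trans_le ?_) ?_ <;> rw [Subgroup.closure_le]
    · rintro g ⟨hgW, hg⟩
      obtain ⟨v, hv, rfl⟩ := isReflection_iff_exists_reflectionAlong.1 hg
      have hvW : v ∈ roots W := ⟨hv, hgW⟩
      rcases (hξ v hvW).lt_or_gt with hlt | hgt
      · refine Subgroup.subset_closure
          ⟨-v, mem_positiveRoots.2 ⟨neg_mem_roots hvW, ?_⟩, reflectionAlong_neg v⟩
        rwa [inner_neg_right, neg_pos]
      · exact Subgroup.subset_closure ⟨v, mem_positiveRoots.2 ⟨hvW, hgt⟩, rfl⟩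
    · rintro _ ⟨v, hv, rfl⟩
      exact (mem_positiveRoots.1 hv).1.2

/- A generic point `x` of `V`, pushed slightly off the hyperplanes containing `V`. -/
theorem exists_regular_near_subspace (W : Subgroup (O n)) [Finite W] (V : Submodule ℝ (Euc n)) :
    ∃ ξ, (∀ v ∈ roots W, ⟪ξ, v⟫ ≠ 0) ∧
      ∃ x ∈ V, ∀ v ∈ roots W, 0 < ⟪ξ, v⟫ → v ∈ Vᗮ ∨ 0 < ⟪v, x⟫ := by
  obtain ⟨x, hxV, hx⟩ := exists_mem_forall_inner_ne_zero (finite_roots W) V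
  obtain ⟨η, -, hη⟩ := exists_mem_forall_inner_ne_zero (finite_roots W) ⊤
  have hη_ne {v} (hv : v ∈ roots W) : ⟪v, η⟫ ≠ 0 := by
    refine hη v hv ?_
    rw [Submodule.top_orthogonal_eq_bot]
    exact ne_zero_of_norm_eq_one hv.1
  obtain ⟨ε, hε, hpos⟩ := exists_pos_forall_add_mul_pos (finite_roots W) (fun v => ⟪v, x⟫)
    fun v => ⟪v, η⟫
  have hinner (v : Euc n) : ⟪x + ε • η, v⟫ = ⟪v, x⟫ + ε * ⟪v, η⟫ := by
    rw [real_inner_comm, inner_add_right, inner_smul_right]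
  have hneg {v} (hv : v ∈ roots W) (hvx : ⟪v, x⟫ < 0) : ⟪x + ε • η, v⟫ < 0 := by
    have hlt := hpos (-v) (neg_mem_roots hv) (by rwa [inner_neg_left, neg_pos])
    rw [← hinner, inner_neg_right] at hlt
    exact neg_pos.1 hlt
  refine ⟨x + ε • η, fun v hv => ?_, x, hxV, fun v hv hξv => or_iff_not_imp_left.2 fun hvV => ?_⟩
  · rcases lt_trichotomy ⟪v, x⟫ 0 with hvx | hvx | hvx
    · exact (hneg hv hvx).ne
    · rw [hinner, hvx, zero_add]
      exact mul_ne_zero hε.ne' (hη_ne hv)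
    · rw [hinner]
      exact (hpos v hv hvx).ne'
  · exact (hx v hv hvV).lt_or_gt.resolve_left fun hvx => hξv.not_gt (hneg hv hvx)

theorem exists_isPositiveSystem {W : Subgroup (O n)} (hW : IsReflectionGroup W)
    (V : Submodule ℝ (Euc n)) :
    ∃ P ξ, IsPositiveSystem W P ξ ∧ ∃ x ∈ V, ∀ v ∈ P, v ∈ Vᗮ ∨ 0 < ⟪v, x⟫ := by
  have := hW.1
  obtain ⟨ξ, hξ, x, hxV, hx⟩ := exists_regular_near_subspace W V
  refine ⟨positiveRoots W ξ, ξ, isPositiveSystem_positiveRoots hW.2 hξ, x, hxV, fun v hv => ?_⟩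
  exact hx v (mem_positiveRoots.1 hv).1 (mem_positiveRoots.1 hv).2

theorem map_mem_chamber {P : Finset (Euc n)} {g : O n} (hg : ∀ v, g v ∈ P ↔ v ∈ P) {x : Euc n}
    (hx : x ∈ chamber P) : g x ∈ chamber P := by
  intro v hv
  obtain ⟨u, rfl⟩ := g.surjective v
  rw [g.inner_map_map]
  exact hx u ((hg u).1 hv)

/- The chamber points of `V` span `V`, and on each of them `w` and `g` both act trivially. -/
theorem IsPositiveSystem.map_eq_self_of_mul_map_eq_self {W : Subgroup (O n)} {P : Finset (Euc n)}
    {ξ : Euc n} (hP : IsPositiveSystem W P ξ) {V : Submodule ℝ (Euc n)} {x : Euc n} (hxV : x ∈ V)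
    (hx : ∀ v ∈ P, v ∈ Vᗮ ∨ 0 < ⟪v, x⟫) {w g : O n} (hw : w ∈ W) (hg : ∀ v, g v ∈ P ↔ v ∈ P)
    (hV : ∀ y ∈ V, (w * g) y = y) {y : Euc n} (hy : y ∈ V) : g y = y := by
  have hfix : ∀ z ∈ V, z ∈ chamber P → g z = z := by
    intro z hz hzP
    have hwgz : w (g z) = z := hV z hz
    have hgz : w (g z) = g z :=
      hP.map_eq_self_of_mem_chamber hw (map_mem_chamber hg hzP) (by rwa [hwgz])
    rw [← hgz, hwgz]
  have hxP : x ∈ chamber P := fun v hv =>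
    (hx v hv).elim (fun hvV => (V.mem_orthogonal' v |>.1 hvV x hxV).ge) le_of_lt
  obtain ⟨ε, hε, hpos⟩ := exists_pos_forall_add_mul_pos P.finite_toSet (fun v => ⟪v, x⟫)
    fun v => ⟪v, y⟫
  have hxyV : x + ε • y ∈ V := V.add_mem hxV (V.smul_mem _ hy)
  have hxyP : x + ε • y ∈ chamber P := by
    intro v hv
    rcases hx v hv with hvV | hvx
    · exact (V.mem_orthogonal' v |>.1 hvV _ hxyV).ge
    · rw [inner_add_right, inner_smul_right]
      exact (hpos v hv hvx).le
  have hfix_xy := hfix _ hxyV hxyP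
  rw [map_add, map_smul, hfix x hxV hxP, add_right_inj] at hfix_xy
  exact smul_right_injective _ hε.ne' hfix_xy

end Existence

/-! ### Straightening a chamber -/

section Straighten

variable {n : ℕ}

/-- The elements of `G` preserving `P`. -/
def chamberStabilizer (G : Subgroup (O n)) (P : Finset (Euc n)) : Subgroup (O n) where
  carrier := {g | g ∈ G ∧ ∀ v, g v ∈ P ↔ v ∈ P}
  one_mem' := ⟨G.one_mem, fun _ => Iff.rfl⟩
  mul_mem' := fun {a b} ha hb => ⟨G.mul_mem ha.1 hb.1, fun v => (ha.2 (b v)).trans (hb.2 v)⟩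
  inv_mem' := fun {a} ha => ⟨G.inv_mem ha.1, fun v => by
    have hav : a (a⁻¹ v) = v := a.apply_symm_apply v
    rw [← ha.2, hav]⟩

/-- A unit vector in the interior of the chamber defined by `P`. The set `P` is required to be
nonempty, so that the chamber has a boundary. -/
structure IsCenter (P : Finset (Euc n)) (e : Euc n) : Prop where
  nonempty : P.Nonempty
  norm_eq : ‖e‖ = 1
  pos : ∀ v ∈ P, 0 < ⟪v, e⟫

/- The sum of the translates of an interior point under the stabilizer is fixed by it. -/
theorem IsPositiveSystem.exists_isCenter {W : Subgroup (O n)} {P : Finset (Euc n)} {ξ : Euc n}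
    (hP : IsPositiveSystem W P ξ) (hne : P.Nonempty) (G : Subgroup (O n)) [Finite G] :
    ∃ e : Euc n, IsCenter P e ∧ ∀ g ∈ chamberStabilizer G P, g e = e := by
  have : Finite (chamberStabilizer G P) := Finite.Set.subset (G : Set (O n)) fun g hg => hg.1
  have := Fintype.ofFinite (chamberStabilizer G P)
  let e : Euc n := ∑ g : chamberStabilizer G P, (g : O n) ξ
  have hpos : ∀ v ∈ P, 0 < ⟪v, e⟫ := by
    intro v hv
    rw [inner_sum]
    refine Finset.sum_pos (fun g _ => ?_) ⟨1, Finset.mem_univ _⟩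
    obtain ⟨u, rfl⟩ := (g : O n).surjective v
    rw [LinearIsometryEquiv.inner_map_map, real_inner_comm]
    exact hP.inner_pos ((g.2.2 u).1 hv)
  have hfix : ∀ g ∈ chamberStabilizer G P, g e = e := by
    intro g hg
    rw [map_sum]
    exact Fintype.sum_equiv (Equiv.mulLeft (⟨g, hg⟩ : chamberStabilizer G P)) _ _ fun k => rfl
  have he : e ≠ 0 := by
    obtain ⟨v, hv⟩ := hne
    intro he0
    exact (hpos v hv).ne' (by rw [he0, inner_zero_right])
  refine ⟨‖e‖⁻¹ • e, ⟨hne, norm_smul_inv_norm he, fun v hv => ?_⟩, fun g hg => ?_⟩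
  · rw [inner_smul_right]
    exact mul_pos (inv_pos.2 (norm_pos_iff.2 he)) (hpos v hv)
  · rw [map_smul, hfix g hg]

namespace IsCenter

variable {P : Finset (Euc n)} {e : Euc n}

theorem inner_self (he : IsCenter P e) : ⟪e, e⟫ = 1 := by
  rw [real_inner_self_eq_norm_sq, he.norm_eq, one_pow]

/-- The height above the boundary of the chamber in the direction of `e`. -/
def height (he : IsCenter P e) (x : Euc n) : ℝ :=
  P.inf' he.nonempty fun v => ⟪v, x⟫ / ⟪v, e⟫

theorem continuous_height (he : IsCenter P e) : Continuous he.height :=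
  Continuous.finset_inf'_apply he.nonempty fun v _ => by fun_prop

theorem le_height_iff (he : IsCenter P e) {x : Euc n} {t : ℝ} :
    t ≤ he.height x ↔ ∀ v ∈ P, t * ⟪v, e⟫ ≤ ⟪v, x⟫ := by
  rw [height, Finset.le_inf'_iff]
  exact forall₂_congr fun v hv => le_div_iff₀ (he.pos v hv)

theorem mem_chamber_iff (he : IsCenter P e) {x : Euc n} : x ∈ chamber P ↔ 0 ≤ he.height x := by
  simp only [he.le_height_iff, zero_mul, chamber, mem_ofPred_eq]

theorem height_pos_iff (he : IsCenter P e) {x : Euc n} :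
    0 < he.height x ↔ ∀ v ∈ P, 0 < ⟪v, x⟫ := by
  rw [height, Finset.lt_inf'_iff]
  exact forall₂_congr fun v hv => div_pos_iff_of_pos_right (he.pos v hv)

theorem exists_height_eq (he : IsCenter P e) (x : Euc n) :
    ∃ v ∈ P, he.height x = ⟪v, x⟫ / ⟪v, e⟫ := Finset.exists_mem_eq_inf' he.nonempty _

theorem height_add_smul (he : IsCenter P e) (x : Euc n) (t : ℝ) :
    he.height (x + t • e) = he.height x + t := by
  refine eq_of_forall_le_iff fun s => ?_
  rw [← sub_le_iff_le_add, he.le_height_iff, he.le_height_iff]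
  refine forall₂_congr fun v _ => ?_
  rw [inner_add_right, inner_smul_right, sub_mul, sub_le_iff_le_add]

theorem height_map (he : IsCenter P e) {g : O n} (hg : ∀ v, g v ∈ P ↔ v ∈ P) (hge : g e = e)
    (x : Euc n) : he.height (g x) = he.height x := by
  refine eq_of_forall_le_iff fun t => ?_
  rw [he.le_height_iff, he.le_height_iff, g.surjective.forall]
  refine forall_congr' fun v => imp_congr (hg v) ?_
  nth_rewrite 1 [← hge]
  rw [g.inner_map_map, g.inner_map_map]

theorem height_eq_iff (he : IsCenter P e) {v : Euc n} (hv : v ∈ P) {x : Euc n} :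
    he.height x = ⟪v, x⟫ / ⟪v, e⟫ ↔ ∀ u ∈ P, ⟪v, x⟫ / ⟪v, e⟫ ≤ ⟪u, x⟫ / ⟪u, e⟫ := by
  have hle : he.height x ≤ ⟪v, x⟫ / ⟪v, e⟫ := Finset.inf'_le _ hv
  rw [← hle.ge_iff_eq, height, Finset.le_inf'_iff]

/-- The shear along `e` that takes the chamber to a half space. -/
def straighten (he : IsCenter P e) : Euc n ≃ₜ Euc n where
  toFun x := x + (he.height x - ⟪e, x⟫) • e
  invFun y := y + (⟪e, y⟫ - he.height y) • e
  left_inv x := by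
    simp only [he.height_add_smul, inner_add_right, inner_smul_right, he.inner_self]
    module
  right_inv y := by
    simp only [he.height_add_smul, inner_add_right, inner_smul_right, he.inner_self]
    module
  continuous_toFun := by
    have := he.continuous_height
    fun_prop
  continuous_invFun := by
    have := he.continuous_height
    fun_prop

theorem straighten_apply (he : IsCenter P e) (x : Euc n) :
    he.straighten x = x + (he.height x - ⟪e, x⟫) • e := rfl

theorem inner_straighten (he : IsCenter P e) (x : Euc n) : ⟪e, he.straighten x⟫ = he.height x := by
  rw [straighten_apply, inner_add_right, inner_smul_right, he.inner_self, mul_one,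
    add_sub_cancel]

theorem straighten_map (he : IsCenter P e) {g : O n} (hg : ∀ v, g v ∈ P ↔ v ∈ P) (hge : g e = e)
    (x : Euc n) : he.straighten (g x) = g (he.straighten x) := by
  have hinner : ⟪e, g x⟫ = ⟪e, x⟫ := by
    nth_rewrite 1 [← hge]
    exact g.inner_map_map e x
  rw [straighten_apply, straighten_apply, he.height_map hg hge, hinner, map_add, map_smul, hge]

/- The shear is linear on each of the cones on which a given `v ∈ P` attains the height. -/
theorem isPL_straighten (he : IsCenter P e) : IsPL he.straighten := by
  let ratio (v : Euc n) : Euc n →L[ℝ] ℝ := ⟪v, e⟫⁻¹ • innerSL ℝ v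
  have hratio (v x : Euc n) : ratio v x = ⟪v, x⟫ / ⟪v, e⟫ := (div_eq_inv_mul _ _).symm
  let shear (v : Euc n) : Euc n →ₗ[ℝ] Euc n :=
    LinearMap.id + ((ratio v : Euc n →ₗ[ℝ] ℝ) - innerₛₗ ℝ e).smulRight e
  have hcone (v : P) (x : Euc n) :
      (∀ u ∈ P, 0 ≤ (ratio u - ratio v) x) ↔ he.height x = ratio v x := by
    rw [hratio, he.height_eq_iff v.2]
    refine forall₂_congr fun u _ => ?_
    rw [sub_apply, sub_nonneg, hratio, hratio]
  refine IsPL.of_eqOn_cover (S := fun v : P => {x | ∀ u ∈ P, 0 ≤ (ratio u - ratio v) x})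
    (g := fun v => shear v) (fun x => ?_) (fun v Q hQ => hQ.inter_forall_nonneg P _)
    (fun v => isPL_linearMap _) fun v x hx => ?_
  · obtain ⟨v, hv, hvx⟩ := he.exists_height_eq x
    exact ⟨⟨v, hv⟩, (hcone ⟨v, hv⟩ x).2 (hvx.trans (hratio v x).symm)⟩
  · rw [straighten_apply, (hcone v x).1 hx]
    rfl

end IsCenter

end Straighten

/-! ### Unfolding a chamber -/

section Unfold

theorem apply_mem_iff_of_forall {α : Type*} {P : Finset α} {f : α → α}
    (hf : Function.Injective f) (hfP : ∀ v ∈ P, f v ∈ P) (v : α) : f v ∈ P ↔ v ∈ P := by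
  refine ⟨fun hv => ?_, hfP v⟩
  obtain ⟨u, hu, huv⟩ := Finset.surjOn_of_injOn_of_card_le f hfP hf.injOn le_rfl hv
  rwa [← hf huv]

theorem isClosedMap_of_eqOn_cover {X Y ι : Type*} [TopologicalSpace X] [TopologicalSpace Y]
    [Finite ι] {S : ι → Set X} {f : X → Y} {g : ι → X → Y} (hcover : ∀ x, ∃ i, x ∈ S i)
    (hS : ∀ i, IsClosed (S i)) (hg : ∀ i, IsClosedMap (g i)) (hfg : ∀ i, EqOn f (g i) (S i)) :
    IsClosedMap f := by
  intro A hA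
  have himage : f '' A = ⋃ i, g i '' (A ∩ S i) := by
    conv_lhs => rw [← inter_univ A, ← iUnion_eq_univ_iff.2 hcover, inter_iUnion, image_iUnion]
    exact iUnion_congr fun i => ((hfg i).mono inter_subset_right).image_eq
  rw [himage]
  exact isClosed_iUnion_of_finite fun i => hg i _ (hA.inter (hS i))

variable {n : ℕ}

theorem detHom_inv (g : O n) : detHom n g⁻¹ = detHom n g := by
  have hdet : detHom n g * detHom n g⁻¹ = 1 := by rw [← map_mul, mul_inv_cancel, map_one]
  rcases detHom_eq_one_or_eq_neg_one g with hg | hg <;> rw [hg] at hdet ⊢ <;> linarith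

theorem detHom_conj (g w : O n) : detHom n (g * w * g⁻¹) = detHom n w := by
  rw [map_mul, map_mul, mul_right_comm, ← map_mul, mul_inv_cancel, map_one, one_mul]

/-- The homomorphism that takes the elements of determinant `-1` to the reflection along `e`. -/
def detReflection (e : Euc n) : O n →* O n where
  toFun w := if detHom n w = 1 then 1 else reflectionAlong e
  map_one' := if_pos (map_one _)
  map_mul' w w' := by
    rcases detHom_eq_one_or_eq_neg_one w with hw | hw <;>
      rcases detHom_eq_one_or_eq_neg_one w' with hw' | hw' <;>
      norm_num [hw, hw', reflectionAlong_mul_self]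

theorem detReflection_of_detHom_eq_one (e : Euc n) {w : O n} (hw : detHom n w = 1) :
    detReflection e w = 1 := if_pos hw

theorem detReflection_of_detHom_eq_neg_one (e : Euc n) {w : O n} (hw : detHom n w = -1) :
    detReflection e w = reflectionAlong e :=
  if_neg (by rw [hw]; norm_num)

theorem detReflection_congr (e : Euc n) {w w' : O n} (hw : detHom n w = detHom n w') :
    detReflection e w = detReflection e w' := by
  change ite _ _ _ = ite _ _ _
  rw [hw]

theorem detReflection_apply_of_inner_eq_zero {e x : Euc n} (hx : ⟪e, x⟫ = 0) (w : O n) :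
    detReflection e w x = x := by
  rcases detHom_eq_one_or_eq_neg_one w with hw | hw
  · rw [detReflection_of_detHom_eq_one e hw]
    rfl
  · rw [detReflection_of_detHom_eq_neg_one e hw]
    exact reflectionAlong_of_inner_eq_zero hx

theorem inner_detReflection_apply (e : Euc n) (w : O n) (x : Euc n) :
    ⟪e, detReflection e w x⟫ = detHom n w * ⟪e, x⟫ := by
  rcases detHom_eq_one_or_eq_neg_one w with hw | hw
  · rw [detReflection_of_detHom_eq_one e hw, hw, one_mul]
    rfl
  · rw [detReflection_of_detHom_eq_neg_one e hw, hw, neg_one_mul,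
      ← (reflectionAlong e).inner_map_map e, reflectionAlong_reflectionAlong, reflectionAlong_self,
      inner_neg_left]

theorem commute_reflectionAlong_of_apply_eq_self {g : O n} {e : Euc n} (hge : g e = e) :
    Commute g (reflectionAlong e) := by
  have hconj := mul_reflectionAlong_mul_inv g e
  rwa [hge, mul_inv_eq_iff_eq_mul] at hconj

theorem commute_detReflection_of_apply_eq_self {g : O n} {e : Euc n} (hge : g e = e) (w : O n) :
    Commute g (detReflection e w) := by
  rcases detHom_eq_one_or_eq_neg_one w with hw | hw
  · rw [detReflection_of_detHom_eq_one e hw]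
    exact Commute.one_right g
  · rw [detReflection_of_detHom_eq_neg_one e hw]
    exact commute_reflectionAlong_of_apply_eq_self hge

variable {W : Subgroup (O n)} {P : Finset (Euc n)} {ξ e : Euc n}

theorem IsPositiveSystem.eq_one_of_map_eq_self (hP : IsPositiveSystem W P ξ) {w : O n}
    (hw : w ∈ W) {x : Euc n} (hx : ∀ v ∈ P, 0 < ⟪v, x⟫) (hwx : w x = x) : w = 1 := by
  refine hP.eq_one_of_forall_map_mem hw fun v hv => ?_
  refine (hP.map_mem_or_neg_map_mem (Subgroup.le_normalizer hw) hv).resolve_right fun hneg => ?_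
  have hlt := hx _ hneg
  rw [← hwx, inner_neg_left, w.inner_map_map] at hlt
  linarith [hx v hv]

theorem IsCenter.isClosed_chamber (he : IsCenter P e) : IsClosed (chamber P) := by
  have hpreimage : chamber P = he.height ⁻¹' Ici 0 := by
    ext x
    exact he.mem_chamber_iff
  rw [hpreimage]
  exact isClosed_Ici.preimage he.continuous_height

/- On the boundary of the chamber the reflection along `e` acts trivially after straightening, and
the translates of the interior are disjoint. -/
theorem detReflection_straighten_eq (hP : IsPositiveSystem W P ξ) (he : IsCenter P e) {w w' : O n}
    (hw : w ∈ W) (hw' : w' ∈ W) {x : Euc n} (hx : w x ∈ chamber P) (hx' : w' x ∈ chamber P) :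
    detReflection e w (he.straighten (w x)) = detReflection e w' (he.straighten (w' x)) := by
  have hu : w' * w⁻¹ ∈ W := W.mul_mem hw' (W.inv_mem hw)
  have hux : (w' * w⁻¹) (w x) = w' x := congrArg w' (w.symm_apply_apply x)
  have hfix : (w' * w⁻¹) (w x) = w x := hP.map_eq_self_of_mem_chamber hu hx (by rwa [hux])
  rw [← hux, hfix]
  rcases (he.mem_chamber_iff.1 hx).eq_or_lt with hheight | hheight
  · have hinner : ⟪e, he.straighten (w x)⟫ = 0 := (he.inner_straighten _).trans hheight.symm
    rw [detReflection_apply_of_inner_eq_zero hinner, detReflection_apply_of_inner_eq_zero hinner]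
  · rw [mul_inv_eq_one.1 (hP.eq_one_of_map_eq_self hu (he.height_pos_iff.1 hheight) hfix)]

/-- The homeomorphism that agrees with the unfolding on the translate `w⁻¹ C` of the chamber. -/
def unfoldPiece (he : IsCenter P e) (w : O n) : Euc n ≃ₜ Euc n :=
  (w.toHomeomorph.trans he.straighten).trans (detReflection e w).toHomeomorph

theorem isPL_unfoldPiece (he : IsCenter P e) (w : O n) : IsPL (unfoldPiece he w) :=
  (isPL_linearMap ((detReflection e w).toLinearEquiv : Euc n →ₗ[ℝ] Euc n)).comp
    (he.isPL_straighten.comp (isPL_linearMap (w.toLinearEquiv : Euc n →ₗ[ℝ] Euc n)))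

/-- The map `ℝ^n → ℝ^n` that straightens the chamber and unfolds its translates by even and odd
elements of `W` to the two half spaces bounded by `e^⊥`. -/
def unfold (hP : IsPositiveSystem W P ξ) (he : IsCenter P e) [Finite W] (x : Euc n) : Euc n :=
  detReflection e (hP.exists_map_mem_chamber x).choose
    (he.straighten ((hP.exists_map_mem_chamber x).choose x))

variable [Finite W]

theorem unfold_eq (hP : IsPositiveSystem W P ξ) (he : IsCenter P e) {w : O n} (hw : w ∈ W)
    {x : Euc n} (hx : w x ∈ chamber P) :
    unfold hP he x = detReflection e w (he.straighten (w x)) :=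
  detReflection_straighten_eq hP he (hP.exists_map_mem_chamber x).choose_spec.1 hw
    (hP.exists_map_mem_chamber x).choose_spec.2 hx

theorem unfold_of_mem_chamber (hP : IsPositiveSystem W P ξ) (he : IsCenter P e) {x : Euc n}
    (hx : x ∈ chamber P) : unfold hP he x = he.straighten x := by
  rw [unfold_eq hP he W.one_mem (x := x) hx, map_one]
  rfl

theorem unfold_map (hP : IsPositiveSystem W P ξ) (he : IsCenter P e) {w : O n} (hw : w ∈ W)
    (x : Euc n) : unfold hP he (w x) = detReflection e w (unfold hP he x) := by
  obtain ⟨u, hu, hux⟩ := hP.exists_map_mem_chamber x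
  have huw : (u * w⁻¹) (w x) = u x := congrArg u (w.symm_apply_apply x)
  have hdet : detReflection e (u * w⁻¹) = detReflection e (w * u) :=
    detReflection_congr e (by rw [map_mul, map_mul, detHom_inv, mul_comm])
  rw [unfold_eq hP he (W.mul_mem hu (W.inv_mem hw)) (by rwa [huw]), huw, hdet, map_mul,
    unfold_eq hP he hu hux]
  rfl

theorem unfold_map_of_mem_normalizer (hP : IsPositiveSystem W P ξ) (he : IsCenter P e) {g : O n}
    (hgW : g ∈ Subgroup.normalizer (W : Set (O n))) (hg : ∀ v, g v ∈ P ↔ v ∈ P) (hge : g e = e)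
    (x : Euc n) : unfold hP he (g x) = g (unfold hP he x) := by
  obtain ⟨u, hu, hux⟩ := hP.exists_map_mem_chamber x
  have hgu : (g * u * g⁻¹) (g x) = g (u x) :=
    congrArg (fun y => g (u y)) (g.symm_apply_apply x)
  have hconj : detReflection e (g * u * g⁻¹) = detReflection e u :=
    detReflection_congr e (detHom_conj g u)
  rw [unfold_eq hP he ((Subgroup.mem_normalizer_iff.1 hgW u).1 hu)
      (by rw [hgu]; exact map_mem_chamber hg hux),
    hgu, hconj, he.straighten_map hg hge, unfold_eq hP he hu hux]
  exact (LinearIsometryEquiv.congr_fun (commute_detReflection_of_apply_eq_self hge u)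
    (he.straighten (u x))).symm

theorem eq_and_of_detReflection_straighten_eq (he : IsCenter P e) {x y : Euc n}
    (hx : x ∈ chamber P) (hy : y ∈ chamber P) {w w' : O n}
    (hxy : detReflection e w (he.straighten x) = detReflection e w' (he.straighten y)) :
    x = y ∧ (detHom n w = detHom n w' ∨ he.height x = 0) := by
  by_cases hdet : detHom n w = detHom n w'
  · rw [detReflection_congr e hdet] at hxy
    exact ⟨he.straighten.injective ((detReflection e w').injective hxy), .inl hdet⟩
  · have hinner := congrArg (fun z => ⟪e, z⟫) hxy
    simp only [inner_detReflection_apply, he.inner_straighten] at hinner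
    have hx0 := he.mem_chamber_iff.1 hx
    have hy0 := he.mem_chamber_iff.1 hy
    have hheight : he.height x = 0 ∧ he.height y = 0 := by
      rcases detHom_eq_one_or_eq_neg_one w with hw | hw <;>
        rcases detHom_eq_one_or_eq_neg_one w' with hw' | hw' <;>
        rw [hw, hw'] at hinner hdet <;> first | exact absurd rfl hdet | constructor <;> linarith
    rw [detReflection_apply_of_inner_eq_zero ((he.inner_straighten x).trans hheight.1),
      detReflection_apply_of_inner_eq_zero ((he.inner_straighten y).trans hheight.2)] at hxy
    exact ⟨he.straighten.injective hxy, .inr hheight.1⟩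

theorem exists_reflectionAlong_apply_eq_self_of_height_eq_zero (he : IsCenter P e) {x : Euc n}
    (hx : he.height x = 0) : ∃ v ∈ P, reflectionAlong v x = x := by
  obtain ⟨v, hv, hvx⟩ := he.exists_height_eq x
  rw [hx, eq_comm, div_eq_zero_iff] at hvx
  exact ⟨v, hv, reflectionAlong_of_inner_eq_zero (hvx.resolve_right (he.pos v hv).ne')⟩

theorem unfold_eq_iff (hP : IsPositiveSystem W P ξ) (he : IsCenter P e) (x y : Euc n) :
    unfold hP he x = unfold hP he y ↔ ∃ g ∈ orientationPreserving W, g x = y := by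
  constructor
  · intro hxy
    obtain ⟨w, hw, hwx⟩ := hP.exists_map_mem_chamber x
    obtain ⟨w', hw', hwy⟩ := hP.exists_map_mem_chamber y
    rw [unfold_eq hP he hw hwx, unfold_eq hP he hw' hwy] at hxy
    obtain ⟨heq, hdet⟩ := eq_and_of_detReflection_straighten_eq he hwx hwy hxy
    obtain ⟨u, hu, huw, hdetu⟩ : ∃ u ∈ W, u (w x) = w' y ∧ detHom n (u * w) = detHom n w' := by
      by_cases hww' : detHom n w = detHom n w'
      · exact ⟨1, W.one_mem, heq, by rwa [one_mul]⟩
      · obtain ⟨v, hv, hvx⟩ :=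
          exists_reflectionAlong_apply_eq_self_of_height_eq_zero he (hdet.resolve_left hww')
        refine ⟨reflectionAlong v, hP.reflectionAlong_mem hv, hvx.trans heq, ?_⟩
        rw [map_mul, detHom_reflectionAlong (hP.norm_eq_one hv)]
        rcases detHom_eq_one_or_eq_neg_one w with h | h <;>
          rcases detHom_eq_one_or_eq_neg_one w' with h' | h' <;>
          rw [h, h'] at hww' ⊢ <;> first | exact absurd rfl hww' | norm_num
    refine ⟨w'⁻¹ * (u * w), mem_orientationPreserving.2
      ⟨W.mul_mem (W.inv_mem hw') (W.mul_mem hu hw), ?_⟩, ?_⟩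
    · rw [map_mul, hdetu, ← map_mul, inv_mul_cancel, map_one]
    · change w'⁻¹ (u (w x)) = y
      rw [huw]
      exact w'.symm_apply_apply y
  · rintro ⟨g, hg, rfl⟩
    rw [unfold_map hP he hg.1, detReflection_of_detHom_eq_one e hg.2]
    rfl

theorem surjective_unfold (hP : IsPositiveSystem W P ξ) (he : IsCenter P e) :
    Function.Surjective (unfold hP he) := by
  have hhalf : ∀ y, 0 ≤ ⟪e, y⟫ → ∃ x, unfold hP he x = y := by
    intro y hy
    refine ⟨he.straighten.symm y, ?_⟩
    rw [unfold_of_mem_chamber hP he, he.straighten.apply_symm_apply]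
    rwa [he.mem_chamber_iff, ← he.inner_straighten, he.straighten.apply_symm_apply]
  intro y
  obtain ⟨v, hv⟩ := he.nonempty
  have hdet := detHom_reflectionAlong (hP.norm_eq_one hv)
  rcases le_total 0 ⟪e, y⟫ with hy | hy
  · exact hhalf y hy
  · obtain ⟨x, hx⟩ := hhalf (detReflection e (reflectionAlong v) y) (by
      rw [inner_detReflection_apply, hdet]
      linarith)
    refine ⟨reflectionAlong v x, ?_⟩
    rw [unfold_map hP he (hP.reflectionAlong_mem hv), hx,
      detReflection_of_detHom_eq_neg_one e hdet, reflectionAlong_reflectionAlong]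

theorem isOrbitMap_unfold (hP : IsPositiveSystem W P ξ) (he : IsCenter P e) :
    IsOrbitMap (orientationPreserving W) (unfold hP he) := by
  let S (w : W) : Set (Euc n) := (w : O n) ⁻¹' chamber P
  have heqOn (w : W) : EqOn (unfold hP he) (unfoldPiece he w) (S w) := fun x hx =>
    unfold_eq hP he w.2 hx
  have hcover (x : Euc n) : ∃ w, x ∈ S w := by
    obtain ⟨w, hw, hwx⟩ := hP.exists_map_mem_chamber x
    exact ⟨⟨w, hw⟩, hwx⟩
  have hclosed (w : W) : IsClosed (S w) := he.isClosed_chamber.preimage (w : O n).continuous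
  have hcone (w : W) (Q : Set (Euc n)) (hQ : IsFinUnion Q) : IsFinUnion (Q ∩ S w) :=
    hQ.inter_forall_nonneg P fun v =>
      (innerSL ℝ v).comp ((w : O n).toContinuousLinearEquiv : Euc n →L[ℝ] Euc n)
  exact
    { isPL := IsPL.of_eqOn_cover hcover hcone (fun w => isPL_unfoldPiece he w) heqOn
      continuous := (locallyFinite_of_finite S).continuous (iUnion_eq_univ_iff.2 hcover) hclosed
        fun w => (unfoldPiece he w).continuous.continuousOn.congr (heqOn w)
      isClosedMap := isClosedMap_of_eqOn_cover hcover hclosed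
        (fun w => (unfoldPiece he w).isClosedMap) heqOn
      eq_iff := unfold_eq_iff hP he }

end Unfold

/-! ### Linearized actions on orbit spaces -/

section Linearization

theorem exists_eq_of_forall_exists_apply_eq {ι k E F : Type*} [Finite ι] [DivisionRing k]
    [Infinite k] [AddCommGroup E] [Module k E] [AddCommGroup F] [Module k F] {f : ι → E →ₗ[k] F}
    {g : E →ₗ[k] F} (hfg : ∀ x, ∃ i, f i x = g x) : ∃ i, f i = g := by
  obtain ⟨i, hi⟩ := Subspace.exists_eq_top_of_iUnion_eq_univ
    (p := fun i => LinearMap.eqLocus (f i) g) (iUnion_eq_univ_iff.2 hfg)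
  exact ⟨i, LinearMap.eqLocus_eq_top.1 hi⟩

variable {n : ℕ}

theorem mem_of_forall_exists_apply_eq {H : Subgroup (O n)} [Finite H] {k : O n}
    (hk : ∀ x, ∃ g ∈ H, g x = k x) : k ∈ H := by
  obtain ⟨g, hg⟩ := exists_eq_of_forall_exists_apply_eq
    (f := fun g : H => ((g : O n).toLinearEquiv : Euc n →ₗ[ℝ] Euc n))
    (g := (k.toLinearEquiv : Euc n →ₗ[ℝ] Euc n))
    fun x => let ⟨g, hg, hgx⟩ := hk x; ⟨⟨g, hg⟩, hgx⟩
  have hgk : (g : O n) = k := LinearIsometryEquiv.ext fun x => LinearMap.congr_fun hg x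
  exact hgk ▸ g.2

/-- `F` identifies `ℝ^n/H` with `ℝ^n` in such a way that `G` acts on it linearly, through `r`. -/
structure IsLinearization (H G : Subgroup (O n)) (F : Euc n → Euc n) (r : G →* O n) : Prop where
  le : H ≤ G
  isOrbitMap : IsOrbitMap H F
  surjective : Function.Surjective F
  map_eq : ∀ (k : G) x, F ((k : O n) x) = r k (F x)

theorem IsOrbitMap.exists_isLinearization {H G : Subgroup (O n)} {F : Euc n → Euc n}
    (hF : IsOrbitMap H F) (hsurj : Function.Surjective F) (hHG : H ≤ G)
    (hG : ∀ k ∈ G, ∃ a : O n, ∀ x, F (k x) = a (F x)) :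
    ∃ r : G →* O n, IsLinearization H G F r := by
  have hunique (a b : O n) (hab : ∀ x, a (F x) = b (F x)) : a = b :=
    DFunLike.coe_injective (hsurj.injective_comp_right (funext hab))
  choose! r hr using hG
  exact ⟨MonoidHom.mk' (fun k => r k) fun a b => hunique _ _ fun x => by
      rw [← hr _ (a * b).2]
      exact (hr a a.2 _).trans (congrArg (r a) (hr b b.2 x)),
    hHG, hF, hsurj, fun k => hr k k.2⟩

namespace IsLinearization

variable {H G K G' M : Subgroup (O n)} {F F' : Euc n → Euc n} {r : G →* O n} {r' : G' →* O n}

theorem eq_of_forall_apply (L : IsLinearization H G F r) {k : G} {a : O n}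
    (hk : ∀ x, F ((k : O n) x) = a (F x)) : r k = a :=
  DFunLike.coe_injective
    (L.surjective.injective_comp_right (funext fun x => (L.map_eq k x).symm.trans (hk x)))

theorem apply_eq_one_of_mem (L : IsLinearization H G F r) {k : G} (hk : (k : O n) ∈ H) :
    r k = 1 :=
  L.eq_of_forall_apply fun x => ((L.isOrbitMap.eq_iff x _).2 ⟨k, hk, rfl⟩).symm

/- An element of the kernel takes each point to a point of its `H`-orbit, so it agrees with a single
element of `H`. -/
theorem ker_eq [Finite H] (L : IsLinearization H G F r) : r.ker = H.subgroupOf G := by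
  refine le_antisymm (fun k hk => ?_) fun k hk => L.apply_eq_one_of_mem hk
  refine mem_of_forall_exists_apply_eq fun x => (L.isOrbitMap.eq_iff x _).1 ?_
  rw [G.subtype_apply, L.map_eq, MonoidHom.mem_ker.1 hk]
  rfl

theorem plLinearizationApplies [Finite H] (L : IsLinearization H G F r) :
    PLLinearizationApplies H G :=
  L.isOrbitMap.plLinearizationApplies L.surjective L.le r L.ker_eq L.map_eq

theorem comp (L : IsLinearization H G F r) (L' : IsLinearization K G' F' r')
    (hr : ∀ k, r k ∈ G') (hMG : M ≤ G) (hM : M.subgroupOf G = K.comap r) (hK : K ≤ r.range) :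
    IsLinearization M G (F' ∘ F) (r'.comp (r.codRestrict G' hr)) where
  le := hMG
  isOrbitMap := by
    have hmem (k : G) : (k : O n) ∈ M ↔ r k ∈ K := SetLike.ext_iff.1 hM k
    refine L'.isOrbitMap.comp L.isOrbitMap (fun g hg => ?_) (fun g hg => ?_) fun k hk => ?_
    · refine (hmem ⟨g, L.le hg⟩).2 ?_
      rw [L.apply_eq_one_of_mem hg]
      exact K.one_mem
    · exact ⟨r ⟨g, hMG hg⟩, (hmem ⟨g, hMG hg⟩).1 hg, L.map_eq ⟨g, hMG hg⟩⟩
    · obtain ⟨g, rfl⟩ := hK hk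
      exact ⟨g, (hmem g).2 hk, L.map_eq g⟩
  surjective := L'.surjective.comp L.surjective
  map_eq k x := (congrArg F' (L.map_eq k x)).trans (L'.map_eq ⟨r k, hr k⟩ (F x))

end IsLinearization

/-- A linearization of the action of `G` on `ℝ^n/W⁺` in which the elements of `W` of determinant
`-1` act as the reflection along `e`. The vector `e` has norm one, unless `W` is trivial. -/
structure IsReflectionLinearization (W G : Subgroup (O n)) (F : Euc n → Euc n) (r : G →* O n)
    (e : Euc n) : Prop extends IsLinearization (orientationPreserving W) G F r where
  apply_of_mem : ∀ k : G, (k : O n) ∈ W → r k = detReflection e k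
  norm_eq_one : W ≠ ⊥ → ‖e‖ = 1

/-- The element `γ` is the product of `w ∈ W` and an element `g` that is not changed by the
linearization `r` and fixes `e` and all fixed points of `γ`. -/
structure IsAdapted (W : Subgroup (O n)) {G : Subgroup (O n)} (r : G →* O n) (e : Euc n) (γ : G)
    (w g : O n) : Prop where
  left_mem : w ∈ W
  eq_mul : γ = w * g
  apply_eq : r γ = detReflection e w * g
  map_eq_self : g e = e
  fix_of_fix : ∀ x, (γ : O n) x = x → g x = x

variable {W G : Subgroup (O n)}

theorem orientationPreserving_le (W : Subgroup (O n)) : orientationPreserving W ≤ W :=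
  fun _ hw => hw.1

theorem orientationPreserving_bot : orientationPreserving (⊥ : Subgroup (O n)) = ⊥ :=
  le_bot_iff.1 (orientationPreserving_le ⊥)

theorem exists_isReflectionLinearization_bot (γ : G) :
    ∃ F r e, IsReflectionLinearization ⊥ G F r e ∧ ∃ w g, IsAdapted ⊥ r e γ w g := by
  refine ⟨id, G.subtype, 0, ⟨⟨?_, ?_, Function.surjective_id, fun _ _ => rfl⟩, ?_,
    fun hne => absurd rfl hne⟩, 1, γ, Subgroup.one_mem _, (one_mul _).symm, ?_, map_zero _,
    fun _ hx => hx⟩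
  · exact orientationPreserving_bot.trans_le bot_le
  · rw [orientationPreserving_bot]
    exact IsOrbitMap.id
  · intro k hk
    rw [G.subtype_apply, Subgroup.mem_bot.1 hk, map_one]
  · rw [map_one, one_mul, G.subtype_apply]

namespace IsPositiveSystem

variable {P : Finset (Euc n)} {ξ e : Euc n}

theorem nonempty (hP : IsPositiveSystem W P ξ) (hne : W ≠ ⊥) : P.Nonempty := by
  by_contra hempty
  rw [Finset.not_nonempty_iff_eq_empty] at hempty
  refine hne ?_
  rw [hP.generates, hempty, Finset.coe_empty, image_empty, Subgroup.closure_empty]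

theorem exists_eq_mul_mem_chamberStabilizer [Finite W] (hP : IsPositiveSystem W P ξ) (hWG : W ≤ G)
    (hN : G ≤ Subgroup.normalizer (W : Set (O n))) {k : O n} (hk : k ∈ G) :
    ∃ w ∈ W, ∃ g ∈ chamberStabilizer G P, k = w * g := by
  obtain ⟨w, hw, hwk⟩ := hP.exists_forall_mul_map_mem (hN hk)
  exact ⟨w⁻¹, W.inv_mem hw, w * k, ⟨G.mul_mem (hWG hw) hk,
    apply_mem_iff_of_forall (LinearIsometryEquiv.injective _) hwk⟩, (inv_mul_cancel_left w k).symm⟩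

theorem exists_isReflectionLinearization_unfold [Finite W] (hP : IsPositiveSystem W P ξ)
    (he : IsCenter P e) (hWG : W ≤ G) (hN : G ≤ Subgroup.normalizer (W : Set (O n)))
    (hfix : ∀ g ∈ chamberStabilizer G P, g e = e) :
    ∃ r, IsReflectionLinearization W G (unfold hP he) r e ∧ ∀ w ∈ W,
      ∀ g ∈ chamberStabilizer G P, ∀ k : G, k = w * g → r k = detReflection e w * g := by
  have hmul : ∀ w ∈ W, ∀ g ∈ chamberStabilizer G P, ∀ x,
      unfold hP he ((w * g) x) = (detReflection e w * g) (unfold hP he x) := fun w hw g hg x =>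
    (unfold_map hP he hw (g x)).trans (congrArg (detReflection e w)
      (unfold_map_of_mem_normalizer hP he (hN hg.1) hg.2 (hfix g hg) x))
  obtain ⟨r, L⟩ := (isOrbitMap_unfold hP he).exists_isLinearization (surjective_unfold hP he)
    ((orientationPreserving_le W).trans hWG) fun k hk => by
      obtain ⟨w, hw, g, hg, rfl⟩ := hP.exists_eq_mul_mem_chamberStabilizer hWG hN hk
      exact ⟨_, hmul w hw g hg⟩
  exact ⟨r, ⟨L, fun k hk => L.eq_of_forall_apply (unfold_map hP he hk), fun _ => he.norm_eq⟩,
    fun w hw g hg k hk => L.eq_of_forall_apply (hk ▸ hmul w hw g hg)⟩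

end IsPositiveSystem

/- A chamber containing as much as possible of the fixed space of `γ` is taken, so that the
part of `γ` outside `W` fixes this space. -/
theorem exists_isReflectionLinearization [Finite G] (hW : IsReflectionGroup W) (hWG : W ≤ G)
    (hN : G ≤ Subgroup.normalizer (W : Set (O n))) (γ : G) :
    ∃ F r e, IsReflectionLinearization W G F r e ∧ ∃ w g, IsAdapted W r e γ w g := by
  rcases eq_or_ne W ⊥ with rfl | hne
  · exact exists_isReflectionLinearization_bot γ
  have := hW.1
  let V : Submodule ℝ (Euc n) :=
    LinearMap.eqLocus ((γ : O n).toLinearEquiv : Euc n →ₗ[ℝ] Euc n) LinearMap.id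
  obtain ⟨P, ξ, hP, x₀, hx₀, hV⟩ := exists_isPositiveSystem hW V
  obtain ⟨e, he, hfix⟩ := hP.exists_isCenter (hP.nonempty hne) G
  obtain ⟨r, hr, hr_mul⟩ := hP.exists_isReflectionLinearization_unfold he hWG hN hfix
  obtain ⟨w, hw, g, hg, hγ⟩ := hP.exists_eq_mul_mem_chamberStabilizer hWG hN γ.2
  refine ⟨_, r, e, hr, w, g, hw, hγ, hr_mul w hw g hg γ hγ, hfix g hg, fun x hx => ?_⟩
  exact hP.map_eq_self_of_mul_map_eq_self hx₀ hV hw hg.2 (fun y hy => hγ ▸ hy) hx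

theorem ne_bot_of_detHom_eq_neg_one {w : O n} (hw : w ∈ W) (hdet : detHom n w = -1) : W ≠ ⊥ := by
  rintro rfl
  rw [Subgroup.mem_bot.1 hw, map_one] at hdet
  norm_num at hdet

namespace IsReflectionLinearization

variable {F : Euc n → Euc n} {r : G →* O n} {e : Euc n} {γ : G} {w g : O n}

theorem isReflection_reflectionAlong (L : IsReflectionLinearization W G F r e) (hne : W ≠ ⊥) :
    IsReflection (reflectionAlong e) :=
  PLQuot.isReflection_reflectionAlong (L.norm_eq_one hne)

theorem apply_of_isReflection (L : IsReflectionLinearization W G F r e) {s : G}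
    (hs : (s : O n) ∈ W) (hrefl : IsReflection (s : O n)) : r s = reflectionAlong e :=
  (L.apply_of_mem s hs).trans (detReflection_of_detHom_eq_neg_one e hrefl.detHom_eq_neg_one)

theorem isReflection_apply (L : IsReflectionLinearization W G F r e) (hγ : IsAdapted W r e γ w g)
    (hrefl : IsReflection (γ : O n)) : IsReflection (r γ) := by
  have hdet : detHom n w * detHom n g = -1 := by
    rw [← map_mul, ← hγ.eq_mul, hrefl.detHom_eq_neg_one]
  rw [hγ.apply_eq]
  rcases eq_of_fixCodim_le_one ((fixCodim_mono hγ.fix_of_fix).trans_eq hrefl) with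
    rfl | ⟨v, hv, rfl⟩
  · rw [map_one, mul_one] at hdet
    rw [detReflection_of_detHom_eq_neg_one e hdet, mul_one]
    exact L.isReflection_reflectionAlong (ne_bot_of_detHom_eq_neg_one hγ.left_mem hdet)
  · rw [detHom_reflectionAlong hv] at hdet
    rw [detReflection_of_detHom_eq_one e (by linarith), one_mul]
    exact PLQuot.isReflection_reflectionAlong hv

theorem exists_apply_eq_reflectionAlong_mul (L : IsReflectionLinearization W G F r e)
    (hγ : IsAdapted W r e γ w g) (hrot : IsRotation (γ : O n)) (hγW : (γ : O n) ∉ W) :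
    ∃ u v, ‖u‖ = 1 ∧ ‖v‖ = 1 ∧ r γ = reflectionAlong u * reflectionAlong v ∧
      (e = u ∨ ⟪u, e⟫ = 0 ∧ ⟪v, e⟫ = 0) := by
  have hdet : detHom n w * detHom n g = 1 := by rw [← map_mul, ← hγ.eq_mul, hrot.detHom_eq_one]
  have hg : g ≠ 1 := fun hg => hγW (by rw [hγ.eq_mul, hg, mul_one]; exact hγ.left_mem)
  have hr := hγ.apply_eq
  rcases eq_of_fixCodim_le_two ((fixCodim_mono hγ.fix_of_fix).trans_eq hrot) with
    rfl | ⟨v, hv, rfl⟩ | ⟨u, v, hu, hv, rfl⟩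
  · exact absurd rfl hg
  · rw [detHom_reflectionAlong hv] at hdet
    have hw : detHom n w = -1 := by linarith
    rw [detReflection_of_detHom_eq_neg_one e hw] at hr
    exact ⟨e, v, L.norm_eq_one (ne_bot_of_detHom_eq_neg_one hγ.left_mem hw), hv, hr, .inl rfl⟩
  · rw [map_mul, detHom_reflectionAlong hu, detHom_reflectionAlong hv] at hdet
    rw [detReflection_of_detHom_eq_one e (by linarith), one_mul] at hr
    exact ⟨u, v, hu, hv, hr,
      .inr (inner_eq_zero_of_reflectionAlong_mul_apply_eq hu hv hg hγ.map_eq_self)⟩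

end IsReflectionLinearization

end Linearization

/-! ### Groups generated by reflections -/

section ClosureReflectionAlong

theorem finite_sup_of_le_normalizer {G : Type*} [Group G] {N K : Subgroup G} [Finite N] [Finite K]
    (hK : K ≤ Subgroup.normalizer (N : Set G)) : Finite (N ⊔ K : Subgroup G) := by
  have hfin : ((N ⊔ K : Subgroup G) : Set G).Finite := by
    rw [Subgroup.coe_mul_of_right_le_normalizer_left N K hK]
    exact (toFinite (N : Set G)).mul (toFinite (K : Set G))
  exact hfin.to_subtype

variable {n : ℕ} {u v e : Euc n} {U : Set (Euc n)}

theorem mem_zpowers_reflectionAlong {g : O n} :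
    g ∈ Subgroup.zpowers (reflectionAlong v) ↔ g = 1 ∨ g = reflectionAlong v := by
  constructor
  · rintro ⟨k, rfl⟩
    rcases Int.even_or_odd' k with ⟨m, rfl | rfl⟩
    · exact .inl (by simp only [zpow_mul, zpow_two, reflectionAlong_mul_self, one_zpow])
    · exact .inr (by simp only [zpow_add, zpow_mul, zpow_two, reflectionAlong_mul_self, one_zpow,
        one_mul, zpow_one])
  · rintro (rfl | rfl)
    exacts [Subgroup.one_mem _, Subgroup.mem_zpowers _]

theorem detReflection_mem_zpowers (e : Euc n) (w : O n) :
    detReflection e w ∈ Subgroup.zpowers (reflectionAlong e) :=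
  mem_zpowers_reflectionAlong.2 (ite_eq_or_eq ..)

theorem finite_zpowers_reflectionAlong (v : Euc n) :
    Finite (Subgroup.zpowers (reflectionAlong v)) :=
  (toFinite {1, reflectionAlong v}).subset fun _ hg => mem_zpowers_reflectionAlong.1 hg

/- Conjugation by `reflectionAlong v` inverts the generators. -/
theorem zpowers_reflectionAlong_le_normalizer_closure (U : Set (Euc n)) (v : Euc n) :
    Subgroup.zpowers (reflectionAlong v) ≤ Subgroup.normalizer
      (Subgroup.closure ((fun u => reflectionAlong u * reflectionAlong v) '' U) : Set (O n)) := by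
  rw [Subgroup.le_normalizer_closure_iff]
  rintro a ha _ ⟨u, hu, rfl⟩
  have hmem := Subgroup.subset_closure
    (mem_image_of_mem (fun u => reflectionAlong u * reflectionAlong v) hu)
  rcases mem_zpowers_reflectionAlong.1 ha with rfl | rfl
  · rwa [one_mul, inv_one, mul_one]
  · have hconj : reflectionAlong v * (reflectionAlong u * reflectionAlong v) *
        (reflectionAlong v)⁻¹ = (reflectionAlong u * reflectionAlong v)⁻¹ := by
      rw [← mul_assoc, mul_inv_cancel_right, mul_inv_rev, reflectionAlong_inv, reflectionAlong_inv]
    rw [hconj]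
    exact Subgroup.inv_mem _ hmem

theorem closure_reflectionAlong_eq_sup (hv : v ∈ U) :
    Subgroup.closure (reflectionAlong '' U) =
      Subgroup.closure ((fun u => reflectionAlong u * reflectionAlong v) '' U) ⊔
        Subgroup.zpowers (reflectionAlong v) := by
  have hmem {u : Euc n} (hu : u ∈ U) :
      reflectionAlong u ∈ Subgroup.closure (reflectionAlong '' U) :=
    Subgroup.subset_closure (mem_image_of_mem _ hu)
  refine le_antisymm ?_ (sup_le ?_ (Subgroup.zpowers_le.2 (hmem hv))) <;> rw [Subgroup.closure_le]
  · rintro _ ⟨u, hu, rfl⟩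
    have hmul := Subgroup.mul_mem_sup (Subgroup.subset_closure (mem_image_of_mem
      (fun u => reflectionAlong u * reflectionAlong v) hu))
      (Subgroup.mem_zpowers (reflectionAlong v))
    rwa [mul_assoc, reflectionAlong_mul_self, mul_one] at hmul
  · rintro _ ⟨u, hu, rfl⟩
    exact Subgroup.mul_mem _ (hmem hu) (hmem hv)

theorem orientationPreserving_sup_zpowers_reflectionAlong {K : Subgroup (O n)}
    (hK : K ≤ (detHom n).ker) (hv : ‖v‖ = 1)
    (hvK : Subgroup.zpowers (reflectionAlong v) ≤ Subgroup.normalizer (K : Set (O n))) :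
    orientationPreserving (K ⊔ Subgroup.zpowers (reflectionAlong v)) = K := by
  refine le_antisymm (fun g hg => ?_) fun g hg => ⟨Subgroup.mem_sup_left hg, hK hg⟩
  obtain ⟨hgK, hgdet⟩ := mem_orientationPreserving.1 hg
  rw [← SetLike.mem_coe, Subgroup.coe_mul_of_right_le_normalizer_left _ _ hvK] at hgK
  obtain ⟨a, ha, b, hb, rfl⟩ := mem_mul.1 hgK
  rcases mem_zpowers_reflectionAlong.1 hb with rfl | rfl
  · rwa [mul_one]
  · rw [map_mul, hK ha, detHom_reflectionAlong hv] at hgdet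
    norm_num at hgdet

theorem orientationPreserving_closure_reflectionAlong (hU : ∀ u ∈ U, ‖u‖ = 1) (hv : v ∈ U) :
    orientationPreserving (Subgroup.closure (reflectionAlong '' U)) =
      Subgroup.closure ((fun u => reflectionAlong u * reflectionAlong v) '' U) := by
  rw [closure_reflectionAlong_eq_sup hv]
  refine orientationPreserving_sup_zpowers_reflectionAlong ?_ (hU v hv)
    (zpowers_reflectionAlong_le_normalizer_closure U v)
  rw [Subgroup.closure_le]
  rintro _ ⟨u, hu, rfl⟩
  rw [SetLike.mem_coe, MonoidHom.mem_ker, map_mul, detHom_reflectionAlong (hU u hu),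
    detHom_reflectionAlong (hU v hv), neg_one_mul, neg_neg]

theorem isReflectionGroup_closure {S : Set (O n)} (hfin : Finite (Subgroup.closure S))
    (hS : ∀ g ∈ S, IsReflection g) : IsReflectionGroup (Subgroup.closure S) :=
  ⟨hfin, le_antisymm (Subgroup.closure_mono fun g hg => ⟨Subgroup.subset_closure hg, hS g hg⟩)
    ((Subgroup.closure_le _).2 fun _ hg => hg.1)⟩

/-- The dihedral group generated by the reflections along `u` and `v`. -/
def dihedral (u v : Euc n) : Subgroup (O n) :=
  Subgroup.closure (reflectionAlong '' {v, u})

theorem dihedral_eq_sup (u v : Euc n) : dihedral u v =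
    Subgroup.zpowers (reflectionAlong u * reflectionAlong v) ⊔
      Subgroup.zpowers (reflectionAlong v) := by
  rw [dihedral, closure_reflectionAlong_eq_sup (mem_insert v {u}), image_pair,
    reflectionAlong_mul_self, Subgroup.closure_insert_one, ← Subgroup.zpowers_eq_closure]

theorem isReflectionGroup_dihedral (hu : ‖u‖ = 1) (hv : ‖v‖ = 1)
    (huv : IsOfFinOrder (reflectionAlong u * reflectionAlong v)) :
    IsReflectionGroup (dihedral u v) := by
  have : Finite (Subgroup.zpowers (reflectionAlong u * reflectionAlong v)) := huv.finite_zpowers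
  have := finite_zpowers_reflectionAlong v
  refine isReflectionGroup_closure ?_ ?_
  · rw [← dihedral, dihedral_eq_sup]
    refine finite_sup_of_le_normalizer ?_
    rw [Subgroup.zpowers_eq_closure (reflectionAlong u * reflectionAlong v),
      ← image_singleton (f := fun u => reflectionAlong u * reflectionAlong v)]
    exact zpowers_reflectionAlong_le_normalizer_closure {u} v
  · rw [image_pair]
    rintro _ (rfl | rfl)
    exacts [isReflection_reflectionAlong hv, isReflection_reflectionAlong hu]

theorem orientationPreserving_dihedral (hu : ‖u‖ = 1) (hv : ‖v‖ = 1) :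
    orientationPreserving (dihedral u v) =
      Subgroup.zpowers (reflectionAlong u * reflectionAlong v) := by
  have hnorm : ∀ x ∈ ({v, u} : Set (Euc n)), ‖x‖ = 1 := by
    rintro _ (rfl | rfl) <;> assumption
  rw [dihedral, orientationPreserving_closure_reflectionAlong hnorm (mem_insert v {u}), image_pair,
    reflectionAlong_mul_self, Subgroup.closure_insert_one, ← Subgroup.zpowers_eq_closure]

theorem zpowers_reflectionAlong_le_normalizer_dihedral (he : e = u ∨ ⟪u, e⟫ = 0 ∧ ⟪v, e⟫ = 0) :
    Subgroup.zpowers (reflectionAlong e) ≤ Subgroup.normalizer (dihedral u v : Set (O n)) := by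
  rw [Subgroup.zpowers_le]
  rcases he with rfl | ⟨hue, hve⟩
  · exact Subgroup.le_normalizer (Subgroup.subset_closure
      (mem_image_of_mem _ (mem_insert_of_mem v rfl)))
  · refine Subgroup.le_normalizer_closure_iff.2 ?_ (Subgroup.mem_zpowers (reflectionAlong e))
    rintro a ⟨k, rfl⟩ g hg
    have hge : g e = e := by
      rw [image_pair] at hg
      rcases hg with rfl | rfl
      exacts [reflectionAlong_of_inner_eq_zero hve, reflectionAlong_of_inner_eq_zero hue]
    have hcomm := (commute_reflectionAlong_of_apply_eq_self hge).symm.zpow_left k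
    rw [hcomm.eq, mul_inv_cancel_right]
    exact Subgroup.subset_closure hg

end ClosureReflectionAlong

/-! ### Folding along a hyperplane -/

section Folding

variable {n : ℕ} {e : Euc n}

/-- The map that fixes the half space `0 ≤ ⟪e, y⟫` and reflects its complement onto it. -/
def fold (e y : Euc n) : Euc n :=
  if 0 ≤ ⟪e, y⟫ then y else reflectionAlong e y

theorem fold_of_nonneg {y : Euc n} (hy : 0 ≤ ⟪e, y⟫) : fold e y = y := if_pos hy

theorem fold_of_nonpos {y : Euc n} (hy : ⟪e, y⟫ ≤ 0) : fold e y = reflectionAlong e y := by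
  rcases hy.eq_or_lt with hy | hy
  · rw [fold_of_nonneg hy.ge, reflectionAlong_of_inner_eq_zero hy]
  · exact if_neg hy.not_ge

theorem fold_eq_or_eq (e y : Euc n) : fold e y = y ∨ fold e y = reflectionAlong e y :=
  ite_eq_or_eq ..

theorem inner_reflectionAlong_self (he : ‖e‖ = 1) (y : Euc n) :
    ⟪e, reflectionAlong e y⟫ = -⟪e, y⟫ := by
  rw [reflectionAlong_apply he, inner_sub_right, inner_smul_right, real_inner_self_eq_norm_sq, he]
  ring

theorem fold_reflectionAlong (he : ‖e‖ = 1) (y : Euc n) :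
    fold e (reflectionAlong e y) = fold e y := by
  have hinner := inner_reflectionAlong_self he y
  rcases le_total 0 ⟪e, y⟫ with hy | hy
  · rw [fold_of_nonneg hy, fold_of_nonpos (by linarith), reflectionAlong_reflectionAlong]
  · rw [fold_of_nonpos hy, fold_of_nonneg (by linarith)]

theorem range_fold (he : ‖e‖ = 1) : range (fold e) = {y | 0 ≤ ⟪e, y⟫} := by
  refine Subset.antisymm ?_ fun y hy => ⟨y, fold_of_nonneg hy⟩
  rintro _ ⟨y, rfl⟩
  rcases le_total 0 ⟪e, y⟫ with hy | hy
  · rwa [fold_of_nonneg hy]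
  · rw [fold_of_nonpos hy, mem_ofPred_eq, inner_reflectionAlong_self he]
    exact neg_nonneg.2 hy

theorem fold_eq_iff (he : ‖e‖ = 1) (x y : Euc n) :
    fold e x = fold e y ↔ ∃ g ∈ Subgroup.zpowers (reflectionAlong e), g x = y := by
  constructor
  · intro hxy
    obtain ⟨s, hs, hsx⟩ : ∃ s ∈ Subgroup.zpowers (reflectionAlong e), fold e x = s x := by
      rcases fold_eq_or_eq e x with hx | hx
      exacts [⟨1, Subgroup.one_mem _, hx⟩, ⟨_, Subgroup.mem_zpowers _, hx⟩]
    obtain ⟨t, ht, hty⟩ : ∃ t ∈ Subgroup.zpowers (reflectionAlong e), fold e y = t y := by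
      rcases fold_eq_or_eq e y with hy | hy
      exacts [⟨1, Subgroup.one_mem _, hy⟩, ⟨_, Subgroup.mem_zpowers _, hy⟩]
    refine ⟨t⁻¹ * s, Subgroup.mul_mem _ (Subgroup.inv_mem _ ht) hs, ?_⟩
    change t.symm (s x) = y
    rw [← hsx, hxy, hty, t.symm_apply_apply]
  · rintro ⟨g, hg, rfl⟩
    rcases mem_zpowers_reflectionAlong.1 hg with rfl | rfl
    exacts [rfl, (fold_reflectionAlong he x).symm]

theorem isOrbitMap_fold (he : ‖e‖ = 1) :
    IsOrbitMap (Subgroup.zpowers (reflectionAlong e)) (fold e) := by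
  let L : Bool → Euc n →L[ℝ] ℝ := fun b => if b then innerSL ℝ e else -innerSL ℝ e
  let S : Bool → Set (Euc n) := fun b => {x | 0 ≤ L b x}
  let s : Bool → O n := fun b => if b then 1 else reflectionAlong e
  have hcover (x : Euc n) : ∃ b, x ∈ S b := by
    rcases le_total 0 ⟪e, x⟫ with hx | hx
    exacts [⟨true, hx⟩, ⟨false, neg_nonneg.2 hx⟩]
  have hfold (b : Bool) : EqOn (fold e) (s b) (S b) := by
    intro x hx
    cases b
    exacts [fold_of_nonpos (neg_nonneg.1 hx), fold_of_nonneg hx]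
  have hS (b : Bool) : IsClosed (S b) := isClosed_Ici.preimage (L b).continuous
  exact {
    isPL := IsPL.of_eqOn_cover hcover (fun b Q hQ => hQ.inter_nonneg (L b))
      (fun b => isPL_linearMap ((s b).toLinearEquiv : Euc n →ₗ[ℝ] Euc n)) hfold
    continuous := (locallyFinite_of_finite S).continuous (iUnion_eq_univ_iff.2 hcover) hS
      fun b => (s b).continuous.continuousOn.congr (hfold b)
    isClosedMap :=
      isClosedMap_of_eqOn_cover hcover hS (fun b => (s b).toHomeomorph.isClosedMap) hfold
    eq_iff := fold_eq_iff he }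

theorem IsOrbitMap.isometry_comp {G : Subgroup (O n)} {F : Euc n → Euc n} (hF : IsOrbitMap G F)
    (A : O n) : IsOrbitMap G (A ∘ F) where
  isPL := (isPL_linearMap (A.toLinearEquiv : Euc n →ₗ[ℝ] Euc n)).comp hF.isPL
  continuous := A.continuous.comp hF.continuous
  isClosedMap := A.toHomeomorph.isClosedMap.comp hF.isClosedMap
  eq_iff x y := A.injective.eq_iff.trans (hF.eq_iff x y)

theorem image_halfSpace_of_apply_eq {v w : Euc n} {A : O n} (hA : A v = w) :
    A '' {y | 0 ≤ ⟪v, y⟫} = {y | 0 ≤ ⟪w, y⟫} := by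
  refine (A.toEquiv.image_eq_preimage_symm _).trans (Set.ext fun y => ?_)
  change 0 ≤ ⟪v, A.symm y⟫ ↔ 0 ≤ ⟪w, y⟫
  rw [← hA, ← A.inner_map_map v, A.apply_symm_apply]

theorem exists_halfSpace_eq (hn : 0 < n) :
    ∃ w : Euc n, ‖w‖ = 1 ∧ halfSpace n = {y | 0 ≤ ⟪w, y⟫} := by
  let i : Fin n := ⟨0, hn⟩
  refine ⟨EuclideanSpace.single i 1, by simp, Set.ext fun y => ?_⟩
  rw [mem_ofPred_eq, EuclideanSpace.inner_single_left, map_one, one_mul]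
  exact ⟨fun hy => hy i rfl, fun hy j hj => by rwa [show j = i from Fin.ext hj]⟩

theorem IsReflection.exists_isOrbitMap_zpowers {τ : O n} (hτ : IsReflection τ) :
    ∃ Q, IsOrbitMap (Subgroup.zpowers τ) Q ∧ range Q = halfSpace n := by
  obtain ⟨v, hv, rfl⟩ := isReflection_iff_exists_reflectionAlong.1 hτ
  have hn : 0 < n := by
    rcases Nat.eq_zero_or_pos n with rfl | hn
    · rw [Subsingleton.elim v 0, norm_zero] at hv
      exact absurd hv zero_ne_one
    · exact hn
  obtain ⟨w, hw, hhalf⟩ := exists_halfSpace_eq hn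
  have hA : reflectionAlong (v - w) v = w := Submodule.reflection_sub (hv.trans hw.symm)
  refine ⟨_, (isOrbitMap_fold hv).isometry_comp (reflectionAlong (v - w)), ?_⟩
  rw [range_comp, range_fold hv, hhalf]
  exact image_halfSpace_of_apply_eq hA

end Folding

/-! ### Generation by reflections and rotations -/

section Generation

variable {n : ℕ} {W G K : Subgroup (O n)} {h : O n}

theorem isReflectionRotationGroup_of_eq_closure {S : Set (O n)} (hfin : Finite G)
    (hG : G = Subgroup.closure S)
    (hS : ∀ g ∈ S, g = 1 ∨ IsReflection g ∨ IsRotation g) : IsReflectionRotationGroup G := by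
  refine ⟨hfin, le_antisymm (hG.trans_le ?_) ((Subgroup.closure_le _).2 fun _ hg => hg.1)⟩
  refine (Subgroup.closure_le _).2 fun g hg => ?_
  rcases hS g hg with rfl | hg'
  · exact Subgroup.one_mem _
  · exact Subgroup.subset_closure ⟨hG ▸ Subgroup.subset_closure hg, hg'⟩

theorem IsReflectionGroup.isReflectionRotationGroup (hW : IsReflectionGroup W) :
    IsReflectionRotationGroup W :=
  isReflectionRotationGroup_of_eq_closure hW.1 hW.2 fun _ hg => .inr (.inl hg.2)

theorem IsReflectionGroup.eq_closure_roots (hW : IsReflectionGroup W) :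
    W = Subgroup.closure (reflectionAlong '' roots W) := by
  refine le_antisymm (hW.2.trans_le (Subgroup.closure_mono ?_)) ((Subgroup.closure_le _).2 ?_)
  · rintro g ⟨hg, hrefl⟩
    obtain ⟨v, hv, rfl⟩ := isReflection_iff_exists_reflectionAlong.1 hrefl
    exact mem_image_of_mem _ ⟨hv, hg⟩
  · rintro _ ⟨v, hv, rfl⟩
    exact hv.2

theorem IsReflectionGroup.roots_nonempty (hW : IsReflectionGroup W) (hne : W ≠ ⊥) :
    (roots W).Nonempty := by
  rw [nonempty_iff_ne_empty]
  intro hempty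
  refine hne ?_
  rw [hW.eq_closure_roots, hempty, image_empty, Subgroup.closure_empty]

theorem IsReflectionGroup.isReflectionRotationGroup_orientationPreserving
    (hW : IsReflectionGroup W) : IsReflectionRotationGroup (orientationPreserving W) := by
  rcases eq_or_ne W ⊥ with rfl | hne
  · rw [orientationPreserving_bot]
    exact hW.isReflectionRotationGroup
  have := hW.1
  obtain ⟨v, hv⟩ := hW.roots_nonempty hne
  refine isReflectionRotationGroup_of_eq_closure
    (Finite.Set.subset (W : Set (O n)) (orientationPreserving_le W))
    ((congrArg _ hW.eq_closure_roots).trans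
      (orientationPreserving_closure_reflectionAlong (fun u hu => hu.1) hv)) ?_
  rintro _ ⟨u, hu, rfl⟩
  exact or_iff_not_imp_left.2 fun hne => .inr (isRotation_reflectionAlong_mul hu.1 hv.1 hne)

theorem extendBy_eq_sup (G : Subgroup (O n)) (h : O n) :
    extendBy G h = G ⊔ Subgroup.zpowers h := by
  rw [extendBy, Subgroup.closure_union, Subgroup.closure_eq, ← Subgroup.zpowers_eq_closure]

theorem le_extendBy (G : Subgroup (O n)) (h : O n) : G ≤ extendBy G h := fun _ hg =>
  Subgroup.subset_closure (Or.inl hg)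

theorem mem_extendBy (G : Subgroup (O n)) (h : O n) : h ∈ extendBy G h :=
  Subgroup.subset_closure (Or.inr rfl)

theorem extendBy_le : extendBy G h ≤ K ↔ G ≤ K ∧ h ∈ K := by
  rw [extendBy_eq_sup, sup_le_iff, Subgroup.zpowers_le]

theorem orientationPreserving_extendBy_le (W : Subgroup (O n)) (h : O n) :
    extendBy (orientationPreserving W) h ≤ extendBy W h :=
  extendBy_le.2 ⟨(orientationPreserving_le W).trans (le_extendBy W h), mem_extendBy W h⟩

theorem IsReflectionRotationGroup.extendBy (hG : IsReflectionRotationGroup G) (hh : IsRotation h)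
    (hfin : Finite (extendBy G h)) : IsReflectionRotationGroup (PLQuot.extendBy G h) := by
  refine ⟨hfin, le_antisymm (extendBy_le.2 ⟨?_, ?_⟩) ((Subgroup.closure_le _).2 fun _ hg => hg.1)⟩
  · exact hG.2.trans_le (Subgroup.closure_mono fun g hg => ⟨le_extendBy G h hg.1, hg.2⟩)
  · exact Subgroup.subset_closure ⟨mem_extendBy G h, .inr hh⟩

theorem IsRotation.detHom_eq_one_of_mem_extendBy (hh : IsRotation h) {g : O n}
    (hg : g ∈ extendBy (orientationPreserving W) h) : detHom n g = 1 := by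
  have hle : extendBy (orientationPreserving W) h ≤ (detHom n).ker :=
    extendBy_le.2 ⟨fun _ hk => hk.2, hh.detHom_eq_one⟩
  exact hle hg

end Generation

/-! ### The groups attached to a reflection group -/

section Main

variable {n : ℕ}

theorem IsLinearization.mainTheoremHoldsFor_of_isReflection {H G : Subgroup (O n)}
    {F : Euc n → Euc n} {r : G →* O n} {τ : O n} (L : IsLinearization H G F r)
    (hG : IsReflectionRotationGroup G) (hτ : IsReflection τ)
    (hr : ∀ k, r k ∈ Subgroup.zpowers τ) (hs : ∃ s : G, IsReflection (s : O n) ∧ r s = τ) :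
    MainTheoremHoldsFor G := by
  obtain ⟨Q, hQ, hrange⟩ := hτ.exists_isOrbitMap_zpowers
  obtain ⟨s, hs_refl, hsτ⟩ := hs
  have hlift : ∀ k ∈ Subgroup.zpowers τ, ∃ g ∈ G, ∀ x, F (g x) = k (F x) := by
    rintro _ ⟨m, rfl⟩
    refine ⟨(s ^ m : G), (s ^ m).2, fun x => ?_⟩
    rw [L.map_eq, map_zpow, hsτ]
  have hQF := hQ.comp L.isOrbitMap L.le (fun g hg => ⟨r ⟨g, hg⟩, hr _, L.map_eq ⟨g, hg⟩⟩) hlift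
  refine hQF.mainTheoremHoldsFor_of_range_eq_halfSpace ?_ hG ⟨s, s.2, hs_refl⟩
  rw [L.surjective.range_comp, hrange]

theorem IsReflectionGroup.exists_isReflection {W : Subgroup (O n)} (hW : IsReflectionGroup W)
    (hne : W ≠ ⊥) : ∃ s ∈ W, IsReflection s :=
  let ⟨_, hv⟩ := hW.roots_nonempty hne
  ⟨_, hv.2, isReflection_reflectionAlong hv.1⟩

theorem IsReflectionGroup.mainTheoremHoldsFor {W : Subgroup (O n)} (hW : IsReflectionGroup W) :
    MainTheoremHoldsFor W ∧ MainTheoremHoldsFor (orientationPreserving W) ∧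
      PLLinearizationApplies (orientationPreserving W) W := by
  have := hW.1
  have : Finite (orientationPreserving W) :=
    Finite.Set.subset (W : Set (O n)) (orientationPreserving_le W)
  obtain ⟨F, r, e, L, -⟩ := exists_isReflectionLinearization hW le_rfl Subgroup.le_normalizer 1
  have hplus : MainTheoremHoldsFor (orientationPreserving W) :=
    L.isOrbitMap.mainTheoremHoldsFor_of_surjective L.surjective
      hW.isReflectionRotationGroup_orientationPreserving
      (not_exists_isReflection_of_detHom_eq_one fun _ hg => hg.2)
  refine ⟨?_, hplus, L.plLinearizationApplies⟩
  rcases eq_or_ne W ⊥ with rfl | hne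
  · rwa [orientationPreserving_bot] at hplus
  · obtain ⟨s, hs, hs_refl⟩ := hW.exists_isReflection hne
    refine L.mainTheoremHoldsFor_of_isReflection hW.isReflectionRotationGroup
      (L.isReflection_reflectionAlong hne) (fun k => ?_)
      ⟨⟨s, hs⟩, hs_refl, L.apply_of_isReflection hs hs_refl⟩
    rw [L.apply_of_mem k k.2]
    exact detReflection_mem_zpowers e k

theorem IsLinearization.subgroupOf_extendBy {H G : Subgroup (O n)} [Finite H]
    {F : Euc n → Euc n} {r : G →* O n} (L : IsLinearization H G F r) (h : G) :
    (extendBy H (h : O n)).subgroupOf G = (Subgroup.zpowers (r h)).comap r := by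
  have hzpowers : (Subgroup.zpowers (h : O n)).subgroupOf G = Subgroup.zpowers h := by
    rw [← G.subtype_apply h, ← MonoidHom.map_zpowers]
    exact Subgroup.comap_map_eq_self_of_injective G.subtype_injective _
  rw [← MonoidHom.map_zpowers, Subgroup.comap_map_eq, L.ker_eq, extendBy_eq_sup,
    Subgroup.subgroupOf_sup L.le (Subgroup.zpowers_le.2 h.2), hzpowers, sup_comm]

theorem apply_mem_of_extendBy {W : Subgroup (O n)} {h : O n} {A : Type*} [Group A]
    {f : extendBy W h →* A} {K : Subgroup A} (hW : ∀ k : extendBy W h, (k : O n) ∈ W → f k ∈ K)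
    (hh : f ⟨h, mem_extendBy W h⟩ ∈ K) (k : extendBy W h) : f k ∈ K := by
  have hle : extendBy W h ≤ (K.comap f).map (extendBy W h).subtype :=
    extendBy_le.2 ⟨fun w hw => ⟨⟨w, le_extendBy W h hw⟩, hW _ hw, rfl⟩, ⟨_, hh, rfl⟩⟩
  obtain ⟨l, hl, hlk⟩ := hle k.2
  rwa [← Subtype.ext hlk]

/- The generator `reflectionAlong u * reflectionAlong v` is the orientation preserving part of the
dihedral group, which is normalized by the reflection along `e`. -/
theorem exists_isLinearization_zpowers {u v e : Euc n} (hu : ‖u‖ = 1) (hv : ‖v‖ = 1)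
    (huv : IsOfFinOrder (reflectionAlong u * reflectionAlong v))
    (he : e = u ∨ ⟪u, e⟫ = 0 ∧ ⟪v, e⟫ = 0) :
    ∃ (G : Subgroup (O n)) (heG : reflectionAlong e ∈ G) (F : Euc n → Euc n) (r : G →* O n),
      IsLinearization (Subgroup.zpowers (reflectionAlong u * reflectionAlong v)) G F r ∧
      (IsReflection (reflectionAlong e) → IsReflection (r ⟨reflectionAlong e, heG⟩)) := by
  have hD := isReflectionGroup_dihedral hu hv huv
  have heN := zpowers_reflectionAlong_le_normalizer_dihedral he
  have := hD.1
  have := finite_zpowers_reflectionAlong e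
  obtain ⟨G, hG⟩ : ∃ G, G = dihedral u v ⊔ Subgroup.zpowers (reflectionAlong e) := ⟨_, rfl⟩
  have hDG : dihedral u v ≤ G := hG ▸ le_sup_left
  have hGN : G ≤ Subgroup.normalizer (dihedral u v : Set (O n)) :=
    hG ▸ sup_le Subgroup.le_normalizer heN
  have : Finite G := hG ▸ finite_sup_of_le_normalizer heN
  have heG : reflectionAlong e ∈ G := hG ▸ Subgroup.mem_sup_right (Subgroup.mem_zpowers _)
  obtain ⟨F, r, e', L, w, g, hγ⟩ :=
    exists_isReflectionLinearization hD hDG hGN ⟨reflectionAlong e, heG⟩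
  have hL := L.toIsLinearization
  rw [orientationPreserving_dihedral hu hv] at hL
  exact ⟨G, heG, F, r, hL, fun he_refl => L.isReflection_apply hγ he_refl⟩

variable {W : Subgroup (O n)} {h : O n}

theorem IsReflectionLinearization.exists_isLinearization_extendBy [Finite (extendBy W h)]
    {F : Euc n → Euc n} {r : extendBy W h →* O n} {u v e : Euc n}
    (L : IsReflectionLinearization W (extendBy W h) F r e) (hu : ‖u‖ = 1) (hv : ‖v‖ = 1)
    (hr : r ⟨h, mem_extendBy W h⟩ = reflectionAlong u * reflectionAlong v)
    (he : e = u ∨ ⟪u, e⟫ = 0 ∧ ⟪v, e⟫ = 0) :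
    ∃ F r τ, IsLinearization (extendBy (orientationPreserving W) h) (extendBy W h) F r ∧
      (∀ k : extendBy W h, (k : O n) ∈ W → detHom n (k : O n) = -1 → r k = τ) ∧
      (W ≠ ⊥ → IsReflection τ) := by
  have : Finite (orientationPreserving W) :=
    Finite.Set.subset (extendBy W h : Set (O n)) L.le
  have huv : IsOfFinOrder (reflectionAlong u * reflectionAlong v) :=
    hr ▸ r.isOfFinOrder (isOfFinOrder_of_finite _)
  obtain ⟨G, heG, F', r', L', hτ⟩ := exists_isLinearization_zpowers hu hv huv he
  have hrG : ∀ k, r k ∈ G := by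
    refine apply_mem_of_extendBy (fun k hk => ?_) ?_
    · rw [L.apply_of_mem k hk]
      exact Subgroup.zpowers_le.2 heG (detReflection_mem_zpowers e k)
    · rw [hr]
      exact L'.le (Subgroup.mem_zpowers _)
  refine ⟨F' ∘ F, r'.comp (r.codRestrict G hrG), r' ⟨reflectionAlong e, heG⟩,
    L.comp L' hrG (orientationPreserving_extendBy_le W h) ?_ ?_, fun k hk hdet => ?_,
    fun hne => hτ (L.isReflection_reflectionAlong hne)⟩
  · rw [← hr]
    exact L.subgroupOf_extendBy ⟨h, mem_extendBy W h⟩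
  · rw [Subgroup.zpowers_le, ← hr]
    exact ⟨_, rfl⟩
  · refine congrArg r' (Subtype.ext ?_)
    exact (L.apply_of_mem k hk).trans (detReflection_of_detHom_eq_neg_one e hdet)

theorem IsLinearization.apply_mem_zpowers_of_extendBy {F : Euc n → Euc n}
    {r : extendBy W h →* O n} {τ : O n}
    (L : IsLinearization (extendBy (orientationPreserving W) h) (extendBy W h) F r)
    (hτ : ∀ k : extendBy W h, (k : O n) ∈ W → detHom n (k : O n) = -1 → r k = τ)
    (k : extendBy W h) : r k ∈ Subgroup.zpowers τ := by
  refine apply_mem_of_extendBy (fun k hk => ?_) ?_ k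
  · rcases detHom_eq_one_or_eq_neg_one (k : O n) with hdet | hdet
    · rw [L.apply_eq_one_of_mem (le_extendBy _ h (mem_orientationPreserving.2 ⟨hk, hdet⟩))]
      exact Subgroup.one_mem _
    · rw [hτ k hk hdet]
      exact Subgroup.mem_zpowers τ
  · rw [L.apply_eq_one_of_mem (mem_extendBy (orientationPreserving W) h)]
    exact Subgroup.one_mem _

theorem IsReflectionGroup.mainTheoremHoldsFor_extendBy (hW : IsReflectionGroup W)
    (hh : IsRotation h) (hhW : h ∉ W) (hN : h ∈ Subgroup.normalizer (W : Set (O n)))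
    (hfin : Finite (extendBy W h)) :
    MainTheoremHoldsFor (extendBy (orientationPreserving W) h) ∧
      MainTheoremHoldsFor (extendBy W h) ∧
      PLLinearizationApplies (orientationPreserving W) (extendBy W h) ∧
      PLLinearizationApplies (extendBy (orientationPreserving W) h) (extendBy W h) := by
  obtain ⟨F, r, e, L, w, g, hγ⟩ := exists_isReflectionLinearization hW (le_extendBy W h)
    (extendBy_le.2 ⟨Subgroup.le_normalizer, hN⟩) ⟨h, mem_extendBy W h⟩
  obtain ⟨u, v, hu, hv, hr, he⟩ := L.exists_apply_eq_reflectionAlong_mul hγ hh hhW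
  obtain ⟨F', r', τ, L', hr', hτ⟩ := L.exists_isLinearization_extendBy hu hv hr he
  have : Finite (orientationPreserving W) := Finite.Set.subset (extendBy W h : Set (O n)) L.le
  have : Finite (extendBy (orientationPreserving W) h) :=
    Finite.Set.subset (extendBy W h : Set (O n)) L'.le
  have hplus : MainTheoremHoldsFor (extendBy (orientationPreserving W) h) :=
    L'.isOrbitMap.mainTheoremHoldsFor_of_surjective L'.surjective
      (hW.isReflectionRotationGroup_orientationPreserving.extendBy hh this)
      (not_exists_isReflection_of_detHom_eq_one fun _ hg => hh.detHom_eq_one_of_mem_extendBy hg)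
  refine ⟨hplus, ?_, L.plLinearizationApplies, L'.plLinearizationApplies⟩
  rcases eq_or_ne W ⊥ with rfl | hne
  · rwa [orientationPreserving_bot] at hplus
  · obtain ⟨s, hs, hs_refl⟩ := hW.exists_isReflection hne
    exact L'.mainTheoremHoldsFor_of_isReflection (hW.isReflectionRotationGroup.extendBy hh hfin)
      (hτ hne) (L'.apply_mem_zpowers_of_extendBy hr')
      ⟨⟨s, le_extendBy W h hs⟩, hs_refl, hr' _ hs hs_refl.detHom_eq_neg_one⟩

end Main

/-! ### The reflection groups of type `BC_n` and `D_n` -/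

section SignedPermutations

variable {n : ℕ}

/-- The group of orthogonal transformations that map a set of vectors onto itself. -/
def orthogonalStabilizer (S : Set (Euc n)) : Subgroup (O n) where
  carrier := {g | ∀ x, g x ∈ S ↔ x ∈ S}
  one_mem' _ := Iff.rfl
  mul_mem' {a b} ha hb x := (ha (b x)).trans (hb x)
  inv_mem' {a} ha x := by rw [← ha, LinearIsometryEquiv.inv_def, a.apply_symm_apply]

theorem reflectionAlong_mem_orthogonalStabilizer {S : Set (Euc n)} {v : Euc n}
    (hv : ∀ x ∈ S, reflectionAlong v x ∈ S) : reflectionAlong v ∈ orthogonalStabilizer S :=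
  fun x => ⟨fun hx => reflectionAlong_reflectionAlong v x ▸ hv _ hx, hv x⟩

theorem finite_orthogonalStabilizer {S : Set (Euc n)} (hS : S.Finite)
    (hspan : Submodule.span ℝ S = ⊤) : Finite (orthogonalStabilizer S) := by
  have := hS.to_subtype
  refine Finite.of_injective (fun (g : orthogonalStabilizer S) (x : S) =>
    (⟨(g : O n) x, (g.2 x).2 x.2⟩ : S)) fun g k hgk => Subtype.ext ?_
  have hlin : ((g : O n).toLinearEquiv : Euc n →ₗ[ℝ] Euc n) = (k : O n).toLinearEquiv :=
    LinearMap.ext_on hspan fun x hx => congrArg Subtype.val (congrFun hgk ⟨x, hx⟩)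
  exact LinearIsometryEquiv.ext fun x => LinearMap.congr_fun hlin x

/-- The vectors `±e_i`. -/
def signedBasis (n : ℕ) : Set (Euc n) := {x | ∃ i, x = stdVec i ∨ x = -stdVec i}

theorem stdVec_mem_signedBasis (i : Fin n) : stdVec i ∈ signedBasis n := ⟨i, .inl rfl⟩

theorem neg_mem_signedBasis {x : Euc n} (hx : x ∈ signedBasis n) : -x ∈ signedBasis n := by
  obtain ⟨i, rfl | rfl⟩ := hx
  exacts [⟨i, .inr rfl⟩, ⟨i, .inl (neg_neg _)⟩]

theorem norm_eq_one_of_mem_signedBasis {x : Euc n} (hx : x ∈ signedBasis n) : ‖x‖ = 1 := by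
  obtain ⟨i, rfl | rfl⟩ := hx <;> simp

theorem finite_signedBasis : (signedBasis n).Finite := by
  refine ((finite_range fun i : Fin n => (stdVec i : Euc n)).union
    (finite_range fun i : Fin n => -(stdVec i : Euc n))).subset ?_
  rintro x ⟨i, rfl | rfl⟩
  exacts [.inl ⟨i, rfl⟩, .inr ⟨i, rfl⟩]

theorem span_signedBasis : Submodule.span ℝ (signedBasis n) = ⊤ := by
  rw [eq_top_iff, ← (EuclideanSpace.basisFun (Fin n) ℝ).toBasis.span_eq]
  refine Submodule.span_mono ?_
  rintro _ ⟨i, rfl⟩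
  simpa using stdVec_mem_signedBasis i

theorem inner_stdVec (i j : Fin n) : ⟪(stdVec i : Euc n), stdVec j⟫ = if i = j then 1 else 0 := by
  simp [EuclideanSpace.inner_single_left]

theorem eq_or_eq_neg_or_inner_eq_zero {x y : Euc n} (hx : x ∈ signedBasis n)
    (hy : y ∈ signedBasis n) : y = x ∨ y = -x ∨ ⟪x, y⟫ = 0 := by
  obtain ⟨i, hx⟩ := hx
  obtain ⟨j, hy⟩ := hy
  rcases eq_or_ne i j with rfl | hij
  · rcases hx with rfl | rfl <;> rcases hy with rfl | rfl <;> simp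
  · right; right
    rcases hx with rfl | rfl <;> rcases hy with rfl | rfl <;>
      simp [inner_neg_left, inner_neg_right, inner_stdVec, hij]

theorem reflectionAlong_sub_apply_mem_signedBasis {a b x : Euc n} (ha : a ∈ signedBasis n)
    (hb : b ∈ signedBasis n) (hx : x ∈ signedBasis n) :
    reflectionAlong (a - b) x ∈ signedBasis n := by
  have hab : reflectionAlong (a - b) a = b := Submodule.reflection_sub
    ((norm_eq_one_of_mem_signedBasis ha).trans (norm_eq_one_of_mem_signedBasis hb).symm)
  have hba : reflectionAlong (a - b) b = a :=
    (congrArg _ hab.symm).trans (reflectionAlong_reflectionAlong (a - b) a)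
  rcases eq_or_eq_neg_or_inner_eq_zero ha hx with rfl | rfl | hax
  · rwa [hab]
  · rw [map_neg, hab]
    exact neg_mem_signedBasis hb
  rcases eq_or_eq_neg_or_inner_eq_zero hb hx with rfl | rfl | hbx
  · rwa [hba]
  · rw [map_neg, hba]
    exact neg_mem_signedBasis ha
  · rwa [reflectionAlong_of_inner_eq_zero (by rw [inner_sub_left, hax, hbx, sub_zero])]

theorem reflectionAlong_sub_mem_orthogonalStabilizer {a b : Euc n} (ha : a ∈ signedBasis n)
    (hb : b ∈ signedBasis n) :
    reflectionAlong (a - b) ∈ orthogonalStabilizer (signedBasis n) :=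
  reflectionAlong_mem_orthogonalStabilizer fun _ hx =>
    reflectionAlong_sub_apply_mem_signedBasis ha hb hx

/-- The reflections exchanging two orthogonal vectors of the form `±e_i`; they are the reflections
that generate `W(D_n)`, in a form that does not depend on signs. -/
def exchangeReflections (n : ℕ) : Set (O n) :=
  {g | ∃ a ∈ signedBasis n, ∃ b ∈ signedBasis n, ⟪a, b⟫ = 0 ∧ g = reflectionAlong (a - b)}

theorem weylD_eq_closure_exchangeReflections :
    weylD n = Subgroup.closure (exchangeReflections n) := by
  refine congrArg _ (Subset.antisymm ?_ ?_)
  · rintro _ ⟨i, j, hij, rfl | rfl⟩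
    · exact ⟨_, stdVec_mem_signedBasis i, _, stdVec_mem_signedBasis j,
        by rw [inner_stdVec, if_neg hij], rfl⟩
    · exact ⟨_, stdVec_mem_signedBasis i, _, neg_mem_signedBasis (stdVec_mem_signedBasis j),
        by rw [inner_neg_right, inner_stdVec, if_neg hij, neg_zero], by rw [sub_neg_eq_add]⟩
  · rintro _ ⟨a, ⟨i, ha⟩, b, ⟨j, hb⟩, hab, rfl⟩
    have hij : i ≠ j := by
      rintro rfl
      rcases ha with rfl | rfl <;> rcases hb with rfl | rfl <;>
        simp [inner_neg_left, inner_neg_right] at hab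
    refine ⟨i, j, hij, ?_⟩
    rcases ha with rfl | rfl <;> rcases hb with rfl | rfl
    · exact .inl rfl
    · exact .inr (by rw [sub_neg_eq_add])
    · exact .inr (by rw [← reflectionAlong_neg, neg_sub, sub_neg_eq_add, add_comm])
    · exact .inl (by rw [← neg_add', reflectionAlong_neg, ← sub_eq_add_neg])

theorem isReflection_of_mem_exchangeReflections {g : O n} (hg : g ∈ exchangeReflections n) :
    IsReflection g := by
  obtain ⟨a, ha, b, hb, hab, rfl⟩ := hg
  refine fixCodim_reflectionAlong (sub_ne_zero.2 ?_)
  rintro rfl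
  exact ne_zero_of_norm_eq_one (norm_eq_one_of_mem_signedBasis ha) (inner_self_eq_zero.1 hab)

theorem weylD_le_weylBC (n : ℕ) : weylD n ≤ weylBC n := fun _ hg =>
  Subgroup.subset_closure (.inl hg)

theorem weylBC_le_orthogonalStabilizer : weylBC n ≤ orthogonalStabilizer (signedBasis n) := by
  refine (Subgroup.closure_le _).2 (union_subset (SetLike.coe_subset_coe.2 ?_) ?_)
  · rw [weylD_eq_closure_exchangeReflections, Subgroup.closure_le]
    rintro _ ⟨a, ha, b, hb, -, rfl⟩
    exact reflectionAlong_sub_mem_orthogonalStabilizer ha hb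
  · rintro _ ⟨i, rfl⟩
    have hi := stdVec_mem_signedBasis i
    rw [← reflectionAlong_smul two_ne_zero, two_smul, ← sub_neg_eq_add]
    exact reflectionAlong_sub_mem_orthogonalStabilizer hi (neg_mem_signedBasis hi)

theorem finite_weylBC (n : ℕ) : Finite (weylBC n) :=
  have := finite_orthogonalStabilizer finite_signedBasis (span_signedBasis (n := n))
  Finite.Set.subset (orthogonalStabilizer (signedBasis n) : Set (O n))
    weylBC_le_orthogonalStabilizer

theorem isReflectionGroup_weylD (n : ℕ) : IsReflectionGroup (weylD n) := by
  have := finite_weylBC n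
  have hfin : Finite (weylD n) := Finite.Set.subset (weylBC n : Set (O n)) (weylD_le_weylBC n)
  rw [weylD_eq_closure_exchangeReflections] at hfin ⊢
  exact isReflectionGroup_closure hfin fun g hg => isReflection_of_mem_exchangeReflections hg

theorem weylBC_le_normalizer (n : ℕ) :
    weylBC n ≤ Subgroup.normalizer (weylD n : Set (O n)) := by
  rw [weylD_eq_closure_exchangeReflections, Subgroup.le_normalizer_closure_iff]
  rintro g hg _ ⟨a, ha, b, hb, hab, rfl⟩
  have hmem {x : Euc n} (hx : x ∈ signedBasis n) : g x ∈ signedBasis n :=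
    (weylBC_le_orthogonalStabilizer hg x).2 hx
  rw [mul_reflectionAlong_mul_inv, map_sub]
  exact Subgroup.subset_closure ⟨_, hmem ha, _, hmem hb, by rwa [g.inner_map_map], rfl⟩

theorem plLinearizationApplies_weylBC (n : ℕ) :
    PLLinearizationApplies (orientationPreserving (weylD n)) (weylBC n) := by
  have := finite_weylBC n
  obtain ⟨F, r, e, L, -⟩ := exists_isReflectionLinearization (isReflectionGroup_weylD n)
    (weylD_le_weylBC n) (weylBC_le_normalizer n) 1
  have : Finite (orientationPreserving (weylD n)) :=
    Finite.Set.subset (weylBC n : Set (O n)) L.le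
  exact L.plLinearizationApplies

end SignedPermutations

end PLQuot

end

open PLQuot

theorem mainTheorem6 :
    (∀ (n : ℕ) (W : Subgroup (O n)), IsReflectionGroup W →
      MainTheoremHoldsFor W ∧
      MainTheoremHoldsFor (orientationPreserving W) ∧
      PLLinearizationApplies (orientationPreserving W) W ∧
      ∀ h : O n, IsRotation h → h ∉ W → h ∈ Subgroup.normalizer (W : Set (O n)) →
        Finite (extendBy W h) →
          MainTheoremHoldsFor (extendBy (orientationPreserving W) h) ∧
          MainTheoremHoldsFor (extendBy W h) ∧
          PLLinearizationApplies (orientationPreserving W) (extendBy W h) ∧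
          PLLinearizationApplies (extendBy (orientationPreserving W) h) (extendBy W h)) ∧
    ∀ n : ℕ, PLLinearizationApplies (orientationPreserving (weylD n)) (weylBC n) := by
  refine ⟨fun n W hW => ?_, plLinearizationApplies_weylBC⟩
  obtain ⟨hW_main, hWplus_main, hW_lin⟩ := hW.mainTheoremHoldsFor
  exact ⟨hW_main, hWplus_main, hW_lin, fun h hh hhW hN hfin =>
    hW.mainTheoremHoldsFor_extendBy hh hhW hN hfin⟩
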